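/- A closed subgroup $H<\mathrm{GL}(d,\mathbb R)$ is called \emph{irreducibly admissible} if the quasi-regular representation $[\pi(x,h)f](y)=|\det h|^{-1/2}f(h^{-1}(y-x))$ of $\mathbb R^d\rtimes H$ on $L^2(\mathbb R^d)$ is irreducible and square integrable, i.e. $(x,h)\mapsto\langle\psi,\pi(x,h)\psi\rangle$ is in $L^2(\mathbb R^d\rtimes H,\,|\det h|^{-1}dx\,dh)$ for some $\psi\neq0$, where $dh$ is a left Haar measure on $H$. Let $T(d,\mathbb R)$ be the group of upper triangular matrices with ones on the diagonal. An irreducibly admissible $H$ is a \emph{generalized shearlet dilation group} with \emph{shearing subgroup} $S$ if there are closed subgroups $S,D<H$ such that $S$ is a connected closed abelian subgroup of $T(d,\mathbb R)$, $D=\{\exp(rY):r\in\mathbb R\}$ for a diagonal matrix $Y$, and every $h\in H$ can be written uniquely as $h=\pm\delta s$ with a sign $\pm$, $\delta\in D$ and $s\in S$. A \emph{shearing group in dimension $d$} is a subgroup of $\mathrm{GL}(d,\mathbb R)$ that is the shearing subgroup of some generalized shearlet dilation group. Conjugacy means conjugacy inside $\mathrm{GL}(d,\mathbb R)$. For a shearing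 group $S$, let $\mathcal A_S$ be the associative algebra with unit generated by $S$ in $\mathbb R^{d\times d}$, let $\mathcal N$ be the set of its nilpotent elements, and let $n(\mathcal A_S)$ (the nilpotency class) be the least $n$ such that all products of $n$ elements of $\mathcal N$ vanish. The \emph{standard} group in dimension $d$ consists of all matrices $I+\sum_{j=2}^{d}s_{j-1}E_{1j}$, and the \emph{Toeplitz} group of all upper triangular Toeplitz matrices with ones on the diagonal. For $a\in\{-1,0,1\}$ let $$H_a=\left\{\begin{pmatrix}s&t_1&t_2&t_3\\0&s&0&t_1\\0&0&s&a t_2\\0&0&0&s\end{pmatrix}: s\in\mathbb R\setminus\{0\},\ t_1,t_2,t_3\in\mathbb R\right\},\qquad S_a=H_a\cap T(4,\mathbb R).$$ \textbf{Theorem.} (1) In dimension 3, the standard and the Toeplitz group are shearing groups and are not conjugate. For every shearing group $S$ in dimension 3, either $n(\mathcal A_S)=2$ and $S$ is conjugate to the standard group, or $n(\mathcal A_S)=3$ and $S$ is conjugate to the Toeplitz group. (2) In dimension 4, the standard and the Toeplitz group are shearing groups, and for $a\in\{-1,0,1\}$, $H_a$ is a generalized shearlet dilation group with shearing subgroup $S_a$.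 The five shearing groups (standard, Toeplitz, $S_{-1}$, $S_0$, $S_1$) are pairwise non-conjugate. For every shearing group $S$ in dimension 4, either $n(\mathcal A_S)=2$ and $S$ is conjugate to the standard group, or $n(\mathcal A_S)=4$ and $S$ is conjugate to the Toeplitz group, or $n(\mathcal A_S)=3$ and $S$ is conjugate to $S_a$ for a unique $a\in\{-1,0,1\}$. (3) For $a\in\{-1,0,1\}$ let $\mathcal B_a=\mathbb R[X,Y]/(X^3,\,Y^2-aX^2,\,XY)$. There is a linear isomorphism $\psi:\mathcal B_a\to\mathbb R^4$ sending (the classes of) $1,X,Y,X^2$ to $e_1,e_2,e_3,e_4$, and $H_a$ is the set of all $h\in\mathrm{GL}(4,\mathbb R)$ for which there is a unit $u\in\mathcal B_a^\times$ with $h^T\xi=\psi(u\,\psi^{-1}(\xi))$ for all $\xi\in\mathbb R^4$. -/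

import Mathlib

open MeasureTheory Matrix

noncomputable section

namespace ShearletGroups

/-! ### Dilation groups and the quasi-regular representation -/

/-- The matrix group `GL(d, ℝ)`. -/
abbrev GLR (d : ℕ) := GL (Fin d) ℝ

/-- Euclidean space `ℝ^d`. -/
abbrev E (d : ℕ) := EuclideanSpace ℝ (Fin d)

/-- The complex Hilbert space `L²(ℝ^d)`. -/
abbrev L2 (d : ℕ) := Lp ℂ 2 (volume : Measure (E d))

/-- The representative `y ↦ |det h|^{-1/2} f (h⁻¹ (y - x))`. -/
def quasiRegularFun {d : ℕ} (x : E d) (h : GLR d) (f : E d → ℂ) : E d → ℂ := fun y =>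
  ((|(h : Matrix (Fin d) (Fin d) ℝ).det| ^ (-(1 / 2) : ℝ) : ℝ) : ℂ) *
    f (Matrix.toEuclideanLin ((h⁻¹ : GLR d) : Matrix (Fin d) (Fin d) ℝ) (y - x))

theorem memLp_quasiRegularFun {d : ℕ} (x : E d) (h : GLR d) {f : E d → ℂ}
    (hf : MemLp f 2 volume) : MemLp (quasiRegularFun x h f) 2 volume := by
  refine MemLp.const_mul ?_ _
  set L := Matrix.toEuclideanLin ((h⁻¹ : GLR d) : Matrix (Fin d) (Fin d) ℝ) with hL
  have hdet : LinearMap.det L ≠ 0 := by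
    have h1 : LinearMap.det L = ((h⁻¹ : GLR d) : Matrix (Fin d) (Fin d) ℝ).det := by
      rw [hL, Matrix.toEuclideanLin_eq_toLin_orthonormal, LinearMap.det_toLin]
    rw [h1]
    exact (Matrix.isUnit_iff_isUnit_det _).1 (h⁻¹ : GLR d).isUnit |>.ne_zero
  have hmap : Measure.map L (volume : Measure (E d)) =
      ENNReal.ofReal |(LinearMap.det L)⁻¹| • volume :=
    Measure.map_linearMap_addHaar_eq_smul_addHaar volume hdet
  have hLm : Measurable L := (LinearMap.continuous_of_finiteDimensional L).measurable
  have h2 : MemLp f 2 (Measure.map L volume) := by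
    rw [hmap]
    exact hf.smul_measure ENNReal.ofReal_ne_top
  have h3 : MemLp (f ∘ L) 2 volume := h2.comp_of_map hLm.aemeasurable
  exact h3.comp_measurePreserving (measurePreserving_sub_right volume x)

/-- The quasi-regular representation of `ℝ^d ⋊ H` on `L²(ℝ^d)`:
`(π(x,h) f)(y) = |det h|^{-1/2} f (h⁻¹ (y - x))`. -/
def quasiRegular {d : ℕ} (x : E d) (h : GLR d) (f : L2 d) : L2 d :=
  (memLp_quasiRegularFun x h (Lp.memLp f)).toLp (quasiRegularFun x h f)

/-- The quasi-regular representation of `ℝ^d ⋊ H` is irreducible: the only closed invariant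
subspaces are the trivial ones. -/
def IsQuasiRegularIrreducible {d : ℕ} (H : Subgroup (GLR d)) : Prop :=
  ∀ K : Submodule ℂ (L2 d), IsClosed (K : Set (L2 d)) →
    (∀ x : E d, ∀ h ∈ H, ∀ f ∈ K, quasiRegular x h f ∈ K) → K = ⊥ ∨ K = ⊤

/-- Some nonzero `ψ ∈ L²(ℝ^d)` has a matrix coefficient `(x,h) ↦ ⟨ψ, π(x,h) ψ⟩` that is square
integrable for the left Haar measure `|det h|⁻¹ dx dh` of `ℝ^d ⋊ H`, where `dh` is a left Haar
measure of `H` (unique up to scaling, so that the choice of `dh` does not matter). -/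
def HasAdmissibleVector {d : ℕ} (H : Subgroup (GLR d)) : Prop :=
  letI : MeasurableSpace H := borel H
  ∃ μ : Measure H, μ.IsHaarMeasure ∧ ∃ ψ : L2 d, ψ ≠ 0 ∧
    MemLp (fun p : E d × H => inner ℂ ψ (quasiRegular p.1 (p.2 : GLR d) ψ)) 2
      (((volume : Measure (E d)).prod μ).withDensity fun p =>
        ENNReal.ofReal (|((p.2 : GLR d) : Matrix (Fin d) (Fin d) ℝ).det|⁻¹))

/-- Irreducibly admissible dilation groups: closed matrix groups whose quasi-regular
representation is irreducible and square integrable. -/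
structure IsIrreduciblyAdmissible {d : ℕ} (H : Subgroup (GLR d)) : Prop where
  isClosed : IsClosed (H : Set (GLR d))
  irreducible : IsQuasiRegularIrreducible H
  squareIntegrable : HasAdmissibleVector H

/-! ### Generalized shearlet dilation groups -/

theorem unitriangular_mul {d : ℕ} {A B : Matrix (Fin d) (Fin d) ℝ}
    (hA : (∀ i, A i i = 1) ∧ ∀ i j, j < i → A i j = 0)
    (hB : ∀ i j, j < i → B i j = 0) (i : Fin d) : (A * B) i i = B i i := by
  rw [Matrix.mul_apply, Finset.sum_eq_single i]
  · rw [hA.1, one_mul]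
  · intro k _ hk
    rcases lt_or_gt_of_ne hk with h | h
    · rw [hA.2 _ _ h, zero_mul]
    · rw [hB _ _ h, mul_zero]
  · simp

/-- `T(d, ℝ)`: upper triangular matrices with ones on the diagonal. -/
def unitriangular (d : ℕ) : Subgroup (GLR d) where
  carrier := {g | (∀ i, (g : Matrix (Fin d) (Fin d) ℝ) i i = 1) ∧
    ∀ i j, j < i → (g : Matrix (Fin d) (Fin d) ℝ) i j = 0}
  one_mem' := by
    refine ⟨fun i => by simp, fun i j hij => ?_⟩
    simp [Matrix.one_apply_ne hij.ne']
  mul_mem' := by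
    intro a b ha hb
    refine ⟨fun i => ?_, ?_⟩
    · rw [Units.val_mul, unitriangular_mul ha hb.2, hb.1]
    · have h := Matrix.BlockTriangular.mul (b := id) (M := a.val) (N := b.val)
        (fun i j hij => ha.2 i j hij) (fun i j hij => hb.2 i j hij)
      exact fun i j hij => h hij
  inv_mem' := by
    intro a ha
    have hT : ∀ i j, j < i → ((a⁻¹ : GLR d) : Matrix (Fin d) (Fin d) ℝ) i j = 0 := by
      let _ : Invertible a.val := a.invertible
      have h := Matrix.blockTriangular_inv_of_blockTriangular (b := id) (M := a.val)
        (fun i j hij => ha.2 i j hij)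
      intro i j hij
      rw [Matrix.coe_units_inv]
      exact h hij
    refine ⟨fun i => ?_, hT⟩
    have h := unitriangular_mul ha hT i
    rw [← h, ← Units.val_mul, mul_inv_cancel, Units.val_one, Matrix.one_apply_eq]

/-- `H` is a generalized shearlet dilation group with shearing subgroup `S`. -/
structure IsShearletGroupWith {d : ℕ} (H S : Subgroup (GLR d)) : Prop where
  admissible : IsIrreduciblyAdmissible H
  le : S ≤ H
  isClosed : IsClosed (S : Set (GLR d))
  isConnected : IsConnected (S : Set (GLR d))
  abelian : ∀ a ∈ S, ∀ b ∈ S, a * b = b * a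
  le_unitriangular : S ≤ unitriangular d
  complement : ∃ (D : Subgroup (GLR d)) (y : Fin d → ℝ), D ≤ H ∧ IsClosed (D : Set (GLR d)) ∧
    (∀ g : GLR d, g ∈ D ↔ ∃ r : ℝ, (g : Matrix (Fin d) (Fin d) ℝ) =
      NormedSpace.exp (r • Matrix.diagonal y)) ∧
    ∀ h ∈ H, ∃! p : ℤˣ × D × S, (h : Matrix (Fin d) (Fin d) ℝ) =
      ((p.1 : ℤ) : ℝ) • (((p.2.1 : GLR d) * (p.2.2 : GLR d) : GLR d) : Matrix (Fin d) (Fin d) ℝ)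

/-- `S` is a shearing (sub)group: it is the shearing subgroup of some generalized shearlet
dilation group. -/
def IsShearingSubgroup {d : ℕ} (S : Subgroup (GLR d)) : Prop :=
  ∃ H : Subgroup (GLR d), IsShearletGroupWith H S

/-- Conjugacy of subgroups inside `GL(d, ℝ)`. -/
def AreConjugate {d : ℕ} (S S' : Subgroup (GLR d)) : Prop :=
  ∃ g : GLR d, S.map (MulAut.conj g).toMonoidHom = S'

/-! ### The algebra of a shearing group and nilpotency classes -/

/-- The associative algebra with unit generated (equivalently, for a group, spanned) by `S`. -/
def groupAlgebra {d : ℕ} (S : Subgroup (GLR d)) : Subalgebra ℝ (Matrix (Fin d) (Fin d) ℝ) :=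
  Algebra.adjoin ℝ {M | ∃ s ∈ S, (s : Matrix (Fin d) (Fin d) ℝ) = M}

/-- `n` is the nilpotency class of `A`: with `N` the set of nilpotent elements, `n` is the least
exponent with `N^n = 0`, i.e. such that all products of `n` nilpotent elements vanish. -/
def HasNilpotencyClass (A : Type*) [Ring A] (n : ℕ) : Prop :=
  IsLeast {m : ℕ | ∀ f : Fin m → A, (∀ i, IsNilpotent (f i)) → (List.ofFn f).prod = 0} n

/-! ### The standard and the Toeplitz shearing groups -/

/-- The matrix with ones on the diagonal, `s j` at place `(0, j)` for `j ≠ 0`, and zeros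
elsewhere. -/
def standardMatrix (d : ℕ) (s : Fin d → ℝ) : Matrix (Fin d) (Fin d) ℝ :=
  Matrix.of fun i j => if i = j then 1 else if (i : ℕ) = 0 then s j else 0

theorem standardMatrix_mul (d : ℕ) (s t : Fin d → ℝ) :
    standardMatrix d s * standardMatrix d t = standardMatrix d (s + t) := by
  cases d with
  | zero => exact Subsingleton.elim _ _
  | succ n =>
    ext i j
    rw [Matrix.mul_apply, Fin.sum_univ_succ]
    induction i using Fin.cases with
    | zero =>
      induction j using Fin.cases with
      | zero => simp [standardMatrix, Fin.succ_ne_zero]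
      | succ j =>
        simp [standardMatrix, (Fin.succ_ne_zero _).symm, add_comm]
    | succ i =>
      induction j using Fin.cases with
      | zero => simp [standardMatrix, Fin.succ_ne_zero]
      | succ j =>
        simp [standardMatrix, Fin.succ_ne_zero]

theorem standardMatrix_zero (d : ℕ) : standardMatrix d 0 = 1 := by
  ext i j
  simp [standardMatrix, Matrix.one_apply]

/-- The standard shearing group in dimension `d`. -/
def standardShearing (d : ℕ) : Subgroup (GLR d) where
  carrier := {g | ∃ s : Fin d → ℝ, (g : Matrix (Fin d) (Fin d) ℝ) = standardMatrix d s}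
  one_mem' := ⟨0, by rw [standardMatrix_zero, Units.val_one]⟩
  mul_mem' := by
    rintro a b ⟨s, hs⟩ ⟨t, ht⟩
    exact ⟨s + t, by rw [Units.val_mul, hs, ht, standardMatrix_mul]⟩
  inv_mem' := by
    rintro a ⟨s, hs⟩
    refine ⟨-s, Units.inv_eq_of_mul_eq_one_right ?_⟩
    rw [hs, standardMatrix_mul, add_neg_cancel, standardMatrix_zero]

/-- The upper triangular Toeplitz matrix with entry `s (j - i)` at place `(i, j)`, `i ≤ j`. -/
def toeplitzMatrix (d : ℕ) (s : ℕ → ℝ) : Matrix (Fin d) (Fin d) ℝ :=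
  Matrix.of fun i j => if i ≤ j then s ((j : ℕ) - (i : ℕ)) else 0

theorem toeplitzMatrix_mul (d : ℕ) (s t : ℕ → ℝ) :
    toeplitzMatrix d s * toeplitzMatrix d t =
      toeplitzMatrix d fun n => ∑ p ∈ Finset.HasAntidiagonal.antidiagonal n, s p.1 * t p.2 := by
  ext i j
  rw [Matrix.mul_apply]
  simp only [toeplitzMatrix, Matrix.of_apply]
  split_ifs with hij
  · have h1 : ∀ k : Fin d, ((if i ≤ k then s ((k : ℕ) - i) else 0) *
        (if k ≤ j then t ((j : ℕ) - k) else 0)) =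
        if k ∈ Finset.Icc i j then s ((k : ℕ) - i) * t ((j : ℕ) - k) else 0 := by
      intro k
      by_cases h : i ≤ k <;> by_cases h' : k ≤ j <;> simp [h, h']
    rw [Finset.sum_congr rfl fun k _ => h1 k, Finset.sum_ite_mem, Finset.univ_inter]
    refine Finset.sum_bij (fun k _ => ((k : ℕ) - i, (j : ℕ) - k)) ?_ ?_ ?_ ?_
    · intro k hk
      simp only [Finset.mem_Icc, Fin.le_def] at hk
      simp only [Finset.HasAntidiagonal.mem_antidiagonal]
      omega
    · intro k hk l hl h
      simp only [Finset.mem_Icc, Fin.le_def, Prod.mk.injEq] at hk hl h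
      ext
      omega
    · rintro ⟨p, q⟩ hpq
      simp only [Finset.HasAntidiagonal.mem_antidiagonal] at hpq
      have hij' : (i : ℕ) ≤ j := hij
      refine ⟨⟨p + i, by have := j.2; omega⟩, ?_, ?_⟩
      · simp only [Finset.mem_Icc, Fin.le_def]
        omega
      · simp only [Prod.mk.injEq]
        omega
    · intro k _
      rfl
  · refine Finset.sum_eq_zero fun k _ => ?_
    by_cases h : i ≤ k
    · rw [if_neg (fun h' => hij (h.trans h')), mul_zero]
    · rw [if_neg h, zero_mul]

theorem toeplitzMatrix_one (d : ℕ) :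
    toeplitzMatrix d (fun n => if n = 0 then 1 else 0) = 1 := by
  ext i j
  simp only [toeplitzMatrix, Matrix.of_apply, Matrix.one_apply, Fin.le_def, Fin.ext_iff]
  split_ifs <;> first | rfl | omega

/-- The Toeplitz shearing group in dimension `d`. -/
def toeplitzShearing (d : ℕ) : Subgroup (GLR d) where
  carrier := {g | ∃ s : ℕ → ℝ, s 0 = 1 ∧
    (g : Matrix (Fin d) (Fin d) ℝ) = toeplitzMatrix d s}
  one_mem' := ⟨_, if_pos rfl, by rw [toeplitzMatrix_one, Units.val_one]⟩
  mul_mem' := by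
    rintro a b ⟨s, hs0, hs⟩ ⟨t, ht0, ht⟩
    refine ⟨fun n => ∑ p ∈ Finset.HasAntidiagonal.antidiagonal n, s p.1 * t p.2, ?_, ?_⟩
    · simp [hs0, ht0]
    · rw [Units.val_mul, hs, ht, toeplitzMatrix_mul]
  inv_mem' := by
    rintro a ⟨s, hs0, hs⟩
    have h0 : PowerSeries.constantCoeff (PowerSeries.mk s) ≠ 0 := by simp [hs0]
    have hinv := PowerSeries.mul_inv_cancel (PowerSeries.mk s) h0
    refine ⟨fun n => PowerSeries.coeff n (PowerSeries.mk s)⁻¹, by simp [hs0],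
      Units.inv_eq_of_mul_eq_one_right ?_⟩
    rw [hs, toeplitzMatrix_mul, ← toeplitzMatrix_one]
    congr 1
    funext n
    rw [← PowerSeries.coeff_one, ← hinv, PowerSeries.coeff_mul]
    simp

/-! ### The three further groups in dimension four -/

/-- The matrix displayed below, an element of the span of `H_a`. -/
def hMatrix (a s t₁ t₂ t₃ : ℝ) : Matrix (Fin 4) (Fin 4) ℝ :=
  !![s, t₁, t₂, t₃; 0, s, 0, t₁; 0, 0, s, a * t₂; 0, 0, 0, s]

theorem hMatrix_mul (a s t₁ t₂ t₃ s' t₁' t₂' t₃' : ℝ) :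
    hMatrix a s t₁ t₂ t₃ * hMatrix a s' t₁' t₂' t₃' =
      hMatrix a (s * s') (s * t₁' + t₁ * s') (s * t₂' + t₂ * s')
        (s * t₃' + t₁ * t₁' + a * (t₂ * t₂') + t₃ * s') := by
  ext i j
  fin_cases i <;> fin_cases j <;>
    simp [hMatrix, Matrix.mul_apply, Fin.sum_univ_four] <;> ring

theorem hMatrix_one (a : ℝ) : hMatrix a 1 0 0 0 = 1 := by
  ext i j
  fin_cases i <;> fin_cases j <;> simp [hMatrix]

/-- The group `H_a`. -/
def hGroup (a : ℝ) : Subgroup (GLR 4) where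
  carrier := {g | ∃ s t₁ t₂ t₃ : ℝ, s ≠ 0 ∧
    (g : Matrix (Fin 4) (Fin 4) ℝ) = hMatrix a s t₁ t₂ t₃}
  one_mem' := ⟨1, 0, 0, 0, one_ne_zero, by rw [hMatrix_one, Units.val_one]⟩
  mul_mem' := by
    rintro g g' ⟨s, t₁, t₂, t₃, hs, hg⟩ ⟨s', t₁', t₂', t₃', hs', hg'⟩
    exact ⟨_, _, _, _, mul_ne_zero hs hs', by rw [Units.val_mul, hg, hg', hMatrix_mul]⟩
  inv_mem' := by
    rintro g ⟨s, t₁, t₂, t₃, hs, hg⟩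
    refine ⟨s⁻¹, -(t₁ / s ^ 2), -(t₂ / s ^ 2),
      (t₁ ^ 2 + a * t₂ ^ 2) / s ^ 3 - t₃ / s ^ 2, inv_ne_zero hs,
      Units.inv_eq_of_mul_eq_one_right ?_⟩
    rw [hg, hMatrix_mul, ← hMatrix_one a]
    congr 1 <;> field_simp <;> ring

/-- The subgroup `S_a` of unipotent matrices in `H_a` (those with `s = 1`). -/
def hShearing (a : ℝ) : Subgroup (GLR 4) := hGroup a ⊓ unitriangular 4

/-- The ideal `(X³, Y² - a X², X Y)` of `ℝ[X, Y]`. -/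
def hIdeal (a : ℝ) : Ideal (MvPolynomial (Fin 2) ℝ) :=
  Ideal.span {MvPolynomial.X 0 ^ 3,
    MvPolynomial.X 1 ^ 2 - MvPolynomial.C a * MvPolynomial.X 0 ^ 2,
    MvPolynomial.X 0 * MvPolynomial.X 1}

/-- The algebra `ℝ[X, Y] / (X³, Y² - a X², X Y)`. -/
abbrev HAlgebra (a : ℝ) := MvPolynomial (Fin 2) ℝ ⧸ hIdeal a

/-- The residue classes of `X` (index `0`) and `Y` (index `1`). -/
def hGen (a : ℝ) (i : Fin 2) : HAlgebra a := Ideal.Quotient.mk (hIdeal a) (MvPolynomial.X i)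

end ShearletGroups

end

open ShearletGroups

/-! The Fourier transform turns `π(x,h)` into a modulation followed by the dual action `ξ ↦ hᵀ ξ`,
and Plancherel in `x` turns the square integral of a matrix coefficient into a double integral over
the group and the frequencies (`fourier_quasiRegular`, `lintegral_inner_quasiRegular`).
Admissibility thus becomes a question about this action.

Necessity. Irreducibility makes the dual action ergodic. Combined with square integrability, this
shows that almost all orbit maps push the weighted Haar measure to one and the same finite nonzero
measure, so some orbit has positive volume (`IsIrreduciblyAdmissible.exists_orbit`). The
decomposition `±DS` covers the orbit of `ξ`, up to sign, by a smooth image of pairs (shear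
parameter, dilation parameter). Since smooth maps preserve null sets, `ξ` must be a cyclic row
vector for the commutative algebra of `S`, and the logarithms of `S` must fill its whole nilpotent
part. Hence `S` consists of all unipotent elements of a local commutative algebra acting by its
regular representation (`IsShearingSubgroup.exists_isRegular`).

Classification. A basis of this algebra with a prescribed multiplication table conjugates `S` to a
model group (`IsRegular.areConjugate`). If all squares of nilpotent elements vanish, the model is
standard; if the highest possible power survives, it is Toeplitz. In dimension four one case
remains: nilpotents `x, y, x²` with `xy = 0` and `y² = b x²`, where rescaling `y` leaves only the
sign of `b` (`IsRegular.exists_square_table`).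

Existence. All models are charts (`IsShearletChart`): commutative algebras parametrised linearly by
the first row. The frequencies with nonzero first coordinate form a conull dual orbit. Commutativity
exchanges group element and frequency, which gives irreducibility by Fubini, and the indicator of a
compact ball in the orbit gives an admissible vector. The models are separated by ring-theoretic
properties of `S - 1`. -/

noncomputable section

namespace ShearletGroups

open FourierTransform SchwartzMap
open scoped ENNReal ContDiff

/-! ### The Fourier transform on `L²` compared with the Fourier integral -/

section Fourier

variable {V : Type*} [NormedAddCommGroup V] [InnerProductSpace ℝ V] [FiniteDimensional ℝ V]
  [MeasurableSpace V] [BorelSpace V]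

/-- Two locally integrable functions that agree as distributions agree almost everywhere. -/
theorem ae_eq_of_forall_schwartz {f g : V → ℂ} (hf : LocallyIntegrable f volume)
    (hg : LocallyIntegrable g volume)
    (h : ∀ φ : 𝓢(V, ℂ), HasCompactSupport φ → ∫ x, φ x * f x = ∫ x, φ x * g x) :
    f =ᵐ[volume] g := by
  refine ae_eq_of_integral_contDiff_smul_eq hf hg fun k hk hks => ?_
  have h1 : HasCompactSupport (Complex.ofRealCLM ∘ k) := hks.comp_left rfl
  have h2 : ContDiff ℝ ∞ (Complex.ofRealCLM ∘ k) := by fun_prop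
  have := h (h1.toSchwartzMap h2) h1
  simpa using this

/-- Duality with Schwartz functions stands in for a pointwise formula, which the `L²` transform does
not have. -/
theorem integral_schwartz_mul_fourier (f : Lp (α := V) ℂ 2) (φ : 𝓢(V, ℂ)) :
    ∫ x, φ x * (𝓕 f : Lp (α := V) ℂ 2) x = ∫ x, 𝓕 (φ : V → ℂ) x * f x := by
  have h := congrArg (fun T => T φ) (Lp.fourier_toTemperedDistribution_eq f)
  simp only [TemperedDistribution.fourier_apply, Lp.toTemperedDistribution_apply,
    smul_eq_mul] at h
  rw [← h]
  rfl

theorem integral_schwartz_mul_fourier_of_integrable {u : V → ℂ} (hu : Integrable u)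
    (φ : 𝓢(V, ℂ)) : ∫ x, φ x * 𝓕 u x = ∫ x, 𝓕 (φ : V → ℂ) x * u x := by
  have h := VectorFourier.integral_fourierIntegral_smul_eq_flip (μ := volume) (ν := volume)
    (L := innerₗ V) (e := Real.fourierChar) Real.continuous_fourierChar
    continuous_inner (φ.integrable (μ := volume)) hu
  simp only [smul_eq_mul, flip_innerₗ] at h
  exact h.symm

theorem continuous_fourier_of_integrable {u : V → ℂ} (hu : Integrable u) : Continuous (𝓕 u) :=
  VectorFourier.fourierIntegral_continuous Real.continuous_fourierChar continuous_inner hu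

/-- On integrable square integrable functions, the two Fourier transforms agree. -/
theorem fourier_ae_eq_of_integrable {u : V → ℂ} (hu : Integrable u) (f : Lp (α := V) ℂ 2)
    (hfu : f =ᵐ[volume] u) : (𝓕 f : Lp (α := V) ℂ 2) =ᵐ[volume] 𝓕 u := by
  refine ae_eq_of_forall_schwartz ((Lp.memLp _).locallyIntegrable (by norm_num))
    (continuous_fourier_of_integrable hu).locallyIntegrable fun φ _ => ?_
  rw [integral_schwartz_mul_fourier, integral_schwartz_mul_fourier_of_integrable hu]
  refine integral_congr_ae ?_
  filter_upwards [hfu] with x hx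
  rw [hx]

/-- An integrable function with square integrable Fourier transform is square integrable. -/
theorem ae_eq_fourierInv_of_integrable {u : V → ℂ} (hu : Integrable u) (g : Lp (α := V) ℂ 2)
    (hgu : g =ᵐ[volume] 𝓕 u) : u =ᵐ[volume] (𝓕⁻ g : Lp (α := V) ℂ 2) := by
  refine ae_eq_of_forall_schwartz hu.locallyIntegrable
    ((Lp.memLp _).locallyIntegrable (by norm_num)) fun φ _ => ?_
  -- Writing the test function as a Fourier transform lets both duality formulas be used backwards.
  obtain ⟨χ, hχ⟩ : ∃ χ : 𝓢(V, ℂ), 𝓕 χ = φ := ⟨𝓕⁻ φ, fourier_fourierInv_eq φ⟩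
  have h0 : 𝓕 (χ : V → ℂ) = φ := by rw [← hχ]; rfl
  have h1 := integral_schwartz_mul_fourier_of_integrable hu χ
  have h2 := integral_schwartz_mul_fourier (𝓕⁻ g : Lp ℂ 2 (volume : Measure V)) χ
  rw [fourier_fourierInv_eq] at h2
  rw [h0] at h1 h2
  rw [← h1, ← h2]
  refine integral_congr_ae ?_
  filter_upwards [hgu] with x hx
  rw [hx]

/-- Plancherel's theorem for integrable functions, with infinite values allowed. -/
theorem eLpNorm_fourier_of_integrable {u : V → ℂ} (hu : Integrable u) :
    eLpNorm (𝓕 u) 2 volume = eLpNorm u 2 volume := by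
  by_cases h : MemLp u 2 volume
  · have h1 := fourier_ae_eq_of_integrable hu (h.toLp u) h.coeFn_toLp
    have h2 := h.coeFn_toLp
    rw [← eLpNorm_congr_ae h1, ← eLpNorm_congr_ae h2]
    have := Lp.norm_fourier_eq (h.toLp u)
    rw [Lp.norm_def, Lp.norm_def] at this
    exact (ENNReal.toReal_eq_toReal_iff' (Lp.memLp _).2.ne (Lp.memLp _).2.ne).1 this
  -- Both sides are infinite here, since a square integrable transform would force `u` into `L²`.
  · have h1 : ¬ MemLp (𝓕 u) 2 volume := fun h' => h <|
      (memLp_congr_ae (ae_eq_fourierInv_of_integrable hu (h'.toLp _) h'.coeFn_toLp)).2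
        (Lp.memLp _)
    have e1 : eLpNorm u 2 volume = ⊤ := by
      by_contra hne
      exact h ⟨hu.1, lt_top_iff_ne_top.2 hne⟩
    have e2 : eLpNorm (𝓕 u) 2 volume = ⊤ := by
      by_contra hne
      exact h1 ⟨(continuous_fourier_of_integrable hu).aestronglyMeasurable,
        lt_top_iff_ne_top.2 hne⟩
    rw [e1, e2]

end Fourier

/-! ### The quasi-regular representation on the Fourier side -/

section Action

variable {d : ℕ}

theorem toEuclideanLin_eq (M : Matrix (Fin d) (Fin d) ℝ) (v : E d) :
    Matrix.toEuclideanLin M v = WithLp.toLp 2 (M *ᵥ v.ofLp) := rfl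

/-- The dual action `ξ ↦ hᵀ ξ` as a continuous linear equivalence. -/
def dualAct (h : GLR d) : E d ≃L[ℝ] E d :=
  (LinearEquiv.ofLinearMap (Matrix.toEuclideanLin (h : Matrix (Fin d) (Fin d) ℝ)ᵀ)
    (Matrix.toEuclideanLin ((h⁻¹ : GLR d) : Matrix (Fin d) (Fin d) ℝ)ᵀ)
    (by
      ext x
      simp [toEuclideanLin_eq, Matrix.mulVec_mulVec, ← Matrix.transpose_mul])
    (by
      ext x
      simp [toEuclideanLin_eq, Matrix.mulVec_mulVec,
        ← Matrix.transpose_mul])).toContinuousLinearEquiv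

theorem dualAct_apply (h : GLR d) (ξ : E d) :
    dualAct h ξ = WithLp.toLp 2 (ξ.ofLp ᵥ* (h : Matrix (Fin d) (Fin d) ℝ)) := by
  change Matrix.toEuclideanLin (h : Matrix (Fin d) (Fin d) ℝ)ᵀ ξ = _
  rw [toEuclideanLin_eq, Matrix.mulVec_transpose]

theorem dualAct_mul (h k : GLR d) (ξ : E d) : dualAct (h * k) ξ = dualAct k (dualAct h ξ) := by
  simp [dualAct_apply, Matrix.vecMul_vecMul]

theorem dualAct_one (ξ : E d) : dualAct (1 : GLR d) ξ = ξ := by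
  simp [dualAct_apply]

theorem dualAct_inv_apply (h : GLR d) (ξ : E d) : dualAct h⁻¹ (dualAct h ξ) = ξ := by
  rw [← dualAct_mul, mul_inv_cancel, dualAct_one]

theorem dualAct_apply_inv (h : GLR d) (ξ : E d) : dualAct h (dualAct h⁻¹ ξ) = ξ := by
  rw [← dualAct_mul, inv_mul_cancel, dualAct_one]

theorem inner_toEuclideanLin (h : GLR d) (x ξ : E d) :
    inner ℝ (Matrix.toEuclideanLin (h : Matrix (Fin d) (Fin d) ℝ) x) ξ =
      inner ℝ x (dualAct h ξ) := by
  simp [dualAct_apply, toEuclideanLin_eq, EuclideanSpace.inner_eq_star_dotProduct,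
    Matrix.dotProduct_mulVec]

theorem det_ne_zero (h : GLR d) : (h : Matrix (Fin d) (Fin d) ℝ).det ≠ 0 :=
  ((Matrix.isUnit_iff_isUnit_det _).1 h.isUnit).ne_zero

theorem map_dualAct (h : GLR d) : Measure.map (dualAct h) (volume : Measure (E d)) =
    ENNReal.ofReal |(h : Matrix (Fin d) (Fin d) ℝ).det|⁻¹ • volume := by
  have hdet : LinearMap.det (dualAct h : E d →ₗ[ℝ] E d) =
      (h : Matrix (Fin d) (Fin d) ℝ).det := by
    change LinearMap.det (Matrix.toEuclideanLin (h : Matrix (Fin d) (Fin d) ℝ)ᵀ) = _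
    rw [Matrix.toEuclideanLin_eq_toLin_orthonormal, LinearMap.det_toLin, Matrix.det_transpose]
  have := Measure.map_linearMap_addHaar_eq_smul_addHaar (volume : Measure (E d))
    (f := (dualAct h : E d →ₗ[ℝ] E d)) (by rw [hdet]; exact det_ne_zero h)
  rw [hdet, abs_inv] at this
  exact this

theorem quasiMeasurePreserving_dualAct (h : GLR d) :
    Measure.QuasiMeasurePreserving (dualAct h) (volume : Measure (E d)) volume :=
  ⟨(dualAct h).continuous.measurable, by
    rw [map_dualAct]; exact Measure.smul_absolutelyContinuous⟩

theorem integral_comp_dualAct (h : GLR d) (f : E d → ℂ) :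
    ∫ ξ, f (dualAct h ξ) = ((|(h : Matrix (Fin d) (Fin d) ℝ).det|⁻¹ : ℝ) : ℂ) * ∫ ξ, f ξ := by
  have h1 := (dualAct h).toHomeomorph.measurableEmbedding.integral_map (μ := volume) f
  change ∫ ξ, f ξ ∂(Measure.map (dualAct h) volume) = ∫ ξ, f (dualAct h ξ) at h1
  rw [← h1, map_dualAct, integral_smul_measure, ENNReal.toReal_ofReal (by positivity),
    Complex.real_smul]

theorem integral_comp_toEuclideanLin_inv (h : GLR d) (f : E d → ℂ) :
    ∫ y, f (Matrix.toEuclideanLin ((h⁻¹ : GLR d) : Matrix (Fin d) (Fin d) ℝ) y) =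
      ((|(h : Matrix (Fin d) (Fin d) ℝ).det| : ℝ) : ℂ) * ∫ y, f y := by
  -- The map `y ↦ h⁻¹ y` is the dual action of the inverse transpose, so the substitution rule above
  -- applies to it.
  obtain ⟨k, hk⟩ : ∃ k : GLR d, (k : Matrix (Fin d) (Fin d) ℝ) =
      ((h⁻¹ : GLR d) : Matrix (Fin d) (Fin d) ℝ)ᵀ :=
    ⟨⟨((h⁻¹ : GLR d) : Matrix (Fin d) (Fin d) ℝ)ᵀ, (h : Matrix (Fin d) (Fin d) ℝ)ᵀ, by
      rw [← Matrix.transpose_mul, ← Units.val_mul]; simp, by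
      rw [← Matrix.transpose_mul, ← Units.val_mul]; simp⟩, rfl⟩
  have h1 := integral_comp_dualAct k f
  have h2 : ∀ y, dualAct k y =
      Matrix.toEuclideanLin ((h⁻¹ : GLR d) : Matrix (Fin d) (Fin d) ℝ) y := by
    intro y
    rw [dualAct_apply, hk, Matrix.vecMul_transpose, toEuclideanLin_eq]
  simp only [h2] at h1
  have hd : |(k : Matrix (Fin d) (Fin d) ℝ).det|⁻¹ = |(h : Matrix (Fin d) (Fin d) ℝ).det| := by
    have h3 : ((h⁻¹ : GLR d) : Matrix (Fin d) (Fin d) ℝ).det *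
        (h : Matrix (Fin d) (Fin d) ℝ).det = 1 := by
      rw [← Matrix.det_mul, ← Units.val_mul]; simp
    rw [hk, Matrix.det_transpose, ← abs_inv, eq_inv_of_mul_eq_one_left h3, inv_inv]
  rw [h1, hd]

/-- The modulation `e^{-2πi⟨x,ξ⟩}`. -/
def modulation (x ξ : E d) : ℂ := (Real.fourierChar (-inner ℝ x ξ) : ℂ)

theorem contDiff_modulation (x : E d) : ContDiff ℝ ∞ (modulation x) := by
  unfold modulation
  simp only [Real.fourierChar_apply]
  have h : ContDiff ℝ ∞ fun ξ : E d => 2 * Real.pi * -inner ℝ x ξ :=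
    contDiff_const.mul (contDiff_const.inner ℝ contDiff_id).neg
  exact ((Complex.ofRealCLM.contDiff.comp h).mul contDiff_const).cexp

theorem norm_modulation (x ξ : E d) : ‖modulation x ξ‖ = 1 := Circle.norm_coe _

theorem memLp_comp_dualAct (h : GLR d) {f : E d → ℂ} (hf : MemLp f 2 volume) :
    MemLp (fun ξ => f (dualAct h ξ)) 2 volume := by
  refine MemLp.comp_of_map (f := dualAct h) ?_ (dualAct h).continuous.measurable.aemeasurable
  rw [map_dualAct]
  exact hf.smul_measure ENNReal.ofReal_ne_top

/-- The substitution `η = hᵀ ξ` moves the matrix from frequency to position, and the modulation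
becomes a translation by `x`. This is the covariance rule in transposed form, for test functions. -/
theorem fourier_comp_dualAct (h : GLR d) (x : E d) (φ : E d → ℂ) (w : E d) :
    𝓕 (fun η => ((|(h : Matrix (Fin d) (Fin d) ℝ).det|⁻¹ : ℝ) : ℂ) *
      (modulation x (dualAct h⁻¹ η) * φ (dualAct h⁻¹ η))) w =
    𝓕 φ (Matrix.toEuclideanLin (h : Matrix (Fin d) (Fin d) ℝ) w + x) := by
  rw [Real.fourier_eq, Real.fourier_eq]
  have h1 := integral_comp_dualAct h (fun η => (Real.fourierChar (-inner ℝ η w) : ℂ) *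
      (modulation x (dualAct h⁻¹ η) * φ (dualAct h⁻¹ η)))
  simp only [dualAct_inv_apply] at h1
  rw [← integral_const_mul] at h1
  simp only [Circle.smul_def, smul_eq_mul]
  refine Eq.trans (integral_congr_ae (.of_forall fun η => ?_)) (h1.symm.trans
    (integral_congr_ae (.of_forall fun ξ => ?_)))
  · ring
  · simp only
    rw [← mul_assoc, modulation, inner_add_right, neg_add, AddChar.map_add_eq_mul, Circle.coe_mul,
      real_inner_comm x ξ, real_inner_comm w, ← inner_toEuclideanLin,
      real_inner_comm ξ]

/-- Since `f` is merely in `L²`, the identity is tested against compactly supported functions. The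
operator is moved onto the test function, where the Fourier integral can be computed by
substitution. -/
theorem fourier_quasiRegular (x : E d) (h : GLR d) (f : L2 d) :
    (𝓕 (quasiRegular x h f) : L2 d) =ᵐ[volume] fun ξ =>
      ((|(h : Matrix (Fin d) (Fin d) ℝ).det| ^ (1 / 2 : ℝ) : ℝ) : ℂ) *
        (modulation x ξ * (𝓕 f : L2 d) (dualAct h ξ)) := by
  have hpos : 0 < |(h : Matrix (Fin d) (Fin d) ℝ).det| := abs_pos.2 (det_ne_zero h)
  set c := |(h : Matrix (Fin d) (Fin d) ℝ).det| with hc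
  have hm : MemLp (fun ξ => ((c ^ (1 / 2 : ℝ) : ℝ) : ℂ) *
        (modulation x ξ * (𝓕 f : L2 d) (dualAct h ξ))) 2 volume := by
    refine MemLp.const_mul ?_ _
    refine (memLp_congr_norm ?_ ?_ ?_).1 (memLp_comp_dualAct h (Lp.memLp (𝓕 f : L2 d)))
    · exact (memLp_comp_dualAct h (Lp.memLp _)).1
    · exact (contDiff_modulation x).continuous.aestronglyMeasurable.mul
        (memLp_comp_dualAct h (Lp.memLp _)).1
    · filter_upwards with ξ
      rw [norm_mul, norm_modulation, one_mul]
  refine ae_eq_of_forall_schwartz ((Lp.memLp _).locallyIntegrable (by norm_num))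
    (hm.locallyIntegrable (by norm_num)) fun φ hφ => ?_
  have hcont : ContDiff ℝ ∞ (fun η => (((c⁻¹ : ℝ)) : ℂ) *
      (modulation x (dualAct h⁻¹ η) * φ (dualAct h⁻¹ η))) :=
    contDiff_const.mul (((contDiff_modulation x).comp (dualAct h⁻¹).contDiff).mul
      ((φ.smooth').comp (dualAct h⁻¹).contDiff))
  have hcomp : HasCompactSupport (fun η => (((c⁻¹ : ℝ)) : ℂ) *
      (modulation x (dualAct h⁻¹ η) * φ (dualAct h⁻¹ η))) :=
    ((hφ.comp_homeomorph (dualAct h⁻¹).toHomeomorph).mul_left).mul_left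
  have key := integral_schwartz_mul_fourier f (hcomp.toSchwartzMap hcont)
  change ∫ η, (((c⁻¹ : ℝ)) : ℂ) *
      (modulation x (dualAct h⁻¹ η) * φ (dualAct h⁻¹ η)) * (𝓕 f : L2 d) η =
    ∫ w, 𝓕 (fun η => (((c⁻¹ : ℝ)) : ℂ) *
      (modulation x (dualAct h⁻¹ η) * φ (dualAct h⁻¹ η))) w * f w at key
  rw [integral_schwartz_mul_fourier]
  calc ∫ y, 𝓕 (φ : E d → ℂ) y * quasiRegular x h f y
      = ∫ y, (fun z => 𝓕 (φ : E d → ℂ) (z + x) * (((c ^ (-(1 / 2) : ℝ) : ℝ) : ℂ) *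
          f (Matrix.toEuclideanLin ((h⁻¹ : GLR d) : Matrix (Fin d) (Fin d) ℝ) z))) (y - x) := by
        refine integral_congr_ae ?_
        filter_upwards [(memLp_quasiRegularFun x h (Lp.memLp f)).coeFn_toLp] with y hy
        simp only [quasiRegular, hy, quasiRegularFun, sub_add_cancel, hc]
    _ = ∫ z, 𝓕 (φ : E d → ℂ) (z + x) * (((c ^ (-(1 / 2) : ℝ) : ℝ) : ℂ) *
          f (Matrix.toEuclideanLin ((h⁻¹ : GLR d) : Matrix (Fin d) (Fin d) ℝ) z)) :=
        integral_sub_right_eq_self (μ := (volume : Measure (E d)))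
          (fun z => 𝓕 (φ : E d → ℂ) (z + x) * (((c ^ (-(1 / 2) : ℝ) : ℝ) : ℂ) *
          f (Matrix.toEuclideanLin ((h⁻¹ : GLR d) : Matrix (Fin d) (Fin d) ℝ) z))) x
    _ = ∫ z, (fun w => 𝓕 (φ : E d → ℂ)
          (Matrix.toEuclideanLin (h : Matrix (Fin d) (Fin d) ℝ) w + x) *
          (((c ^ (-(1 / 2) : ℝ) : ℝ) : ℂ) * f w))
          (Matrix.toEuclideanLin ((h⁻¹ : GLR d) : Matrix (Fin d) (Fin d) ℝ) z) := by
        congr 1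
        funext z
        have : Matrix.toEuclideanLin (h : Matrix (Fin d) (Fin d) ℝ)
            (Matrix.toEuclideanLin ((h⁻¹ : GLR d) : Matrix (Fin d) (Fin d) ℝ) z) = z := by
          simp [toEuclideanLin_eq, Matrix.mulVec_mulVec]
        simp only [this]
    _ = ((c ^ (1 / 2 : ℝ) : ℝ) : ℂ) * ∫ w, 𝓕 (φ : E d → ℂ)
          (Matrix.toEuclideanLin (h : Matrix (Fin d) (Fin d) ℝ) w + x) * f w := by
        refine (integral_comp_toEuclideanLin_inv h (fun w => 𝓕 (φ : E d → ℂ)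
          (Matrix.toEuclideanLin (h : Matrix (Fin d) (Fin d) ℝ) w + x) *
          (((c ^ (-(1 / 2) : ℝ) : ℝ) : ℂ) * f w))).trans ?_
        rw [← integral_const_mul, ← integral_const_mul]
        congr 1
        funext w
        have : c ^ (1 / 2 : ℝ) = c * c ^ (-(1 / 2) : ℝ) := by
          rw [← Real.rpow_one_add' hpos.le (by norm_num)]; norm_num
        rw [this]
        push_cast
        ring
    _ = ((c ^ (1 / 2 : ℝ) : ℝ) : ℂ) * ∫ η, (((c⁻¹ : ℝ)) : ℂ) *
          (modulation x (dualAct h⁻¹ η) * φ (dualAct h⁻¹ η)) * (𝓕 f : L2 d) η := by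
        rw [key]
        simp only [hc, fourier_comp_dualAct]
    _ = ((c ^ (1 / 2 : ℝ) : ℝ) : ℂ) * ∫ ξ, (fun η =>
          (modulation x (dualAct h⁻¹ η) * φ (dualAct h⁻¹ η)) * (𝓕 f : L2 d) η) (dualAct h ξ) := by
        congr 1
        refine Eq.trans ?_ (integral_comp_dualAct h (fun η =>
          (modulation x (dualAct h⁻¹ η) * φ (dualAct h⁻¹ η)) * (𝓕 f : L2 d) η)).symm
        rw [← integral_const_mul]
        simp only [mul_assoc, hc]
    _ = _ := by
        rw [← integral_const_mul]
        congr 1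
        funext ξ
        simp only [dualAct_inv_apply]
        ring

/-- The integrand of matrix coefficients on the Fourier side. -/
def coeffFun (g f : L2 d) (h : GLR d) (ξ : E d) : ℂ :=
  starRingEnd ℂ ((𝓕 g : L2 d) ξ) * (𝓕 f : L2 d) (dualAct h ξ)

theorem integrable_coeffFun (g f : L2 d) (h : GLR d) : Integrable (coeffFun g f h) :=
  (Lp.memLp (𝓕 g : L2 d)).star.integrable_mul (memLp_comp_dualAct h (Lp.memLp (𝓕 f : L2 d)))

/-- By Parseval, for fixed `h` a matrix coefficient is a multiple of the Fourier integral of an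
integrable function. -/
theorem inner_quasiRegular (g f : L2 d) (x : E d) (h : GLR d) :
    inner ℂ g (quasiRegular x h f) =
      ((|(h : Matrix (Fin d) (Fin d) ℝ).det| ^ (1 / 2 : ℝ) : ℝ) : ℂ) * 𝓕 (coeffFun g f h) x := by
  rw [← Lp.inner_fourier_eq, L2.inner_def, Real.fourier_eq, ← integral_const_mul]
  refine integral_congr_ae ?_
  filter_upwards [fourier_quasiRegular x h f] with ξ hξ
  rw [hξ, RCLike.inner_apply, Circle.smul_def, smul_eq_mul, modulation, coeffFun,
    real_inner_comm]
  ring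

/-- Plancherel in `x`, with infinite values allowed: `coeffFun` is a product of two `L²` functions,
hence integrable but perhaps not square integrable. -/
theorem eLpNorm_inner_quasiRegular (g f : L2 d) (h : GLR d) :
    ∫⁻ x, ‖inner ℂ g (quasiRegular x h f)‖ₑ ^ 2 =
      ENNReal.ofReal |(h : Matrix (Fin d) (Fin d) ℝ).det| *
        ∫⁻ ξ, ‖(𝓕 g : L2 d) ξ‖ₑ ^ 2 * ‖(𝓕 f : L2 d) (dualAct h ξ)‖ₑ ^ 2 := by
  have h1 := eLpNorm_fourier_of_integrable (integrable_coeffFun g f h)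
  have h2 : ∫⁻ x, ‖𝓕 (coeffFun g f h) x‖ₑ ^ 2 = ∫⁻ ξ, ‖coeffFun g f h ξ‖ₑ ^ 2 := by
    have e := congrArg (fun t => t ^ 2) h1
    have h3 : ∀ u : E d → ℂ, eLpNorm u 2 volume ^ 2 = ∫⁻ x, ‖u x‖ₑ ^ 2 := fun u => by
      simpa using eLpNorm_nnreal_pow_eq_lintegral (f := u) (p := 2) (μ := volume) two_ne_zero
    simpa only [h3] using e
  simp only [inner_quasiRegular, enorm_mul, mul_pow]
  rw [lintegral_const_mul' _ _ (by simp), h2]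
  congr 1
  · rw [← ofReal_norm, Complex.norm_real, Real.norm_eq_abs, abs_of_nonneg (by positivity),
      ← ENNReal.ofReal_pow (by positivity), ← Real.rpow_natCast, ← Real.rpow_mul (abs_nonneg _)]
    norm_num
  · refine lintegral_congr fun ξ => ?_
    simp [coeffFun, enorm_mul, mul_pow]

end Action

end ShearletGroups

namespace ShearletGroups

open FourierTransform SchwartzMap
open scoped ENNReal

/-! ### Measurability and integration over closed matrix groups -/

section Topology

variable {d : ℕ}

instance : SecondCountableTopology (GLR d) := by
  have : SecondCountableTopology (Matrix (Fin d) (Fin d) ℝ) :=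
    inferInstanceAs (SecondCountableTopology (Fin d → Fin d → ℝ))
  have : SecondCountableTopology (Matrix (Fin d) (Fin d) ℝ)ᵐᵒᵖ :=
    MulOpposite.opHomeomorph.symm.isEmbedding.secondCountableTopology
  exact Units.isEmbedding_embedProduct.secondCountableTopology

theorem locallyCompactSpace_GLR : LocallyCompactSpace (GLR d) := by
  have : LocallyCompactSpace (Matrix (Fin d) (Fin d) ℝ) :=
    inferInstanceAs (LocallyCompactSpace (Fin d → Fin d → ℝ))
  have : LocallyCompactSpace (Matrix (Fin d) (Fin d) ℝ)ᵐᵒᵖ :=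
    MulOpposite.opHomeomorph.symm.isClosedEmbedding.locallyCompactSpace
  exact Units.isClosedEmbedding_embedProduct.locallyCompactSpace

/-- This makes Haar measures on `H` σ-finite, as Tonelli's theorem requires. -/
theorem sigmaCompactSpace_of_isClosed {H : Subgroup (GLR d)} (hH : IsClosed (H : Set (GLR d))) :
    SigmaCompactSpace H := by
  have := locallyCompactSpace_GLR (d := d)
  have : SigmaCompactSpace (GLR d) := sigmaCompactSpace_of_locallyCompact_secondCountable
  exact hH.isClosedEmbedding_subtypeVal.sigmaCompactSpace

theorem locallyCompactSpace_of_isClosed {H : Subgroup (GLR d)} (hH : IsClosed (H : Set (GLR d))) :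
    LocallyCompactSpace H := by
  have := locallyCompactSpace_GLR (d := d)
  exact hH.isClosedEmbedding_subtypeVal.locallyCompactSpace

theorem continuous_dualAct : Continuous fun p : GLR d × E d => dualAct p.1 p.2 := by
  simp only [dualAct_apply]
  refine (PiLp.continuous_toLp 2 _).comp ?_
  exact ((PiLp.continuous_ofLp 2 _).comp continuous_snd).matrix_vecMul
    (Units.continuous_val.comp continuous_fst)

variable {H : Subgroup (GLR d)} [MeasurableSpace H] [BorelSpace H]

theorem measurable_dualAct : Measurable fun p : H × E d => dualAct (p.1 : GLR d) p.2 :=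
  (continuous_dualAct.comp
    ((continuous_subtype_val.comp continuous_fst).prodMk continuous_snd)).measurable

theorem continuous_absDet : Continuous fun h : GLR d => |(h : Matrix (Fin d) (Fin d) ℝ).det| :=
  (Units.continuous_val.matrix_det).abs

theorem measurable_coeffFun (g f : L2 d) :
    Measurable fun p : H × E d => coeffFun g f (p.1 : GLR d) p.2 := by
  have m1 : Measurable ((𝓕 f : L2 d) : E d → ℂ) := (Lp.stronglyMeasurable _).measurable
  have m2 : Measurable ((𝓕 g : L2 d) : E d → ℂ) := (Lp.stronglyMeasurable _).measurable
  have m3 : Measurable fun ξ : E d => starRingEnd ℂ ((𝓕 g : L2 d) ξ) :=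
    Complex.continuous_conj.measurable.comp m2
  have m4 : Measurable fun p : H × E d => (𝓕 f : L2 d) (dualAct (p.1 : GLR d) p.2) :=
    m1.comp measurable_dualAct
  exact (m3.comp measurable_snd).mul m4

/-- On the Fourier side the coefficient is a parameter integral of a jointly measurable function. -/
theorem stronglyMeasurable_inner_quasiRegular (g f : L2 d) :
    StronglyMeasurable fun p : E d × H => inner ℂ g (quasiRegular p.1 (p.2 : GLR d) f) := by
  simp only [inner_quasiRegular, Real.fourier_eq]
  refine StronglyMeasurable.mul ?_ ?_
  · refine Measurable.stronglyMeasurable ?_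
    have h1 : Measurable fun h : H => |((h : GLR d) : Matrix (Fin d) (Fin d) ℝ).det| :=
      (continuous_absDet.comp continuous_subtype_val).measurable
    exact Complex.measurable_ofReal.comp ((h1.comp measurable_snd).pow_const _)
  · have c1 : Continuous fun p : E d × E d => (Real.fourierChar (-inner ℝ p.2 p.1) : ℂ) :=
      continuous_subtype_val.comp (Real.continuous_fourierChar.comp
        (continuous_snd.inner continuous_fst).neg)
    have c2 : Measurable fun q : (E d × H) × E d => ((q.1.1, q.2) : E d × E d) :=
      (measurable_fst.comp measurable_fst).prodMk measurable_snd
    have c3 : Measurable fun q : (E d × H) × E d => ((q.1.2, q.2) : H × E d) :=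
      (measurable_snd.comp measurable_fst).prodMk measurable_snd
    have c4 : Measurable fun q : (E d × H) × E d =>
        (Real.fourierChar (-inner ℝ q.2 q.1.1) : ℂ) * coeffFun g f (q.1.2 : GLR d) q.2 :=
      (c1.measurable.comp c2).mul ((measurable_coeffFun g f).comp c3)
    exact c4.stronglyMeasurable.integral_prod_right'

/-- The density `|det h|⁻¹` cancels the factor from Plancherel, so square integrability depends only
on the dual action. -/
theorem lintegral_inner_quasiRegular (μ : Measure H) [SFinite μ] (g f : L2 d) :
    ∫⁻ p, ‖inner ℂ g (quasiRegular p.1 (p.2 : GLR d) f)‖ₑ ^ 2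
      ∂(((volume : Measure (E d)).prod μ).withDensity fun p =>
        ENNReal.ofReal (|((p.2 : GLR d) : Matrix (Fin d) (Fin d) ℝ).det|⁻¹)) =
    ∫⁻ h : H, (∫⁻ ξ : E d, ‖(𝓕 g : L2 d) ξ‖ₑ ^ 2 *
      ‖(𝓕 f : L2 d) (dualAct (h : GLR d) ξ)‖ₑ ^ 2) ∂μ := by
  have m1 : Measurable fun p : E d × H =>
      ENNReal.ofReal (|((p.2 : GLR d) : Matrix (Fin d) (Fin d) ℝ).det|⁻¹) :=
    (((continuous_absDet.comp continuous_subtype_val).measurable.comp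
      measurable_snd).inv).ennreal_ofReal
  have m2 : Measurable fun p : E d × H =>
      ‖inner ℂ g (quasiRegular p.1 (p.2 : GLR d) f)‖ₑ ^ 2 :=
    (stronglyMeasurable_inner_quasiRegular g f).measurable.enorm.pow_const 2
  rw [lintegral_withDensity_eq_lintegral_mul _ m1 m2,
    lintegral_prod_symm' _ (m1.mul m2)]
  refine lintegral_congr fun h => ?_
  simp only [Pi.mul_apply]
  rw [lintegral_const_mul' _ _ ENNReal.ofReal_ne_top, eLpNorm_inner_quasiRegular, ← mul_assoc,
    ← ENNReal.ofReal_mul (by positivity), inv_mul_cancel₀ (abs_pos.2 (det_ne_zero _)).ne',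
    ENNReal.ofReal_one, one_mul]

end Topology

/-! ### Ergodicity and orbits of positive measure -/

section Ergodic

variable {d : ℕ}

theorem fourier_eq_zero_iff (f : L2 d) : (𝓕 f : L2 d) = 0 ↔ f = 0 :=
  (Lp.fourierTransformₗᵢ (E d) ℂ).map_eq_zero_iff

/-- Irreducibility makes the dual action ergodic. -/
theorem IsQuasiRegularIrreducible.null_or_conull {H : Subgroup (GLR d)}
    (hH : IsQuasiRegularIrreducible H) {B : Set (E d)} (hB : MeasurableSet B)
    (hinv : ∀ h ∈ H, ∀ ξ, dualAct h ξ ∈ B ↔ ξ ∈ B) : volume B = 0 ∨ volume Bᶜ = 0 := by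
  -- The kernel of `T` is the closed invariant subspace of functions whose Fourier transform
  -- vanishes off `B`.
  let T : L2 d →L[ℂ] Lp ℂ 2 ((volume : Measure (E d)).restrict Bᶜ) :=
    (LpToLpRestrictCLM (E d) ℂ ℂ volume 2 Bᶜ).comp
      ((Lp.fourierTransformₗᵢ (E d) ℂ).toContinuousLinearEquiv : L2 d →L[ℂ] L2 d)
  have hT : ∀ f : L2 d, f ∈ LinearMap.ker T.toLinearMap ↔
      ∀ᵐ ξ : E d, ξ ∈ Bᶜ → (𝓕 f : L2 d) ξ = 0 := by
    intro f
    rw [← ae_restrict_iff' hB.compl]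
    have h1 : T f =ᵐ[volume.restrict Bᶜ] (𝓕 f : L2 d) := LpToLpRestrictCLM_coeFn ℂ Bᶜ (𝓕 f : L2 d)
    rw [LinearMap.mem_ker]
    change T f = 0 ↔ _
    rw [Lp.eq_zero_iff_ae_eq_zero]
    exact ⟨fun h => h1.symm.trans h, fun h => h1.trans h⟩
  -- Every non-null set supports the Fourier transform of a nonzero function, namely of the inverse
  -- transform of the indicator of a subset of finite positive measure.
  have key : ∀ C : Set (E d), MeasurableSet C → volume C ≠ 0 → ∃ f : L2 d, f ≠ 0 ∧
      (∀ᵐ ξ : E d, ξ ∉ C → (𝓕 f : L2 d) ξ = 0) ∧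
      ¬ (∀ᵐ ξ : E d, ξ ∈ C → (𝓕 f : L2 d) ξ = 0) := by
    intro C hC hC0
    obtain ⟨t, ht, htC, ht0, htt⟩ :=
      Measure.exists_subset_measure_lt_top hC (pos_iff_ne_zero.2 hC0)
    have e := indicatorConstLp_coeFn (p := 2) (μ := (volume : Measure (E d))) (hs := ht)
      (hμs := htt.ne) (c := (1 : ℂ))
    have hnot : ¬ (∀ᵐ ξ : E d, ξ ∈ C →
        (indicatorConstLp 2 ht htt.ne (1 : ℂ) : L2 d) ξ = 0) := by
      intro h
      refine ht0.ne' ?_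
      rw [measure_eq_zero_iff_ae_notMem]
      filter_upwards [h, e] with ξ h1 h2 h3
      rw [h2] at h1
      simpa [h3] using h1 (htC h3)
    refine ⟨𝓕⁻ (indicatorConstLp 2 ht htt.ne (1 : ℂ) : L2 d), ?_, ?_, ?_⟩
    · intro h0
      apply hnot
      have h1 : (indicatorConstLp 2 ht htt.ne (1 : ℂ) : L2 d) = 0 := by
        rw [← fourier_eq_zero_iff, fourier_fourierInv_eq] at h0
        exact h0
      rw [h1]
      filter_upwards [Lp.coeFn_zero ℂ 2 (volume : Measure (E d))] with ξ h2 _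
      exact h2
    · rw [fourier_fourierInv_eq]
      filter_upwards [e] with ξ h1 h2
      rw [h1, Set.indicator_of_notMem (fun h => h2 (htC h))]
    · rwa [fourier_fourierInv_eq]
  have hK : ∀ x : E d, ∀ h ∈ H, ∀ f ∈ LinearMap.ker T.toLinearMap,
      quasiRegular x h f ∈ LinearMap.ker T.toLinearMap := by
    intro x h hh f hf
    rw [hT] at hf ⊢
    filter_upwards [fourier_quasiRegular x h f,
      (quasiMeasurePreserving_dualAct h).ae hf] with ξ h1 h2 h3
    rw [h1, h2 (fun h4 => h3 ((hinv h hh ξ).1 h4)), mul_zero, mul_zero]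
  rcases hH (LinearMap.ker T.toLinearMap) T.isClosed_ker hK with h | h
  · left
    by_contra hB0
    obtain ⟨f, hf0, hf, -⟩ := key B hB hB0
    have : f ∈ LinearMap.ker T.toLinearMap := (hT f).2 hf
    rw [h, Submodule.mem_bot] at this
    exact hf0 this
  · right
    by_contra hB0
    obtain ⟨f, -, -, hf⟩ := key Bᶜ hB.compl hB0
    exact hf ((hT f).1 (h ▸ Submodule.mem_top))

/-- Preimages of measurable sets under an invariant function are invariant, so each is null or
conull. -/
theorem IsQuasiRegularIrreducible.ae_const {H : Subgroup (GLR d)}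
    (hH : IsQuasiRegularIrreducible H) {Φ : E d → ℝ≥0∞} (hΦ : Measurable Φ)
    (hinv : ∀ h ∈ H, ∀ ξ, Φ (dualAct h ξ) = Φ ξ) : ∃ c, ∀ᵐ ξ, Φ ξ = c := by
  refine Filter.exists_eventuallyEq_const_of_forall_separating MeasurableSet fun U hU => ?_
  rcases hH.null_or_conull (hΦ hU) (fun h hh ξ => by simp [hinv h hh]) with h | h
  · exact .inr (measure_eq_zero_iff_ae_notMem.1 h)
  · refine .inl ?_
    filter_upwards [measure_eq_zero_iff_ae_notMem.1 h] with ξ hξ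
    simpa using hξ

theorem withDensity_map_dualAct_apply {H : Subgroup (GLR d)} [MeasurableSpace H] [BorelSpace H]
    (μ : Measure H) {F : E d → ℝ≥0∞} (hF : Measurable F) (ξ : E d) {B : Set (E d)}
    (hB : MeasurableSet B) :
    (μ.map fun h : H => dualAct (h : GLR d) ξ).withDensity F B =
      ∫⁻ h : H, B.indicator F (dualAct (h : GLR d) ξ) ∂μ := by
  have hact : Measurable fun h : H => dualAct (h : GLR d) ξ :=
    (continuous_dualAct.comp (continuous_subtype_val.prodMk continuous_const)).measurable
  rw [withDensity_apply _ hB, ← lintegral_indicator hB, lintegral_map (hF.indicator hB) hact]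

/-- The dual action of an irreducibly admissible group has an orbit of positive measure. -/
theorem IsIrreduciblyAdmissible.exists_orbit {H : Subgroup (GLR d)}
    (hH : IsIrreduciblyAdmissible H) :
    ∃ ξ : E d, volume {η | ∃ h ∈ H, dualAct h ξ = η} ≠ 0 := by
  let _ : MeasurableSpace H := borel H
  have : BorelSpace H := ⟨rfl⟩
  have := sigmaCompactSpace_of_isClosed hH.isClosed
  obtain ⟨μ, hμ, ψ, hψ, hL⟩ := hH.squareIntegrable
  have hfin : ∫⁻ h : H, (∫⁻ ξ : E d, ‖(𝓕 ψ : L2 d) ξ‖ₑ ^ 2 *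
      ‖(𝓕 ψ : L2 d) (dualAct (h : GLR d) ξ)‖ₑ ^ 2) ∂μ ≠ ⊤ := by
    rw [← lintegral_inner_quasiRegular μ ψ ψ]
    have h1 := eLpNorm_nnreal_pow_eq_lintegral (p := 2) two_ne_zero
      (f := fun p : E d × H => inner ℂ ψ (quasiRegular p.1 (p.2 : GLR d) ψ))
      (μ := ((volume : Measure (E d)).prod μ).withDensity fun p =>
        ENNReal.ofReal (|((p.2 : GLR d) : Matrix (Fin d) (Fin d) ℝ).det|⁻¹))
    norm_num at h1
    rw [← h1]
    exact ENNReal.pow_ne_top hL.2.ne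
  set F : E d → ℝ≥0∞ := fun ξ => ‖(𝓕 ψ : L2 d) ξ‖ₑ ^ 2 with hF
  have hFm : Measurable F := (Lp.stronglyMeasurable _).measurable.enorm.pow_const 2
  have hF0 : ¬ ∀ᵐ ξ, F ξ = 0 := by
    intro h
    apply hψ
    have h1 : (𝓕 ψ : L2 d) = 0 := by
      rw [Lp.eq_zero_iff_ae_eq_zero]
      filter_upwards [h] with ξ hξ
      simpa [hF] using hξ
    exact (fourier_eq_zero_iff ψ).1 h1
  have hact : Measurable fun p : H × E d => dualAct (p.1 : GLR d) p.2 := measurable_dualAct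
  -- `Φ B ξ` is the mass of `B` under the image of `μ` by the orbit map of `ξ`, weighted by `F = |𝓕
  -- ψ|²`.
  let Φ : Set (E d) → E d → ℝ≥0∞ := fun B ξ => ∫⁻ h : H, B.indicator F (dualAct (h : GLR d) ξ) ∂μ
  have hΦm : ∀ B, MeasurableSet B → Measurable (Φ B) := fun B hB =>
    Measurable.lintegral_prod_left'
      (f := fun p : H × E d => B.indicator F (dualAct (p.1 : GLR d) p.2))
      ((hFm.indicator hB).comp hact)
  have hΦc : ∀ B, MeasurableSet B → ∃ c, ∀ᵐ ξ, Φ B ξ = c := by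
    refine fun B hB => hH.irreducible.ae_const (hΦm B hB) fun k hk ξ => ?_
    -- The dual action is a right action, so replacing `ξ` by `kᵀ ξ` is a left translation in the
    -- Haar integral.
    simp only [Φ, ← dualAct_mul]
    exact lintegral_mul_left_eq_self (μ := μ)
      (fun h : H => B.indicator F (dualAct (h : GLR d) ξ)) ⟨k, hk⟩
  have hΦint : ∫⁻ ξ, F ξ * Φ Set.univ ξ ≠ ⊤ := by
    have h1 : ∫⁻ ξ, F ξ * Φ Set.univ ξ = ∫⁻ ξ, ∫⁻ h : H, F ξ * F (dualAct (h : GLR d) ξ) ∂μ := by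
      refine lintegral_congr fun ξ => ?_
      simp only [Φ, Set.indicator_univ]
      rw [lintegral_const_mul' _ _ (by simp [hF])]
    rw [h1, lintegral_lintegral_swap]
    · exact hfin
    · exact ((hFm.comp measurable_fst).mul (hFm.comp (hact.comp measurable_swap))).aemeasurable
  -- Each `h` preserves null sets, so by Tonelli the orbit measures of almost all `ξ` ignore a given
  -- null set.
  have hnull : ∀ B, MeasurableSet B → volume B = 0 → ∀ᵐ ξ, Φ B ξ = 0 := by
    intro B hB hB0
    refine (lintegral_eq_zero_iff (hΦm B hB)).1 ?_
    rw [lintegral_lintegral_swap]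
    · refine (lintegral_congr fun h => ?_).trans lintegral_zero
      refine (lintegral_eq_zero_iff ((hFm.indicator hB).comp
        (dualAct (h : GLR d)).continuous.measurable)).2 ?_
      filter_upwards [(quasiMeasurePreserving_dualAct (h : GLR d)).ae
        (measure_eq_zero_iff_ae_notMem.1 hB0)] with ξ hξ
      exact Set.indicator_of_notMem hξ _
    · exact ((hFm.indicator hB).comp (hact.comp measurable_swap)).aemeasurable
  obtain ⟨c, hc⟩ := hΦc Set.univ .univ
  have hc0 : c ≠ 0 := by
    rintro rfl
    have h1 := (lintegral_eq_zero_iff (hΦm Set.univ .univ)).2 hc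
    simp only [Φ, Set.indicator_univ] at h1
    rw [lintegral_lintegral_swap (f := fun (ξ : E d) (h : H) => F (dualAct (h : GLR d) ξ))
        (hFm.comp (hact.comp measurable_swap)).aemeasurable,
      lintegral_eq_zero_iff (Measurable.lintegral_prod_right'
        (f := fun p : H × E d => F (dualAct (p.1 : GLR d) p.2)) (hFm.comp hact))] at h1
    obtain ⟨h, hh⟩ := h1.exists
    replace hh := (lintegral_eq_zero_iff
      (hFm.comp (dualAct (h : GLR d)).continuous.measurable)).1 hh
    apply hF0
    filter_upwards [(quasiMeasurePreserving_dualAct (h : GLR d)⁻¹).ae hh] with ξ hξ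
    simpa [dualAct_apply_inv] using hξ
  -- If `c` were infinite, finiteness of `∫ F Φ` would force `F` to vanish almost everywhere.
  have hctop : c ≠ ⊤ := by
    rintro rfl
    apply hF0
    filter_upwards [ae_lt_top (hFm.mul (hΦm _ .univ)) hΦint, hc] with ξ h1 h2
    by_contra h3
    rw [Pi.mul_apply, h2, ENNReal.mul_top h3] at h1
    exact lt_irrefl _ h1
  let m : E d → Measure (E d) := fun ξ =>
    (μ.map fun h : H => dualAct (h : GLR d) ξ).withDensity F
  have hm : ∀ ξ B, MeasurableSet B → m ξ B = Φ B ξ := fun ξ B hB =>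
    withDensity_map_dualAct_apply μ hFm ξ hB
  -- A countable algebra generating the Borel sets: the exceptional null sets can be united, and
  -- agreement on it identifies finite measures.
  let 𝒜 := generateSetAlgebra (MeasurableSpace.countableGeneratingSet (E d))
  have h𝒜c : 𝒜.Countable :=
    countable_generateSetAlgebra MeasurableSpace.countable_countableGeneratingSet
  have h𝒜g : MeasurableSpace.generateFrom 𝒜 = inferInstanceAs (MeasurableSpace (E d)) :=
    generateFrom_generateSetAlgebra_eq.trans MeasurableSpace.generateFrom_countableGeneratingSet
  have h𝒜m : ∀ B ∈ 𝒜, MeasurableSet B := fun B hB => by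
    have := MeasurableSpace.measurableSet_generateFrom hB
    rwa [h𝒜g] at this
  have hgood : ∀ᵐ ξ, ∀ B ∈ 𝒜, ∃ cB, (∀ᵐ η, Φ B η = cB) ∧ Φ B ξ = cB := by
    rw [ae_ball_iff h𝒜c]
    intro B hB
    obtain ⟨cB, hcB⟩ := hΦc B (h𝒜m B hB)
    filter_upwards [hcB] with ξ hξ
    exact ⟨cB, hcB, hξ⟩
  obtain ⟨ξ₀, h0, hc₀⟩ := (hgood.and hc).exists
  refine ⟨ξ₀, fun hO => ?_⟩
  -- Suppose the orbit `O` of `ξ₀` is null. Then `m ξ₀` is carried by a null set that `m ξ` does not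
  -- charge for almost every `ξ`, although the two measures agree and are nonzero.
  set O := {η | ∃ h ∈ H, dualAct h ξ₀ = η}
  have hO' : volume (toMeasurable volume O) = 0 := by rw [measure_toMeasurable, hO]
  have hOm := measurableSet_toMeasurable volume O
  obtain ⟨ξ, h1, hc₁, h2⟩ := (hgood.and (hc.and (hnull _ hOm hO'))).exists
  have hfinm : IsFiniteMeasure (m ξ) := ⟨by
    rw [hm ξ _ .univ, hc₁]; exact lt_top_iff_ne_top.2 hctop⟩
  have hmm : m ξ = m ξ₀ := by
    refine ext_of_generate_finite 𝒜 h𝒜g.symm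
      (isSetAlgebra_generateSetAlgebra.isSetRing.isSetSemiring.isPiSystem) ?_ ?_
    · intro B hB
      rw [hm _ _ (h𝒜m B hB), hm _ _ (h𝒜m B hB)]
      obtain ⟨c1, e1, e2⟩ := h0 B hB
      obtain ⟨c2, e3, e4⟩ := h1 B hB
      obtain ⟨η, e5, e6⟩ := (e1.and e3).exists
      rw [e2, e4, ← e5, ← e6]
    · rw [hm _ _ .univ, hm _ _ .univ, hc₁, hc₀]
  have h3 : m ξ (toMeasurable volume O)ᶜ = 0 := by
    rw [hmm, hm _ _ hOm.compl]
    refine (lintegral_congr fun h => ?_).trans lintegral_zero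
    refine Set.indicator_of_notMem ?_ _
    rw [Set.notMem_compl_iff]
    exact subset_toMeasurable volume O ⟨h, h.2, rfl⟩
  have h4 : m ξ Set.univ = 0 := by
    rw [← measure_add_measure_compl hOm, h3, hm _ _ hOm, h2, add_zero]
  rw [hm _ _ .univ, hc₁] at h4
  exact hc0 h4

end Ergodic

/-! ### Strictly upper triangular matrices graded by superdiagonals -/

section Band

variable {d : ℕ}

/-- All entries of `M` below the `r`-th superdiagonal vanish. -/
def IsBand (r : ℕ) (M : Matrix (Fin d) (Fin d) ℝ) : Prop :=
  ∀ i j : Fin d, (j : ℕ) < i + r → M i j = 0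

theorem IsBand.mul {r s : ℕ} {M N : Matrix (Fin d) (Fin d) ℝ} (hM : IsBand r M)
    (hN : IsBand s N) : IsBand (r + s) (M * N) := by
  intro i j hij
  rw [Matrix.mul_apply]
  refine Finset.sum_eq_zero fun k _ => ?_
  by_cases h : (k : ℕ) < i + r
  · rw [hM i k h, zero_mul]
  · rw [hN k j (by omega), mul_zero]

theorem IsBand.mono {r s : ℕ} {M : Matrix (Fin d) (Fin d) ℝ} (hM : IsBand r M) (h : s ≤ r) :
    IsBand s M := fun i j hij => hM i j (by omega)

theorem IsBand.add {r : ℕ} {M N : Matrix (Fin d) (Fin d) ℝ} (hM : IsBand r M)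
    (hN : IsBand r N) : IsBand r (M + N) := fun i j hij => by
  rw [Matrix.add_apply, hM i j hij, hN i j hij, add_zero]

theorem IsBand.smul {r : ℕ} {M : Matrix (Fin d) (Fin d) ℝ} (hM : IsBand r M) (c : ℝ) :
    IsBand r (c • M) := fun i j hij => by
  rw [Matrix.smul_apply, hM i j hij, smul_zero]

theorem IsBand.eq_zero {r : ℕ} {M : Matrix (Fin d) (Fin d) ℝ} (hM : IsBand r M) (h : d ≤ r) :
    M = 0 := by
  ext i j
  exact hM i j (by omega)

theorem isBand_one : IsBand 0 (1 : Matrix (Fin d) (Fin d) ℝ) := fun i j hij =>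
  Matrix.one_apply_ne (by rintro rfl; omega)

theorem IsBand.pow {r : ℕ} {M : Matrix (Fin d) (Fin d) ℝ} (hM : IsBand r M) (n : ℕ) :
    IsBand (n * r) (M ^ n) := by
  induction n with
  | zero => simpa using isBand_one
  | succ n ih => rw [pow_succ, Nat.succ_mul]; exact ih.mul hM

theorem IsBand.pow_eq_zero {M : Matrix (Fin d) (Fin d) ℝ} (hM : IsBand 1 M) {n : ℕ}
    (h : d ≤ n) : M ^ n = 0 := (hM.pow n).eq_zero (by omega)

end Band

/-! ### The commutative local algebra of a shearing group -/

section Algebra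

variable {d : ℕ} {S : Subgroup (GLR d)}

theorem mem_groupAlgebra {s : GLR d} (hs : s ∈ S) :
    (s : Matrix (Fin d) (Fin d) ℝ) ∈ groupAlgebra S := Algebra.subset_adjoin ⟨s, hs, rfl⟩

theorem groupAlgebra_comm (h : ∀ a ∈ S, ∀ b ∈ S, a * b = b * a)
    {M N : Matrix (Fin d) (Fin d) ℝ} (hM : M ∈ groupAlgebra S) (hN : N ∈ groupAlgebra S) :
    M * N = N * M := by
  refine Algebra.commute_of_mem_adjoin_of_forall_mem_commute hN (fun b hb => ?_)
  obtain ⟨s, hs, rfl⟩ := hb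
  refine (Algebra.commute_of_mem_adjoin_of_forall_mem_commute hM (fun c hc => ?_)).symm
  obtain ⟨t, ht, rfl⟩ := hc
  change (s : Matrix (Fin d) (Fin d) ℝ) * (t : Matrix (Fin d) (Fin d) ℝ) = _
  rw [← Units.val_mul, h s hs t ht, Units.val_mul]

/-- The scalar part is additive and multiplicative on upper triangular matrices with constant
diagonal. The algebra is therefore local with residue field `ℝ`. -/
theorem groupAlgebra_tri (h : S ≤ unitriangular d) {M : Matrix (Fin d) (Fin d) ℝ}
    (hM : M ∈ groupAlgebra S) : ∃ c : ℝ, IsBand 1 (M - c • (1 : Matrix (Fin d) (Fin d) ℝ)) := by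
  induction hM using Algebra.adjoin_induction with
  | mem x hx =>
    obtain ⟨s, hs, rfl⟩ := hx
    refine ⟨1, fun i j hij => ?_⟩
    rcases (show (j : ℕ) ≤ i by omega).lt_or_eq with h1 | h1
    · simp [(h hs).2 i j h1, Matrix.one_apply_ne (show i ≠ j by rintro rfl; omega)]
    · obtain rfl := Fin.ext h1
      simp [(h hs).1]
  | algebraMap r =>
    refine ⟨r, fun i j _ => ?_⟩
    simp [Algebra.algebraMap_eq_smul_one]
  | add x y _ _ hx hy =>
    obtain ⟨c, hc⟩ := hx
    obtain ⟨e, he⟩ := hy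
    refine ⟨c + e, ?_⟩
    have := hc.add he
    rwa [show x + y - (c + e) • (1 : Matrix (Fin d) (Fin d) ℝ) = x - c • 1 + (y - e • 1) by
      rw [add_smul]; abel]
  | mul x y _ _ hx hy =>
    obtain ⟨c, hc⟩ := hx
    obtain ⟨e, he⟩ := hy
    refine ⟨c * e, ?_⟩
    have := (((hc.mul he).mono (s := 1) (by norm_num)).add (hc.smul e)).add (he.smul c)
    rwa [show x * y - (c * e) • (1 : Matrix (Fin d) (Fin d) ℝ) =
      (x - c • 1) * (y - e • 1) + e • (x - c • 1) + c • (y - e • 1) by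
      simp only [mul_sub, sub_mul, smul_sub, mul_smul_comm, smul_mul_assoc, mul_one, one_mul,
        smul_smul, mul_comm e c]
      abel]

/-- The strictly upper triangular elements of the algebra of a shearing group. -/
def nilPart (S : Subgroup (GLR d)) : Submodule ℝ (Matrix (Fin d) (Fin d) ℝ) where
  carrier := {M | M ∈ groupAlgebra S ∧ IsBand 1 M}
  zero_mem' := ⟨zero_mem _, fun _ _ _ => rfl⟩
  add_mem' ha hb := ⟨add_mem ha.1 hb.1, ha.2.add hb.2⟩
  smul_mem' c _ ha := ⟨Subalgebra.smul_mem _ ha.1 c, ha.2.smul c⟩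

theorem mul_mem_nilPart {M N : Matrix (Fin d) (Fin d) ℝ} (hM : M ∈ nilPart S)
    (hN : N ∈ nilPart S) : M * N ∈ nilPart S :=
  ⟨mul_mem hM.1 hN.1, (hM.2.mul hN.2).mono (by norm_num)⟩

theorem pow_mem_nilPart {M : Matrix (Fin d) (Fin d) ℝ} (hM : M ∈ nilPart S) (n : ℕ) :
    M ^ (n + 1) ∈ nilPart S := by
  induction n with
  | zero => simpa using hM
  | succ n ih => rw [pow_succ]; exact mul_mem_nilPart ih hM

theorem sub_one_mem_nilPart (h : S ≤ unitriangular d) {s : GLR d} (hs : s ∈ S) :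
    (s : Matrix (Fin d) (Fin d) ℝ) - 1 ∈ nilPart S := by
  refine ⟨sub_mem (mem_groupAlgebra hs) (one_mem _), fun i j hij => ?_⟩
  rcases (show (j : ℕ) ≤ i by omega).lt_or_eq with h1 | h1
  · simp [(h hs).2 i j h1, Matrix.one_apply_ne (show i ≠ j by rintro rfl; omega)]
  · obtain rfl := Fin.ext h1
    simp [(h hs).1]

/-- The algebra of `S` acts by its regular representation on the orbit of the row vector `ξ`, and
`S` consists of the unipotent elements of the algebra. -/
structure IsRegular (S : Subgroup (GLR d)) (ξ : Fin d → ℝ) : Prop where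
  comm : ∀ {M N}, M ∈ groupAlgebra S → N ∈ groupAlgebra S → M * N = N * M
  tri : ∀ {M}, M ∈ groupAlgebra S → ∃ c : ℝ, M - c • 1 ∈ nilPart S
  cyclic : ∀ v : Fin d → ℝ, ∃ M ∈ groupAlgebra S, ξ ᵥ* M = v
  mem_iff : ∀ g : GLR d, g ∈ S ↔ (g : Matrix (Fin d) (Fin d) ℝ) - 1 ∈ nilPart S

/-- By commutativity, a matrix that kills `ξ` kills every `ξ N` with `N` in the algebra, and these
are all row vectors. -/
theorem eq_zero_of_cyclic {ξ : Fin d → ℝ}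
    (hc : ∀ {M N}, M ∈ groupAlgebra S → N ∈ groupAlgebra S → M * N = N * M)
    (h : ∀ v : Fin d → ℝ, ∃ M ∈ groupAlgebra S, ξ ᵥ* M = v)
    {M : Matrix (Fin d) (Fin d) ℝ} (hM : M ∈ groupAlgebra S) (h0 : ξ ᵥ* M = 0) : M = 0 := by
  ext i j
  obtain ⟨N, hN, hN'⟩ := h (Pi.single i 1)
  have : (Pi.single i 1 : Fin d → ℝ) ᵥ* M = 0 := by
    rw [← hN', Matrix.vecMul_vecMul, hc hN hM, ← Matrix.vecMul_vecMul, h0, Matrix.zero_vecMul]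
  simpa using congrFun this j

end Algebra

/-! ### Exponential and logarithm truncated at degree three -/

section TruncatedExp

variable {R : Type*} [Ring R] [Algebra ℝ R]

/-- The exponential polynomial of degree three. -/
def expPoly (X : R) : R := 1 + X + (1 / 2 : ℝ) • X ^ 2 + (1 / 6 : ℝ) • X ^ 3

/-- The logarithm polynomial of degree three: it inverts `1 + n ↦ expPoly`. -/
def logPoly (n : R) : R := n - (1 / 2 : ℝ) • n ^ 2 + (1 / 3 : ℝ) • n ^ 3

theorem expPoly_logPoly {n : R} (hn : n ^ 4 = 0) : expPoly (logPoly n) = 1 + n := by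
  -- The explicit cofactor of `X⁴` is the remainder of the composed polynomials. The identity is
  -- checked at real points and then evaluated at `n`.
  have h : expPoly (logPoly (Polynomial.X : Polynomial ℝ)) =
      1 + Polynomial.X + Polynomial.X ^ 4 * ((5 / 24 : ℝ) • 1 + (1 / 8 : ℝ) • Polynomial.X -
        (19 / 144 : ℝ) • Polynomial.X ^ 2 + (7 / 72 : ℝ) • Polynomial.X ^ 3
        - (1 / 36 : ℝ) • Polynomial.X ^ 4 + (1 / 162 : ℝ) • Polynomial.X ^ 5) := by
    refine Polynomial.funext fun x => ?_
    simp [expPoly, logPoly]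
    ring
  have h2 := congrArg (Polynomial.aeval n) h
  simpa [expPoly, logPoly, hn] using h2

theorem expPoly_eq_exp [Module ℚ R] [SMulCommClass ℚ R R] {X : R} (hX : X ^ 4 = 0) :
    expPoly X = IsNilpotent.exp X := by
  rw [IsNilpotent.exp_eq_sum hX]
  simp only [Finset.sum_range_succ, Finset.sum_range_zero, Nat.factorial]
  have e : ∀ (q : ℚ) (x : R), q • x = (q : ℝ) • x := fun q x => by
    exact (Rat.cast_smul_eq_qsmul ℝ q x).symm
  simp only [e, expPoly]
  norm_num

/-- The third nilpotency hypothesis does not follow from the other two, which only give `(X + Y)⁷ =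
0`. -/
theorem expPoly_add {X Y : R} (h : Commute X Y) (hX : X ^ 4 = 0) (hY : Y ^ 4 = 0)
    (hXY : (X + Y) ^ 4 = 0) : expPoly (X + Y) = expPoly X * expPoly Y := by
  let _ : Algebra ℚ R := Algebra.compHom R (algebraMap ℚ ℝ)
  rw [expPoly_eq_exp hX, expPoly_eq_exp hY, expPoly_eq_exp hXY]
  exact IsNilpotent.exp_add_of_commute h ⟨4, hX⟩ ⟨4, hY⟩

theorem expPoly_zero : expPoly (0 : R) = 1 := by simp [expPoly]

end TruncatedExp

/-! ### Smoothness of the orbit parametrisation -/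

section Differentiability

variable {k : ℕ}

attribute [local instance] Matrix.linftyOpNormedRing Matrix.linftyOpNormedAlgebra

theorem differentiable_vecMul_expPoly {F : Type*} [NormedAddCommGroup F] [NormedSpace ℝ F]
    [FiniteDimensional ℝ F] (X : F →ₗ[ℝ] Matrix (Fin k) (Fin k) ℝ) (ξ : Fin k → ℝ) (i : Fin k) :
    Differentiable ℝ fun v => (ξ ᵥ* expPoly (X v)) i := by
  have h1 : Differentiable ℝ X := (LinearMap.toContinuousLinearMap X).differentiable
  have h2 : Differentiable ℝ fun v => expPoly (X v) := by
    unfold expPoly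
    exact (((differentiable_const _).add h1).add ((h1.pow 2).const_smul (1 / 2 : ℝ))).add
      ((h1.pow 3).const_smul (1 / 6 : ℝ))
  let ℓ : Matrix (Fin k) (Fin k) ℝ →ₗ[ℝ] ℝ :=
    { toFun := fun M => (ξ ᵥ* M) i
      map_add' := fun M N => by simp [Matrix.vecMul_add]
      map_smul' := fun c M => by simp [Matrix.vecMul_smul] }
  exact (LinearMap.toContinuousLinearMap ℓ).differentiable.comp h2

end Differentiability

theorem continuous_expPoly {k : ℕ} {F : Type*} [NormedAddCommGroup F] [NormedSpace ℝ F]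
    [FiniteDimensional ℝ F] (X : F →ₗ[ℝ] Matrix (Fin k) (Fin k) ℝ) :
    Continuous fun v => expPoly (X v) := by
  have h1 : Continuous X := X.continuous_of_finiteDimensional
  unfold expPoly
  fun_prop

/-! ### What an orbit of positive measure says about `S` -/

section Structure

variable {k : ℕ}

/-- Replace the first coordinate by zero. -/
def perp : E (k + 1) →ₗ[ℝ] (Fin (k + 1) → ℝ) where
  toFun v := fun i => if i = 0 then 0 else v i
  map_add' v w := by ext i; by_cases h : i = 0 <;> simp [h]
  map_smul' c v := by ext i; by_cases h : i = 0 <;> simp [h]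

theorem volume_submodule_eq_zero {d : ℕ} {W : Submodule ℝ (E d)} (h : W ≠ ⊤) :
    volume (W : Set (E d)) = 0 := Measure.addHaar_submodule _ W h

theorem volume_setOf_eq_zero_of_subset {d : ℕ} {O Γ : Set (E d)} {Ψ : E d → E d}
    (hΨ : Differentiable ℝ Ψ) (hΓ : volume Γ = 0)
    (hO : ∀ η ∈ O, ∃ v ∈ Γ, η = Ψ v ∨ η = -Ψ v) : volume O = 0 := by
  have h1 := addHaar_image_eq_zero_of_differentiableOn_of_addHaar_eq_zero
    (volume : Measure (E d)) (f := Ψ) (s := Γ) hΨ.differentiableOn hΓ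
  have h2 := addHaar_image_eq_zero_of_differentiableOn_of_addHaar_eq_zero
    (volume : Measure (E d)) (f := fun v => -Ψ v) (s := Γ) hΨ.neg.differentiableOn hΓ
  refine measure_mono_null (fun η hη => ?_) (measure_union_null h1 h2)
  obtain ⟨v, hv, rfl | rfl⟩ := hO η hη
  · exact .inl ⟨v, hv, rfl⟩
  · exact .inr ⟨v, hv, rfl⟩

theorem IsShearletGroupWith.decomposition {d : ℕ} {H S : Subgroup (GLR d)}
    (h : IsShearletGroupWith H S) : ∃ y : Fin d → ℝ, ∀ g ∈ H, ∃ s ∈ S, ∃ r : ℝ,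
      (g : Matrix (Fin d) (Fin d) ℝ) = (s : Matrix (Fin d) (Fin d) ℝ) *
        Matrix.diagonal (fun i => Real.exp (r * y i)) ∨
      (g : Matrix (Fin d) (Fin d) ℝ) = -((s : Matrix (Fin d) (Fin d) ℝ) *
        Matrix.diagonal (fun i => Real.exp (r * y i))) := by
  obtain ⟨D, y, -, -, hD, hu⟩ := h.complement
  refine ⟨y, fun g hg => ?_⟩
  -- Decomposing the inverse reverses the factors, so that a row vector meets the shear before the
  -- diagonal matrix.
  obtain ⟨⟨ε, δ, s⟩, hp, -⟩ := hu g⁻¹ (H.inv_mem hg)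
  simp only at hp
  obtain ⟨r, hr⟩ := (hD _).1 (D.inv_mem δ.2)
  have hexp : NormedSpace.exp (r • Matrix.diagonal y) =
      Matrix.diagonal (fun i => Real.exp (r * y i)) := by
    rw [← Matrix.diagonal_smul, Matrix.exp_diagonal]
    congr 1
    funext i
    rw [Pi.coe_exp, ← Real.exp_eq_exp_ℝ]
    rfl
  rw [hexp] at hr
  refine ⟨(s : GLR d)⁻¹, S.inv_mem s.2, r, ?_⟩
  rw [← hr, ← Units.val_mul, ← _root_.mul_inv_rev]
  set t : GLR d := (δ : GLR d) * (s : GLR d)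
  rcases Int.units_eq_one_or ε with rfl | rfl
  · left
    have : g⁻¹ = t := Units.ext (by rw [hp]; simp)
    rw [← this, inv_inv]
  · right
    have : g⁻¹ = -t := Units.ext (by rw [hp]; simp)
    have h2 : g = (-t)⁻¹ := by rw [← this, inv_inv]
    rw [h2, ← Units.val_neg, ← inv_neg]

-- Steinhaus: the difference set of a set of positive measure is a neighbourhood of zero. So `Γ` is
-- open as well as closed, and the space is connected.
open scoped Pointwise in
theorem addSubgroup_eq_top_of_volume_ne_zero {d : ℕ} (Γ : AddSubgroup (E d))
    (hc : IsClosed (Γ : Set (E d)))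
    (h : volume (Γ : Set (E d)) ≠ 0) : Γ = ⊤ := by
  have h1 := Measure.sub_mem_nhds_zero_of_addHaar_pos (volume : Measure (E d)) (Γ : Set (E d))
    hc.measurableSet (pos_iff_ne_zero.2 h)
  have h2 : (Γ : Set (E d)) - (Γ : Set (E d)) ⊆ (Γ : Set (E d)) := by
    rintro _ ⟨a, ha, b, hb, rfl⟩
    exact Γ.sub_mem ha hb
  have h3 := Γ.isOpen_of_mem_nhds (Filter.mem_of_superset h1 h2)
  have h4 : IsClopen (Γ : Set (E d)) := ⟨hc, h3⟩
  exact SetLike.coe_injective (h4.eq_univ ⟨0, Γ.zero_mem⟩)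

theorem perp_apply_zero (v : E (k + 1)) : perp v 0 = 0 := by simp [perp]

/-- A vector of `E (k + 1)` encodes a pair: coordinate `0` stores the dilation parameter `r`, the
others store the shear parameter `w`. -/
theorem perp_toLp {w : Fin (k + 1) → ℝ} (hw : w 0 = 0) (r : ℝ) :
    perp (WithLp.toLp 2 (w + Pi.single 0 r)) = w := by
  ext i
  by_cases h : i = 0
  · simp [perp, h, hw]
  · simp [perp, h]

/-- Otherwise the displacements `ξ n` span a proper subspace of the hyperplane `w 0 = 0`. With the
dilation parameter they form a null set whose smooth image covers the orbit up to sign. -/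
theorem exists_nilPart_of_orbit {H S : Subgroup (GLR (k + 1))} (h : IsShearletGroupWith H S)
    {ξ : E (k + 1)} (hξ : volume {η | ∃ h ∈ H, dualAct h ξ = η} ≠ 0)
    {w : Fin (k + 1) → ℝ} (hw : w 0 = 0) : ∃ n ∈ nilPart S, ξ.ofLp ᵥ* n = w := by
  obtain ⟨y, hy⟩ := h.decomposition
  by_contra hcon
  apply hξ
  let W : Submodule ℝ (Fin (k + 1) → ℝ) :=
    { carrier := {w | ∃ n ∈ nilPart S, ξ.ofLp ᵥ* n = w}
      zero_mem' := ⟨0, zero_mem _, Matrix.vecMul_zero _⟩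
      add_mem' := by
        rintro _ _ ⟨n, hn, rfl⟩ ⟨m, hm, rfl⟩
        exact ⟨n + m, add_mem hn hm, Matrix.vecMul_add _ _ _⟩
      smul_mem' := by
        rintro c _ ⟨n, hn, rfl⟩
        exact ⟨c • n, Submodule.smul_mem _ c hn, Matrix.vecMul_smul _ _ _⟩ }
  have hW : W.comap perp ≠ ⊤ := by
    intro htop
    have : WithLp.toLp 2 (w + Pi.single 0 (0 : ℝ)) ∈ W.comap perp := htop ▸ Submodule.mem_top
    rw [Submodule.mem_comap, perp_toLp hw] at this
    exact hcon this
  let Ψ : E (k + 1) → E (k + 1) := fun v =>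
    WithLp.toLp 2 fun i => (ξ i + perp v i) * Real.exp (v 0 * y i)
  have hΨ : Differentiable ℝ Ψ := by
    rw [differentiable_piLp]
    intro i
    have h1 : Differentiable ℝ fun v : E (k + 1) => perp v i :=
      (LinearMap.toContinuousLinearMap ((LinearMap.proj i).comp perp)).differentiable
    have h2 : Differentiable ℝ fun v : E (k + 1) => v 0 :=
      (EuclideanSpace.proj (0 : Fin (k + 1)) : E (k + 1) →L[ℝ] ℝ).differentiable
    exact ((differentiable_const _).add h1).mul ((h2.mul_const _).exp)
  refine volume_setOf_eq_zero_of_subset hΨ (volume_submodule_eq_zero hW) ?_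
  rintro _ ⟨g, hg, rfl⟩
  obtain ⟨s, hs, r, hg⟩ := hy g hg
  have hn := sub_one_mem_nilPart h.le_unitriangular hs
  set w' := ξ.ofLp ᵥ* ((s : Matrix (Fin (k + 1)) (Fin (k + 1)) ℝ) - 1) with hw'
  have hw0 : w' 0 = 0 := by
    rw [hw', Matrix.vecMul, dotProduct]
    exact Finset.sum_eq_zero fun i _ => by rw [hn.2 i 0 (by simp), mul_zero]
  refine ⟨WithLp.toLp 2 (w' + Pi.single 0 r), ?_, ?_⟩
  · change perp _ ∈ W
    rw [perp_toLp hw0]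
    exact ⟨_, hn, rfl⟩
  · have h3 : Ψ (WithLp.toLp 2 (w' + Pi.single 0 r)) = WithLp.toLp 2 (ξ.ofLp ᵥ*
        ((s : Matrix (Fin (k + 1)) (Fin (k + 1)) ℝ) *
          Matrix.diagonal (fun i => Real.exp (r * y i)))) := by
      ext i
      simp only [Ψ]
      have hw1 : ξ.ofLp ᵥ* (s : Matrix (Fin (k + 1)) (Fin (k + 1)) ℝ) = ξ.ofLp + w' := by
        rw [hw', Matrix.vecMul_sub, Matrix.vecMul_one, add_sub_cancel]
      rw [perp_toLp hw0, ← Matrix.vecMul_vecMul, Matrix.vecMul_diagonal, hw1]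
      simp [hw0]
    rw [h3, dualAct_apply]
    rcases hg with hg | hg
    · left; rw [hg]
    · right; rw [hg, Matrix.vecMul_neg]; rfl

/-- Upper triangular matrices acting on row vectors preserve the hyperplane where the first
coordinate vanishes, and it is null. -/
theorem apply_zero_ne_zero_of_orbit {H S : Subgroup (GLR (k + 1))} (h : IsShearletGroupWith H S)
    {ξ : E (k + 1)} (hξ : volume {η | ∃ h ∈ H, dualAct h ξ = η} ≠ 0) : ξ 0 ≠ 0 := by
  obtain ⟨y, hy⟩ := h.decomposition
  intro h0
  apply hξ
  let W : Submodule ℝ (E (k + 1)) := LinearMap.ker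
    ((EuclideanSpace.proj (0 : Fin (k + 1)) : E (k + 1) →L[ℝ] ℝ)).toLinearMap
  have hW : W ≠ ⊤ := by
    intro htop
    have : (EuclideanSpace.single (0 : Fin (k + 1)) (1 : ℝ)) ∈ W := htop ▸ Submodule.mem_top
    simp [W] at this
  refine measure_mono_null ?_ (volume_submodule_eq_zero hW)
  rintro _ ⟨g, hg, rfl⟩
  obtain ⟨s, hs, r, hg⟩ := hy g hg
  have h1 : (ξ.ofLp ᵥ* (s : Matrix (Fin (k + 1)) (Fin (k + 1)) ℝ)) 0 = 0 := by
    rw [Matrix.vecMul, dotProduct]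
    refine Finset.sum_eq_zero fun i _ => ?_
    by_cases hi : i = 0
    · rw [hi, h0, zero_mul]
    · rw [(h.le_unitriangular hs).2 i 0 (Fin.pos_of_ne_zero hi), mul_zero]
  change (dualAct g ξ) 0 = 0
  rw [dualAct_apply]
  rcases hg with hg | hg
  · rw [hg, ← Matrix.vecMul_vecMul]
    simp [Matrix.vecMul_diagonal, h1]
  · rw [hg, Matrix.vecMul_neg, ← Matrix.vecMul_vecMul]
    change -((_ ᵥ* _ : Fin (k + 1) → ℝ) 0) = 0
    rw [Matrix.vecMul_diagonal, h1, zero_mul, neg_zero]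

/-- A multiple of the identity produces the first coordinate of `v`; the nilpotent part produces the
rest. -/
theorem cyclic_of_orbit {H S : Subgroup (GLR (k + 1))} (h : IsShearletGroupWith H S)
    {ξ : E (k + 1)} (hξ : volume {η | ∃ h ∈ H, dualAct h ξ = η} ≠ 0) (v : Fin (k + 1) → ℝ) :
    ∃ M ∈ groupAlgebra S, ξ.ofLp ᵥ* M = v := by
  have h0 := apply_zero_ne_zero_of_orbit h hξ
  obtain ⟨n, hn, hnw⟩ := exists_nilPart_of_orbit h hξ (w := v - (v 0 / ξ 0) • ξ.ofLp)
    (by simp [h0])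
  refine ⟨n + (v 0 / ξ 0) • 1, add_mem hn.1 (Subalgebra.smul_mem _ (one_mem _) _), ?_⟩
  rw [Matrix.vecMul_add, hnw, Matrix.vecMul_smul, Matrix.vecMul_one, sub_add_cancel]

/-- The parameters whose exponential lies in `S` form a closed additive group. It cannot be null,
because the orbit is covered up to sign by its smooth image; hence it is everything. Dimension at
most four makes the cubic truncations exact. -/
theorem expPoly_mem_of_orbit (hk : k + 1 ≤ 4) {H S : Subgroup (GLR (k + 1))}
    (h : IsShearletGroupWith H S)
    {ξ : E (k + 1)} (hξ : volume {η | ∃ h ∈ H, dualAct h ξ = η} ≠ 0)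
    {n : Matrix (Fin (k + 1)) (Fin (k + 1)) ℝ} (hn : n ∈ nilPart S) :
    ∃ s ∈ S, (s : Matrix (Fin (k + 1)) (Fin (k + 1)) ℝ) = expPoly n := by
  obtain ⟨y, hy⟩ := h.decomposition
  have hcomm : ∀ {M N}, M ∈ groupAlgebra S → N ∈ groupAlgebra S → M * N = N * M :=
    groupAlgebra_comm h.abelian
  have hcyc := cyclic_of_orbit h hξ
  let R : groupAlgebra S →ₗ[ℝ] (Fin (k + 1) → ℝ) :=
    { toFun := fun M => ξ.ofLp ᵥ* (M : Matrix (Fin (k + 1)) (Fin (k + 1)) ℝ)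
      map_add' := fun M N => Matrix.vecMul_add _ _ _
      map_smul' := fun c M => Matrix.vecMul_smul _ _ _ }
  have hR : Function.Bijective R := by
    refine ⟨(injective_iff_map_eq_zero R).2 fun M hM => ?_, fun v => ?_⟩
    · exact Subtype.ext (eq_zero_of_cyclic hcomm hcyc M.2 hM)
    · obtain ⟨M, hM, hv⟩ := hcyc v
      exact ⟨⟨M, hM⟩, hv⟩
  -- `X v` is the nilpotent matrix that sends `ξ` to the shear part of `v`, obtained by inverting
  -- evaluation at `ξ`.
  let X : E (k + 1) →ₗ[ℝ] Matrix (Fin (k + 1)) (Fin (k + 1)) ℝ :=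
    (groupAlgebra S).val.toLinearMap ∘ₗ (LinearEquiv.ofBijective R hR).symm.toLinearMap ∘ₗ perp
  have hXmem : ∀ v, X v ∈ nilPart S := by
    intro v
    obtain ⟨m, hm, hmw⟩ := exists_nilPart_of_orbit h hξ (perp_apply_zero v)
    have : X v = m := by
      have : (LinearEquiv.ofBijective R hR).symm (perp v) = ⟨m, hm.1⟩ := by
        rw [LinearEquiv.symm_apply_eq]
        exact hmw.symm
      change (((LinearEquiv.ofBijective R hR).symm (perp v) : groupAlgebra S) : Matrix _ _ ℝ) = m
      rw [this]
    rwa [this]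
  have hXsurj : ∀ n ∈ nilPart S, ∀ r : ℝ, ∃ v : E (k + 1), X v = n ∧ v 0 = r := by
    intro n hn r
    have hw0 : (ξ.ofLp ᵥ* n) 0 = 0 := by
      rw [Matrix.vecMul, dotProduct]
      exact Finset.sum_eq_zero fun i _ => by rw [hn.2 i 0 (by simp), mul_zero]
    refine ⟨WithLp.toLp 2 (ξ.ofLp ᵥ* n + Pi.single 0 r), ?_, by simp [hw0]⟩
    change (((LinearEquiv.ofBijective R hR).symm (perp _) : groupAlgebra S) : Matrix _ _ ℝ) = n
    rw [perp_toLp hw0]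
    have : (LinearEquiv.ofBijective R hR).symm (ξ.ofLp ᵥ* n) = ⟨n, hn.1⟩ := by
      rw [LinearEquiv.symm_apply_eq]
      rfl
    rw [this]
  have h4 : ∀ n ∈ nilPart S, n ^ 4 = 0 := fun n hn => hn.2.pow_eq_zero hk
  have hexp_add : ∀ v w, expPoly (X (v + w)) = expPoly (X v) * expPoly (X w) := by
    intro v w
    rw [map_add]
    exact expPoly_add (hcomm (hXmem v).1 (hXmem w).1) (h4 _ (hXmem v)) (h4 _ (hXmem w))
      (h4 _ (add_mem (hXmem v) (hXmem w)))
  have hexp_neg : ∀ v, expPoly (X v) * expPoly (X (-v)) = 1 := by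
    intro v
    rw [← hexp_add, add_neg_cancel, map_zero, expPoly_zero]
  let e : E (k + 1) → GLR (k + 1) := fun v =>
    ⟨expPoly (X v), expPoly (X (-v)), hexp_neg v, by simpa using hexp_neg (-v)⟩
  have he : Continuous e := by
    rw [Units.continuous_iff]
    refine ⟨continuous_expPoly X, ?_⟩
    exact (continuous_expPoly X).comp continuous_neg
  have he_add : ∀ v w, e (v + w) = e v * e w := fun v w => Units.ext (hexp_add v w)
  -- Coordinate `0` is unconstrained in `Γ`, so `Γ` amounts to the logarithms of `S` times a free
  -- dilation parameter.
  let Γ : AddSubgroup (E (k + 1)) :=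
    { carrier := {v | e v ∈ S}
      zero_mem' := by
        have : e 0 = 1 := Units.ext (by simp [e, expPoly_zero])
        change e 0 ∈ S
        rw [this]
        exact S.one_mem
      add_mem' := fun {v w} hv hw => by
        change e (v + w) ∈ S
        rw [he_add]
        exact S.mul_mem hv hw
      neg_mem' := fun {v} hv => by
        have : e (-v) = (e v)⁻¹ := Units.ext rfl
        change e (-v) ∈ S
        rw [this]
        exact S.inv_mem hv }
  have hΓc : IsClosed (Γ : Set (E (k + 1))) := h.isClosed.preimage he
  have hΓ : Γ = ⊤ := by
    refine addSubgroup_eq_top_of_volume_ne_zero Γ hΓc fun hΓ0 => hξ ?_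
    let Ψ : E (k + 1) → E (k + 1) := fun v =>
      WithLp.toLp 2 fun i => (ξ.ofLp ᵥ* expPoly (X v)) i * Real.exp (v 0 * y i)
    have hΨ : Differentiable ℝ Ψ := by
      rw [differentiable_piLp]
      intro i
      have h2 : Differentiable ℝ fun v : E (k + 1) => v 0 :=
        (EuclideanSpace.proj (0 : Fin (k + 1)) : E (k + 1) →L[ℝ] ℝ).differentiable
      exact (differentiable_vecMul_expPoly X ξ.ofLp i).mul ((h2.mul_const _).exp)
    refine volume_setOf_eq_zero_of_subset hΨ hΓ0 ?_
    rintro _ ⟨g, hg, rfl⟩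
    obtain ⟨s, hs, r, hg⟩ := hy g hg
    have hs1 := sub_one_mem_nilPart h.le_unitriangular hs
    have hlog : logPoly ((s : Matrix (Fin (k + 1)) (Fin (k + 1)) ℝ) - 1) ∈ nilPart S :=
      add_mem (sub_mem hs1 (Submodule.smul_mem _ _ (pow_mem_nilPart hs1 1)))
        (Submodule.smul_mem _ _ (pow_mem_nilPart hs1 2))
    obtain ⟨v, hv, hvr⟩ := hXsurj _ hlog r
    have hev : expPoly (X v) = s := by
      rw [hv, expPoly_logPoly (h4 _ hs1), add_sub_cancel]
    refine ⟨v, ?_, ?_⟩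
    · change e v ∈ S
      have : e v = s := Units.ext hev
      rwa [this]
    · have h3 : Ψ v = WithLp.toLp 2 (ξ.ofLp ᵥ*
          ((s : Matrix (Fin (k + 1)) (Fin (k + 1)) ℝ) *
            Matrix.diagonal (fun i => Real.exp (r * y i)))) := by
        ext i
        simp only [Ψ]
        rw [← Matrix.vecMul_vecMul, Matrix.vecMul_diagonal, hev, hvr]
      rw [h3, dualAct_apply]
      rcases hg with hg | hg
      · left; rw [hg]
      · right; rw [hg, Matrix.vecMul_neg]; rfl
  obtain ⟨v, hv, -⟩ := hXsurj n hn 0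
  refine ⟨e v, ?_, by rw [← hv]⟩
  have : v ∈ Γ := hΓ ▸ AddSubgroup.mem_top v
  exact this

/-- A shearing group in dimension at most four is the group of unipotent elements of a commutative
algebra in its regular representation. -/
theorem IsShearingSubgroup.exists_isRegular (hk : k + 1 ≤ 4) {S : Subgroup (GLR (k + 1))}
    (hS : IsShearingSubgroup S) : ∃ ξ, IsRegular S ξ := by
  obtain ⟨H, h⟩ := hS
  obtain ⟨ξ, hξ⟩ := h.admissible.exists_orbit
  refine ⟨ξ.ofLp, groupAlgebra_comm h.abelian, fun {M} hM => ?_, cyclic_of_orbit h hξ,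
    fun g => ⟨sub_one_mem_nilPart h.le_unitriangular, fun hg => ?_⟩⟩
  · obtain ⟨c, hc⟩ := groupAlgebra_tri h.le_unitriangular hM
    exact ⟨c, sub_mem hM (Subalgebra.smul_mem _ (one_mem _) c), hc⟩
  · have hlog : logPoly ((g : Matrix (Fin (k + 1)) (Fin (k + 1)) ℝ) - 1) ∈ nilPart S :=
      add_mem (sub_mem hg (Submodule.smul_mem _ _ (pow_mem_nilPart hg 1)))
        (Submodule.smul_mem _ _ (pow_mem_nilPart hg 2))
    obtain ⟨s, hs, hsn⟩ := expPoly_mem_of_orbit hk h hξ hlog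
    rw [expPoly_logPoly (hg.2.pow_eq_zero hk), add_sub_cancel] at hsn
    have : s = g := Units.ext hsn
    rwa [← this]

end Structure

end ShearletGroups

namespace ShearletGroups

/-! ### Charts: construction of generalized shearlet dilation groups -/

open FourierTransform
open scoped ENNReal

/-- A linear chart of a commutative algebra of upper triangular matrices by its first rows. -/
structure IsShearletChart {k : ℕ}
    (L : (Fin (k + 1) → ℝ) →ₗ[ℝ] Matrix (Fin (k + 1)) (Fin (k + 1)) ℝ) : Prop where
  row : ∀ v j, L v 0 j = v j
  diag : ∀ v i, L v i i = v 0
  tri : ∀ v i j, j < i → L v i j = 0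
  mul : ∀ v w, L v * L w = L (v ᵥ* L w)
  comm : ∀ v w, L v * L w = L w * L v

namespace IsShearletChart

variable {k : ℕ} {L : (Fin (k + 1) → ℝ) →ₗ[ℝ] Matrix (Fin (k + 1)) (Fin (k + 1)) ℝ}

theorem injective (hL : IsShearletChart L) : Function.Injective L := fun v w h => by
  ext j
  rw [← hL.row v, h, hL.row]

/-- This symmetry lets group element and frequency trade places in the proof of irreducibility. -/
theorem vecMul_comm (hL : IsShearletChart L) (v w : Fin (k + 1) → ℝ) :
    v ᵥ* L w = w ᵥ* L v := hL.injective (by rw [← hL.mul, hL.comm, hL.mul])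

theorem det (hL : IsShearletChart L) (v : Fin (k + 1) → ℝ) : (L v).det = v 0 ^ (k + 1) := by
  rw [Matrix.det_of_isUpperTriangular (fun i j h => hL.tri v i j h)]
  simp [hL.diag]

theorem single_vecMul (hL : IsShearletChart L) (v : Fin (k + 1) → ℝ) :
    (Pi.single 0 1 : Fin (k + 1) → ℝ) ᵥ* L v = v := by
  ext j
  simp [hL.row]

/-- An invertible idempotent is the identity. -/
theorem one (hL : IsShearletChart L) : L (Pi.single 0 1) = 1 := by
  have h : L (Pi.single 0 1) * L (Pi.single 0 1) = L (Pi.single 0 1) := by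
    rw [hL.mul, hL.single_vecMul]
  have hu : IsUnit (L (Pi.single 0 1)) := by
    rw [Matrix.isUnit_iff_isUnit_det, hL.det]
    simp
  exact (hu.mul_eq_left).1 h

theorem vecMul_zero (hL : IsShearletChart L) (v w : Fin (k + 1) → ℝ) :
    (v ᵥ* L w) 0 = v 0 * w 0 := by
  -- In the last row of an upper triangular matrix only the diagonal entry can survive, so one term
  -- of the product remains.
  rw [← hL.diag (v ᵥ* L w) (Fin.last k), ← hL.mul, Matrix.mul_apply,
    Finset.sum_eq_single (Fin.last k), hL.diag, hL.diag]
  · intro j _ hj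
    rw [hL.tri _ _ _ (lt_of_le_of_ne (Fin.le_last j) hj), zero_mul]
  · simp

/-- The group of invertible elements of a chart. -/
def group (hL : IsShearletChart L) : Subgroup (GLR (k + 1)) where
  carrier := {g | ∃ v, v 0 ≠ 0 ∧ (g : Matrix (Fin (k + 1)) (Fin (k + 1)) ℝ) = L v}
  one_mem' := ⟨Pi.single 0 1, by simp, by rw [hL.one, Units.val_one]⟩
  mul_mem' := by
    rintro a b ⟨v, hv, ha⟩ ⟨w, hw, hb⟩
    refine ⟨v ᵥ* L w, ?_, by rw [Units.val_mul, ha, hb, hL.mul]⟩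
    rw [hL.vecMul_zero]
    exact mul_ne_zero hv hw
  inv_mem' := by
    rintro a ⟨v, hv, ha⟩
    set w := (Pi.single 0 1 : Fin (k + 1) → ℝ) ᵥ*
      ((a⁻¹ : GLR (k + 1)) : Matrix (Fin (k + 1)) (Fin (k + 1)) ℝ) with hw
    have h1 : w ᵥ* L v = Pi.single 0 1 := by
      rw [hw, ← ha, Matrix.vecMul_vecMul, ← Units.val_mul, inv_mul_cancel, Units.val_one,
        Matrix.vecMul_one]
    refine ⟨w, fun h0 => ?_, Units.inv_eq_of_mul_eq_one_left ?_⟩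
    · have := hL.vecMul_zero w v
      rw [h1, h0, zero_mul] at this
      simp at this
    · rw [ha, hL.mul, h1, hL.one]

theorem mem_group (hL : IsShearletChart L) {g : GLR (k + 1)} :
    g ∈ hL.group ↔ ∃ v, v 0 ≠ 0 ∧ (g : Matrix (Fin (k + 1)) (Fin (k + 1)) ℝ) = L v := Iff.rfl

/-- Membership is the closed condition that `g` equals the chart of its own first row; invertibility
of `g` makes the first entry nonzero. -/
theorem isClosed_group (hL : IsShearletChart L) : IsClosed (hL.group : Set (GLR (k + 1))) := by
  have h : (hL.group : Set (GLR (k + 1))) =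
      {g : GLR (k + 1) | (g : Matrix (Fin (k + 1)) (Fin (k + 1)) ℝ) = L (fun j => g.val 0 j)} := by
    ext g
    refine ⟨?_, fun hg => ⟨_, fun h0 => det_ne_zero g ?_, hg⟩⟩
    · rintro ⟨v, -, hg⟩
      have : (fun j => g.val 0 j) = v := by ext j; rw [hg, hL.row]
      rw [Set.mem_ofPred_eq, this, hg]
    · rw [Set.mem_ofPred_eq] at hg
      rw [hg, hL.det, h0, zero_pow (by omega)]
  rw [h]
  have c1 : Continuous L := L.continuous_of_finiteDimensional
  refine isClosed_eq Units.continuous_val (c1.comp ?_)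
  exact continuous_pi fun j => (Units.continuous_val.matrix_elem 0 j)

/-- The group element with given first row. -/
def unit (hL : IsShearletChart L) (v : {v : E (k + 1) // v 0 ≠ 0}) : GLR (k + 1) :=
  Matrix.GeneralLinearGroup.mkOfDetNeZero (L v.1.ofLp) (by
    rw [hL.det]; exact pow_ne_zero _ v.2)

theorem val_unit (hL : IsShearletChart L) (v : {v : E (k + 1) // v 0 ≠ 0}) :
    (hL.unit v : Matrix (Fin (k + 1)) (Fin (k + 1)) ℝ) = L v.1.ofLp := rfl

theorem unit_mem (hL : IsShearletChart L) (v : {v : E (k + 1) // v 0 ≠ 0}) :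
    hL.unit v ∈ hL.group := ⟨_, v.2, rfl⟩

theorem continuous_unit (hL : IsShearletChart L) : Continuous hL.unit := by
  have c1 : Continuous fun v : {v : E (k + 1) // v 0 ≠ 0} => L v.1.ofLp :=
    L.continuous_of_finiteDimensional.comp
      ((PiLp.continuous_ofLp 2 _).comp continuous_subtype_val)
  rw [Units.continuous_iff]
  refine ⟨c1, ?_⟩
  have h : ∀ v, ((hL.unit v)⁻¹ : GLR (k + 1)).val =
      ((L v.1.ofLp).det)⁻¹ • (L v.1.ofLp).adjugate := by
    intro v
    rw [Matrix.coe_units_inv, Matrix.inv_def, Ring.inverse_eq_inv']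
    rfl
  simp only [h]
  refine (c1.matrix_det.inv₀ fun v => ?_).smul c1.matrix_adjugate
  rw [hL.det]
  exact pow_ne_zero _ v.2

theorem ae_apply_zero_ne_zero : ∀ᵐ ξ : E (k + 1), ξ 0 ≠ 0 := by
  let W : Submodule ℝ (E (k + 1)) := LinearMap.ker
    ((EuclideanSpace.proj (0 : Fin (k + 1)) : E (k + 1) →L[ℝ] ℝ)).toLinearMap
  have hW : W ≠ ⊤ := by
    intro htop
    have : (EuclideanSpace.single (0 : Fin (k + 1)) (1 : ℝ)) ∈ W := htop ▸ Submodule.mem_top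
    simp [W] at this
  exact measure_eq_zero_iff_ae_notMem.1 (Measure.addHaar_submodule volume W hW)

/-- Orthogonality for all translations `x` makes the Fourier integral of `coeffFun` vanish
identically, and Plancherel concludes. -/
theorem coeffFun_ae_eq_zero {d : ℕ} {K : Submodule ℂ (L2 d)} {f g : L2 d} (hg : g ∈ Kᗮ)
    {h : GLR d} (hK : ∀ x : E d, quasiRegular x h f ∈ K) : coeffFun g f h =ᵐ[volume] 0 := by
  have h1 : ∀ x, 𝓕 (coeffFun g f h) x = 0 := by
    intro x
    have h2 : inner ℂ g (quasiRegular x h f) = 0 :=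
      (Submodule.mem_orthogonal' K g).1 hg _ (hK x)
    rw [inner_quasiRegular] at h2
    refine (mul_eq_zero.1 h2).resolve_left ?_
    have := abs_pos.2 (det_ne_zero h)
    exact_mod_cast (Real.rpow_pos_of_pos this _).ne'
  have h3 := eLpNorm_fourier_of_integrable (integrable_coeffFun g f h)
  rw [show 𝓕 (coeffFun g f h) = 0 from funext h1, eLpNorm_zero] at h3
  exact (eLpNorm_eq_zero_iff (integrable_coeffFun g f h).1 two_ne_zero).1 h3.symm

/-- For `f ∈ K` and `g ⊥ K`, the product `𝓕 g (ξ) · 𝓕 f (ξ L w)` vanishes almost everywhere, and `ξ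
L w = w L ξ`. Freezing a `ξ` with `𝓕 g (ξ) ≠ 0` makes `𝓕 f` vanish almost everywhere along an
invertible linear map in `w`, so `f = 0`. -/
theorem irreducible (hL : IsShearletChart L) : IsQuasiRegularIrreducible hL.group := by
  intro K hKc hK
  by_contra! hcon
  obtain ⟨f, hf, hf0⟩ := Submodule.exists_mem_ne_zero_of_ne_bot hcon.1
  apply hcon.2
  have : CompleteSpace K := hKc.completeSpace_coe
  rw [← Submodule.orthogonal_eq_bot_iff, Submodule.eq_bot_iff]
  intro g hg
  have mf : Measurable ((𝓕 f : L2 (k + 1)) : E (k + 1) → ℂ) := (Lp.stronglyMeasurable _).measurable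
  have mg : Measurable ((𝓕 g : L2 (k + 1)) : E (k + 1) → ℂ) := (Lp.stronglyMeasurable _).measurable
  let b : E (k + 1) × E (k + 1) → E (k + 1) := fun p => WithLp.toLp 2 (p.2.ofLp ᵥ* L p.1.ofLp)
  have hb : Continuous b := by
    refine (PiLp.continuous_toLp 2 _).comp ?_
    exact ((PiLp.continuous_ofLp 2 _).comp continuous_snd).matrix_vecMul
      (L.continuous_of_finiteDimensional.comp ((PiLp.continuous_ofLp 2 _).comp continuous_fst))
  have h1 : ∀ᵐ w : E (k + 1), ∀ᵐ ξ : E (k + 1),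
      (𝓕 g : L2 (k + 1)) ξ = 0 ∨ (𝓕 f : L2 (k + 1)) (b (ξ, w)) = 0 := by
    filter_upwards [ae_apply_zero_ne_zero] with w hw
    filter_upwards [coeffFun_ae_eq_zero hg
      (fun x => hK x _ (hL.unit_mem ⟨w, hw⟩) f hf)] with ξ hξ
    rw [coeffFun, dualAct_apply, val_unit, Pi.zero_apply, mul_eq_zero, map_eq_zero,
      hL.vecMul_comm] at hξ
    exact hξ
  have hms : MeasurableSet {p : E (k + 1) × E (k + 1) |
      (𝓕 g : L2 (k + 1)) p.2 = 0 ∨ (𝓕 f : L2 (k + 1)) (b (p.2, p.1)) = 0} := by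
    refine MeasurableSet.union ?_ ?_
    · exact (mg.comp measurable_snd) (measurableSet_singleton 0)
    · exact (mf.comp (hb.measurable.comp measurable_swap)) (measurableSet_singleton 0)
  rw [Measure.ae_ae_comm hms] at h1
  rw [← fourier_eq_zero_iff, Lp.eq_zero_iff_ae_eq_zero]
  filter_upwards [h1, ae_apply_zero_ne_zero] with ξ h2 hξ
  by_contra hg0
  apply hf0
  rw [← fourier_eq_zero_iff, Lp.eq_zero_iff_ae_eq_zero]
  have h3 : ∀ᵐ w : E (k + 1), (𝓕 f : L2 (k + 1)) (dualAct (hL.unit ⟨ξ, hξ⟩) w) = 0 := by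
    filter_upwards [h2] with w hw
    rw [dualAct_apply, val_unit]
    exact hw.resolve_left hg0
  filter_upwards [(quasiMeasurePreserving_dualAct (hL.unit ⟨ξ, hξ⟩)⁻¹).ae h3] with η hη
  rwa [dualAct_apply_inv] at hη

theorem hasAdmissibleVector (hL : IsShearletChart L) : HasAdmissibleVector hL.group := by
  let _ : MeasurableSpace hL.group := borel hL.group
  have : BorelSpace hL.group := ⟨rfl⟩
  have := sigmaCompactSpace_of_isClosed hL.isClosed_group
  have := locallyCompactSpace_of_isClosed hL.isClosed_group
  let μ : Measure hL.group := Measure.haar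
  -- Radius `1/2` keeps the first coordinate away from zero, so `B` is a compact subset of the open
  -- orbit.
  let B : Set (E (k + 1)) := Metric.closedBall (EuclideanSpace.single 0 1) (1 / 2)
  have hBm : MeasurableSet B := Metric.isClosed_closedBall.measurableSet
  have hBc : IsCompact B := isCompact_closedBall _ _
  have hB0 : ∀ ξ ∈ B, ξ 0 ≠ 0 := by
    intro ξ hξ h0
    have h1 := PiLp.norm_apply_le (ξ - EuclideanSpace.single 0 1) 0
    rw [Metric.mem_closedBall, dist_eq_norm] at hξ
    simp [h0] at h1
    linarith
  let B' : Set {v : E (k + 1) // v 0 ≠ 0} := {v | v.1 ∈ B}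
  have hB'c : IsCompact B' := by
    rw [Subtype.isCompact_iff]
    convert hBc
    ext ξ
    exact ⟨by rintro ⟨v, hv, rfl⟩; exact hv, fun h => ⟨⟨ξ, hB0 ξ h⟩, h, rfl⟩⟩
  -- An element carrying `ξ ∈ B` to `η ∈ B` must be `(L ξ)⁻¹ L η`. The elements for which the
  -- integrand is not almost everywhere zero thus lie in a compact set.
  let C : Set (GLR (k + 1)) := (fun p : _ × _ => (hL.unit p.1)⁻¹ * hL.unit p.2) '' (B' ×ˢ B')
  have hC : IsCompact C := (hB'c.prod hB'c).image
    ((hL.continuous_unit.comp continuous_fst).inv.mul (hL.continuous_unit.comp continuous_snd))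
  let C' : Set hL.group := Subtype.val ⁻¹' C
  have hC' : IsCompact C' := hL.isClosed_group.isClosedEmbedding_subtypeVal.isCompact_preimage hC
  have hCmem : ∀ h : hL.group, ∀ ξ ∈ B, dualAct (h : GLR (k + 1)) ξ ∈ B → h ∈ C' := by
    rintro ⟨h, v, hv, hh⟩ ξ hξ hη
    refine ⟨(⟨ξ, hB0 ξ hξ⟩, ⟨_, hB0 _ hη⟩), ⟨hξ, hη⟩, ?_⟩
    rw [inv_mul_eq_iff_eq_mul]
    refine Units.ext ?_
    change L (dualAct h ξ).ofLp = L ξ.ofLp * (h : Matrix (Fin (k + 1)) (Fin (k + 1)) ℝ)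
    rw [dualAct_apply, hh, hL.mul]
  have hBtop : volume B ≠ ⊤ := hBc.measure_lt_top.ne
  let φ : L2 (k + 1) := indicatorConstLp 2 hBm hBtop (1 : ℂ)
  have hφ : φ =ᵐ[volume] B.indicator fun _ => (1 : ℂ) := indicatorConstLp_coeFn
  have hmain : ∫⁻ h : hL.group, (∫⁻ ξ : E (k + 1), ‖φ ξ‖ₑ ^ 2 *
      ‖φ (dualAct (h : GLR (k + 1)) ξ)‖ₑ ^ 2) ∂μ < ⊤ := by
    have hle : ∀ h : hL.group, (∫⁻ ξ : E (k + 1), ‖φ ξ‖ₑ ^ 2 *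
        ‖φ (dualAct (h : GLR (k + 1)) ξ)‖ₑ ^ 2) ≤ C'.indicator (fun _ => volume B) h := by
      intro h
      have h1 : ∀ᵐ ξ : E (k + 1), ‖φ ξ‖ₑ ^ 2 * ‖φ (dualAct (h : GLR (k + 1)) ξ)‖ₑ ^ 2 ≤
          B.indicator (fun _ => C'.indicator (fun _ => (1 : ℝ≥0∞)) h) ξ := by
        filter_upwards [hφ, (quasiMeasurePreserving_dualAct (h : GLR (k + 1))).ae hφ]
          with ξ h2 h3
        rw [h2, h3]
        by_cases hξ : ξ ∈ B
        · by_cases hη : dualAct (h : GLR (k + 1)) ξ ∈ B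
          · simp [hξ, hη, hCmem h ξ hξ hη]
          · simp [hη]
        · simp [hξ]
      refine (lintegral_mono_ae h1).trans ?_
      rw [lintegral_indicator hBm, setLIntegral_const]
      by_cases hh : h ∈ C' <;> simp [hh]
    refine (lintegral_mono hle).trans_lt ?_
    rw [lintegral_indicator hC'.isClosed.measurableSet, setLIntegral_const]
    exact ENNReal.mul_lt_top hBc.measure_lt_top hC'.measure_lt_top
  refine ⟨μ, inferInstance, (𝓕⁻ φ : L2 (k + 1)), ?_,
    (stronglyMeasurable_inner_quasiRegular _ _).aestronglyMeasurable, ?_⟩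
  · intro h0
    rw [← fourier_eq_zero_iff, fourier_fourierInv_eq, Lp.eq_zero_iff_ae_eq_zero] at h0
    have h1 : volume B = 0 := by
      rw [measure_eq_zero_iff_ae_notMem]
      filter_upwards [h0, hφ] with ξ h2 h3 h4
      rw [h2, Set.indicator_of_mem h4] at h3
      simp at h3
    exact (Metric.measure_closedBall_pos volume (EuclideanSpace.single 0 1)
      (by norm_num : (0 : ℝ) < 1 / 2)).ne' h1
  · have h1 := lintegral_inner_quasiRegular μ (𝓕⁻ φ : L2 (k + 1)) (𝓕⁻ φ : L2 (k + 1))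
    rw [fourier_fourierInv_eq] at h1
    rw [← h1] at hmain
    have h2 := eLpNorm_nnreal_pow_eq_lintegral (p := 2) two_ne_zero
      (f := fun p : E (k + 1) × hL.group =>
        inner ℂ (𝓕⁻ φ : L2 (k + 1)) (quasiRegular p.1 (p.2 : GLR (k + 1)) (𝓕⁻ φ : L2 (k + 1))))
      (μ := ((volume : Measure (E (k + 1))).prod μ).withDensity fun p =>
        ENNReal.ofReal (|((p.2 : GLR (k + 1)) : Matrix (Fin (k + 1)) (Fin (k + 1)) ℝ).det|⁻¹))
    norm_num at h2
    rw [← h2] at hmain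
    rw [lt_top_iff_ne_top] at hmain ⊢
    intro htop
    rw [htop] at hmain
    simp at hmain

theorem isIrreduciblyAdmissible (hL : IsShearletChart L) : IsIrreduciblyAdmissible hL.group :=
  ⟨hL.isClosed_group, hL.irreducible, hL.hasAdmissibleVector⟩

/-- The subgroup of unipotent matrices of a chart. -/
def shearing (hL : IsShearletChart L) : Subgroup (GLR (k + 1)) :=
  hL.group ⊓ unitriangular (k + 1)

theorem mem_shearing (hL : IsShearletChart L) {g : GLR (k + 1)} :
    g ∈ hL.shearing ↔ ∃ v, v 0 = 1 ∧ (g : Matrix (Fin (k + 1)) (Fin (k + 1)) ℝ) = L v := by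
  constructor
  · rintro ⟨⟨v, -, hg⟩, h1, -⟩
    exact ⟨v, by rw [← hL.diag v 0, ← hg, h1], hg⟩
  · rintro ⟨v, hv, hg⟩
    refine ⟨⟨v, by rw [hv]; exact one_ne_zero, hg⟩, fun i => ?_, fun i j hij => ?_⟩
    · rw [hg, hL.diag, hv]
    · rw [hg, hL.tri v i j hij]

theorem isConnected_shearing (hL : IsShearletChart L) :
    IsConnected (hL.shearing : Set (GLR (k + 1))) := by
  have h1 : IsConnected {v : {v : E (k + 1) // v 0 ≠ 0} | v.1 0 = 1} := by
    have hconv : Convex ℝ {v : E (k + 1) | v 0 = 1} := by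
      intro v hv w hw a b _ _ hab
      simp only [Set.mem_ofPred_eq] at hv hw ⊢
      simp [hv, hw, hab]
    have hne : ({v : E (k + 1) | v 0 = 1}).Nonempty := ⟨EuclideanSpace.single 0 1, by simp⟩
    have h2 : IsConnected {v : E (k + 1) | v 0 = 1} := ⟨hne, hconv.isPreconnected⟩
    refine ⟨⟨⟨EuclideanSpace.single 0 1, by simp⟩, by simp⟩, ?_⟩
    refine (Topology.IsInducing.isPreconnected_image (f := Subtype.val) ⟨rfl⟩).1 ?_
    convert h2.isPreconnected
    ext v
    exact ⟨by rintro ⟨w, hw, rfl⟩; exact hw,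
      fun (h : v 0 = 1) => ⟨⟨v, by rw [h]; exact one_ne_zero⟩, h, rfl⟩⟩
  convert h1.image hL.unit hL.continuous_unit.continuousOn
  ext g
  rw [SetLike.mem_coe, hL.mem_shearing]
  constructor
  · rintro ⟨v, hv, hg⟩
    exact ⟨⟨WithLp.toLp 2 v, by simp [hv]⟩, hv, Units.ext hg.symm⟩
  · rintro ⟨v, hv, rfl⟩
    exact ⟨v.1.ofLp, hv, rfl⟩

theorem isClosed_shearing (hL : IsShearletChart L) :
    IsClosed (hL.shearing : Set (GLR (k + 1))) := by
  have h : (hL.shearing : Set (GLR (k + 1))) = (hL.group : Set (GLR (k + 1))) ∩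
      {g : GLR (k + 1) | (g : Matrix (Fin (k + 1)) (Fin (k + 1)) ℝ) 0 0 = 1} := by
    ext g
    rw [SetLike.mem_coe, hL.mem_shearing]
    constructor
    · rintro ⟨v, hv, hg⟩
      exact ⟨⟨v, by rw [hv]; exact one_ne_zero, hg⟩, by rw [Set.mem_ofPred_eq, hg, hL.row, hv]⟩
    · rintro ⟨⟨v, -, hg⟩, h1⟩
      exact ⟨v, by rw [← hL.row v, ← hg, h1], hg⟩
  rw [h]
  exact hL.isClosed_group.inter
    (isClosed_eq (Units.continuous_val.matrix_elem 0 0) continuous_const)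

/-- Positive scalar matrices. -/
def positiveScalars (d : ℕ) : Subgroup (GLR d) where
  carrier := {g | ∃ r : ℝ, (g : Matrix (Fin d) (Fin d) ℝ) = Real.exp r • 1}
  one_mem' := ⟨0, by simp⟩
  mul_mem' := by
    rintro a b ⟨r, hr⟩ ⟨s, hs⟩
    exact ⟨r + s, by rw [Units.val_mul, hr, hs, Real.exp_add, smul_mul_smul_comm, one_mul]⟩
  inv_mem' := by
    rintro a ⟨r, hr⟩
    refine ⟨-r, Units.inv_eq_of_mul_eq_one_right ?_⟩
    rw [hr, smul_mul_smul_comm, ← Real.exp_add, add_neg_cancel, Real.exp_zero, one_smul, one_mul]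

theorem isClosed_positiveScalars : IsClosed (positiveScalars (k + 1) : Set (GLR (k + 1))) := by
  have h : (positiveScalars (k + 1) : Set (GLR (k + 1))) =
      {g : GLR (k + 1) | (g : Matrix (Fin (k + 1)) (Fin (k + 1)) ℝ) =
        (g : Matrix (Fin (k + 1)) (Fin (k + 1)) ℝ) 0 0 • 1} ∩
      {g : GLR (k + 1) | 0 ≤ (g : Matrix (Fin (k + 1)) (Fin (k + 1)) ℝ) 0 0} := by
    ext g
    constructor
    · rintro ⟨r, hr⟩
      simp [hr, Real.exp_nonneg]
    · rintro ⟨h1, h2⟩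
      rw [Set.mem_ofPred_eq] at h1 h2
      have h3 : (g : Matrix (Fin (k + 1)) (Fin (k + 1)) ℝ) 0 0 ≠ 0 := by
        intro h0
        apply det_ne_zero g
        rw [h1, h0, zero_smul, Matrix.det_zero]
      exact ⟨Real.log _, by rw [Real.exp_log (lt_of_le_of_ne h2 h3.symm)]; exact h1⟩
  rw [h]
  have c := (Units.continuous_val (M := Matrix (Fin (k + 1)) (Fin (k + 1)) ℝ)).matrix_elem 0 0
  exact (isClosed_eq Units.continuous_val (c.smul continuous_const)).inter
    (isClosed_le continuous_const c)

theorem exp_smul_diagonal_one {d : ℕ} (r : ℝ) :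
    NormedSpace.exp (r • Matrix.diagonal fun _ : Fin d => (1 : ℝ)) =
      Real.exp r • (1 : Matrix (Fin d) (Fin d) ℝ) := by
  rw [← Matrix.diagonal_smul, Matrix.exp_diagonal, ← Matrix.diagonal_one, ← Matrix.diagonal_smul]
  congr 1
  funext i
  rw [Pi.coe_exp, ← Real.exp_eq_exp_ℝ]
  simp

/-- The diagonal generator is the identity, so `D` is the group of positive scalars. Sign and scale
are those of `v 0`, and dividing by `v 0` leaves the shear. -/
theorem isShearletGroupWith (hL : IsShearletChart L) :
    IsShearletGroupWith hL.group hL.shearing where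
  admissible := hL.isIrreduciblyAdmissible
  le := inf_le_left
  isClosed := hL.isClosed_shearing
  isConnected := hL.isConnected_shearing
  abelian := by
    rintro a ⟨⟨v, -, ha⟩, -⟩ b ⟨⟨w, -, hb⟩, -⟩
    exact Units.ext (by rw [Units.val_mul, Units.val_mul, ha, hb, hL.comm])
  le_unitriangular := inf_le_right
  complement := by
    refine ⟨positiveScalars (k + 1), fun _ => 1, ?_, isClosed_positiveScalars, fun g => ?_, ?_⟩
    · rintro g ⟨r, hr⟩
      refine ⟨Real.exp r • Pi.single 0 1, by simp, ?_⟩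
      rw [map_smul, hL.one, hr]
    · simp only [exp_smul_diagonal_one]
      exact Iff.rfl
    · rintro h ⟨v, hv, hh⟩
      obtain ⟨ε, r, hεr⟩ : ∃ (ε : ℤˣ) (r : ℝ), v 0 = ((ε : ℤ) : ℝ) * Real.exp r := by
        rcases lt_or_gt_of_ne hv with h0 | h0
        · exact ⟨-1, Real.log (-v 0), by rw [Real.exp_log (by linarith)]; simp⟩
        · exact ⟨1, Real.log (v 0), by rw [Real.exp_log h0]; simp⟩
      have hscal : ∀ r : ℝ, ∃ δ : positiveScalars (k + 1),
          ((δ : GLR (k + 1)) : Matrix (Fin (k + 1)) (Fin (k + 1)) ℝ) = Real.exp r • 1 := fun r =>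
        ⟨⟨⟨Real.exp r • 1, Real.exp (-r) • 1, by
          rw [smul_mul_smul_comm, ← Real.exp_add, add_neg_cancel, Real.exp_zero, one_smul, one_mul],
          by rw [smul_mul_smul_comm, ← Real.exp_add, neg_add_cancel, Real.exp_zero, one_smul,
              one_mul]⟩, r, rfl⟩, rfl⟩
      obtain ⟨δ, hδ⟩ := hscal r
      let w : {v : E (k + 1) // v 0 ≠ 0} := ⟨WithLp.toLp 2 ((v 0)⁻¹ • v), by simp [hv]⟩
      have hw : hL.unit w ∈ hL.shearing := hL.mem_shearing.2 ⟨_, by simp [w, hv], rfl⟩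
      refine ⟨(ε, δ, ⟨hL.unit w, hw⟩), ?_, ?_⟩
      · simp only [Units.val_mul, val_unit, hδ, w, map_smul]
        rw [smul_mul_assoc, one_mul, smul_smul, smul_smul, ← hεr, mul_inv_cancel₀ hv, one_smul, hh]
      · rintro ⟨ε', ⟨δ', r', hδ'⟩, ⟨s, hs⟩⟩ hp
        obtain ⟨u, hu, hsu⟩ := hL.mem_shearing.1 hs
        simp only [Units.val_mul, hδ', hsu, hh] at hp
        rw [smul_mul_assoc, one_mul, smul_smul, ← map_smul] at hp
        have hvu := hL.injective hp
        have h0 : ((ε : ℤ) : ℝ) * Real.exp r = ((ε' : ℤ) : ℝ) * Real.exp r' := by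
          rw [← hεr, hvu]
          simp [hu]
        have hε : ε' = ε ∧ r' = r := by
          have p1 := Real.exp_pos r
          have p2 := Real.exp_pos r'
          rcases Int.units_eq_one_or ε with rfl | rfl <;>
            rcases Int.units_eq_one_or ε' with rfl | rfl
          · simp at h0; exact ⟨rfl, h0.symm⟩
          · simp at h0; linarith
          · simp at h0; linarith
          · simp at h0; exact ⟨rfl, h0.symm⟩
        obtain ⟨rfl, rfl⟩ := hε
        refine Prod.ext rfl (Prod.ext (Subtype.ext (Units.ext ?_)) (Subtype.ext (Units.ext ?_)))
        · exact hδ'.trans hδ.symm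
        · change (s : Matrix (Fin (k + 1)) (Fin (k + 1)) ℝ) = L ((v 0)⁻¹ • v)
          rw [hsu]
          congr 1
          conv_rhs => rw [hεr, hvu]
          rw [smul_smul, inv_mul_cancel₀ (hεr ▸ hv), one_smul]

end IsShearletChart

/-! ### The standard, Toeplitz and `H_a` charts -/

section Charts

/-- The chart of the standard group. -/
def standardChart (k : ℕ) : (Fin (k + 1) → ℝ) →ₗ[ℝ] Matrix (Fin (k + 1)) (Fin (k + 1)) ℝ where
  toFun v := Matrix.of fun i j => if i = j then v 0 else if i = 0 then v j else 0
  map_add' v w := by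
    ext i j
    simp only [Matrix.of_apply, Matrix.add_apply, Pi.add_apply]
    split_ifs <;> simp
  map_smul' c v := by
    ext i j
    simp only [Matrix.of_apply, Matrix.smul_apply, Pi.smul_apply]
    split_ifs <;> simp

theorem standardChart_apply {k : ℕ} (v : Fin (k + 1) → ℝ) (i j : Fin (k + 1)) :
    standardChart k v i j = if i = j then v 0 else if i = 0 then v j else 0 := rfl

theorem standardChart_mul_apply {k : ℕ} (v w : Fin (k + 1) → ℝ) :
    standardChart k v * standardChart k w =
      standardChart k (v 0 • w + w 0 • v - Pi.single 0 (v 0 * w 0)) := by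
  ext i j
  rw [Matrix.mul_apply, Fin.sum_univ_succ]
  induction i using Fin.cases with
  | zero =>
    induction j using Fin.cases with
    | zero => simp [standardChart_apply, Fin.succ_ne_zero, mul_comm]
    | succ j =>
      simp [standardChart_apply, (Fin.succ_ne_zero _).symm, Fin.succ_ne_zero, mul_comm]
  | succ i =>
    induction j using Fin.cases with
    | zero => simp [standardChart_apply, Fin.succ_ne_zero]
    | succ j =>
      by_cases h : i = j <;> simp [standardChart_apply, Fin.succ_ne_zero, h, mul_comm]

theorem isShearletChart_standard (k : ℕ) : IsShearletChart (standardChart k) where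
  row v j := by
    by_cases h : (0 : Fin (k + 1)) = j
    · simp [standardChart_apply, ← h]
    · simp [standardChart_apply, h]
  diag v i := by simp [standardChart_apply]
  tri v i j h := by
    rw [standardChart_apply, if_neg h.ne',
      if_neg (Fin.pos_iff_ne_zero.1 ((Fin.zero_le j).trans_lt h))]
  mul v w := by
    rw [standardChart_mul_apply]
    congr 1
    ext j
    rw [Matrix.vecMul, dotProduct, Fin.sum_univ_succ]
    induction j using Fin.cases with
    | zero => simp [standardChart_apply, Fin.succ_ne_zero, mul_comm]
    | succ j =>
      simp [standardChart_apply, (Fin.succ_ne_zero _).symm, Fin.succ_ne_zero, mul_comm]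
  comm v w := by
    rw [standardChart_mul_apply, standardChart_mul_apply, add_comm (v 0 • w), mul_comm (v 0)]

theorem shearing_standard (k : ℕ) :
    (isShearletChart_standard k).shearing = standardShearing (k + 1) := by
  ext g
  rw [IsShearletChart.mem_shearing]
  constructor
  · rintro ⟨v, hv, hg⟩
    refine ⟨v, ?_⟩
    rw [hg]
    ext i j
    simp [standardChart_apply, standardMatrix, hv]
  · rintro ⟨s, hg⟩
    -- `standardMatrix` never reads `s 0`, so this coordinate may be reset to one.
    refine ⟨fun i => if i = 0 then 1 else s i, by simp, ?_⟩
    rw [hg]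
    ext i j
    by_cases h : i = j
    · simp [standardChart_apply, standardMatrix, h]
    · by_cases h' : i = 0
      · subst h'
        simp [standardChart_apply, standardMatrix, h, Ne.symm h]
      · simp [standardChart_apply, standardMatrix, h, h']

/-- The chart of the Toeplitz group. -/
def toeplitzChart (k : ℕ) : (Fin (k + 1) → ℝ) →ₗ[ℝ] Matrix (Fin (k + 1)) (Fin (k + 1)) ℝ where
  toFun v := toeplitzMatrix (k + 1) fun n => if h : n < k + 1 then v ⟨n, h⟩ else 0
  map_add' v w := by
    ext i j
    simp only [toeplitzMatrix, Matrix.of_apply, Matrix.add_apply, Pi.add_apply]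
    split_ifs <;> simp
  map_smul' c v := by
    ext i j
    simp only [toeplitzMatrix, Matrix.of_apply, Matrix.smul_apply, Pi.smul_apply]
    split_ifs <;> simp

theorem toeplitzChart_eq {k : ℕ} (v : Fin (k + 1) → ℝ) : toeplitzChart k v =
    toeplitzMatrix (k + 1) fun n => if h : n < k + 1 then v ⟨n, h⟩ else 0 := rfl

theorem toeplitzChart_apply {k : ℕ} (v : Fin (k + 1) → ℝ) (i j : Fin (k + 1)) :
    toeplitzChart k v i j = if i ≤ j then v ⟨j - i, by omega⟩ else 0 := by
  have : (j : ℕ) - i < k + 1 := by omega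
  rw [toeplitzChart_eq, toeplitzMatrix, Matrix.of_apply]
  simp only [this, dite_true]

theorem toeplitzMatrix_eq_chart {k : ℕ} (s : ℕ → ℝ) :
    toeplitzMatrix (k + 1) s = toeplitzChart k (fun j => toeplitzMatrix (k + 1) s 0 j) := by
  ext i j
  rw [toeplitzChart_apply]
  simp [toeplitzMatrix]

theorem isShearletChart_toeplitz (k : ℕ) : IsShearletChart (toeplitzChart k) where
  row v j := by simp [toeplitzChart_apply]
  diag v i := by simp [toeplitzChart_apply]
  tri v i j h := by rw [toeplitzChart_apply, if_neg (not_le.2 h)]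
  mul v w := by
    -- A product of Toeplitz matrices is Toeplitz, hence determined by its first row.
    obtain ⟨s, hs⟩ : ∃ s, toeplitzChart k v * toeplitzChart k w = toeplitzMatrix (k + 1) s := by
      rw [toeplitzChart_eq v, toeplitzChart_eq w]
      exact ⟨_, toeplitzMatrix_mul _ _ _⟩
    rw [hs, toeplitzMatrix_eq_chart, ← hs]
    congr 1
    funext j
    rw [Matrix.mul_apply, Matrix.vecMul, dotProduct]
    simp [toeplitzChart_apply]
  comm v w := by
    rw [toeplitzChart_eq, toeplitzChart_eq, toeplitzMatrix_mul, toeplitzMatrix_mul]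
    congr 1
    funext n
    rw [← Finset.Nat.sum_antidiagonal_swap]
    exact Finset.sum_congr rfl fun p _ => mul_comm _ _

theorem shearing_toeplitz (k : ℕ) :
    (isShearletChart_toeplitz k).shearing = toeplitzShearing (k + 1) := by
  ext g
  rw [IsShearletChart.mem_shearing]
  constructor
  · rintro ⟨v, hv, hg⟩
    refine ⟨fun n => if h : n < k + 1 then v ⟨n, h⟩ else 0, ?_, hg⟩
    simpa using hv
  · rintro ⟨s, hs, hg⟩
    refine ⟨_, ?_, hg.trans (toeplitzMatrix_eq_chart s)⟩
    simp [toeplitzMatrix, hs]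

/-- The chart of the group `H_a`. -/
def hChart (a : ℝ) : (Fin 4 → ℝ) →ₗ[ℝ] Matrix (Fin 4) (Fin 4) ℝ where
  toFun v := hMatrix a (v 0) (v 1) (v 2) (v 3)
  map_add' v w := by
    ext i j
    fin_cases i <;> fin_cases j <;> simp [hMatrix, mul_add]
  map_smul' c v := by
    ext i j
    fin_cases i <;> fin_cases j <;> simp [hMatrix, mul_left_comm]

theorem hChart_apply (a : ℝ) (v : Fin 4 → ℝ) :
    hChart a v = hMatrix a (v 0) (v 1) (v 2) (v 3) := rfl

theorem isShearletChart_h (a : ℝ) : IsShearletChart (k := 3) (hChart a) where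
  row v j := by fin_cases j <;> simp [hChart_apply, hMatrix]
  diag v i := by fin_cases i <;> simp [hChart_apply, hMatrix]
  tri v i j h := by
    fin_cases i <;> fin_cases j <;> simp [hChart_apply, hMatrix] at h ⊢
  mul v w := by
    rw [hChart_apply, hChart_apply, hMatrix_mul, hChart_apply]
    congr 1
    all_goals simp [Matrix.vecMul, dotProduct, Fin.sum_univ_four, hMatrix]
    ring
  comm v w := by
    rw [hChart_apply, hChart_apply, hMatrix_mul, hMatrix_mul]
    congr 1 <;> ring

theorem group_h (a : ℝ) : (isShearletChart_h a).group = hGroup a := by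
  ext g
  rw [IsShearletChart.mem_group]
  constructor
  · rintro ⟨v, hv, hg⟩
    exact ⟨v 0, v 1, v 2, v 3, hv, hg⟩
  · rintro ⟨s, t₁, t₂, t₃, hs, hg⟩
    exact ⟨![s, t₁, t₂, t₃], hs, hg⟩

theorem shearing_h (a : ℝ) : (isShearletChart_h a).shearing = hShearing a := by
  rw [IsShearletChart.shearing, group_h]
  rfl

end Charts

/-! ### Conjugacy from multiplication tables -/

section Regular

variable {k : ℕ} {S : Subgroup (GLR (k + 1))} {ξ : Fin (k + 1) → ℝ}

theorem IsRegular.smul_one_mem_nilPart_iff {c : ℝ} :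
    c • (1 : Matrix (Fin (k + 1)) (Fin (k + 1)) ℝ) ∈ nilPart S ↔ c = 0 := by
  refine ⟨fun h => ?_, fun h => by rw [h, zero_smul]; exact zero_mem _⟩
  simpa using h.2 0 0 (by simp)

theorem IsRegular.eq_zero (hS : IsRegular S ξ) {M : Matrix (Fin (k + 1)) (Fin (k + 1)) ℝ}
    (hM : M ∈ groupAlgebra S) (h : ξ ᵥ* M = 0) : M = 0 :=
  eq_zero_of_cyclic hS.comm hS.cyclic hM h

theorem sum_smul_mem {a : Fin (k + 1) → Matrix (Fin (k + 1)) (Fin (k + 1)) ℝ}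
    (ha : ∀ i, a i ∈ groupAlgebra S) (c : Fin (k + 1) → ℝ) :
    ∑ j, c j • a j ∈ groupAlgebra S :=
  sum_mem fun j _ => Subalgebra.smul_mem _ (ha j) _

theorem vecMul_sum_smul (a : Fin (k + 1) → Matrix (Fin (k + 1)) (Fin (k + 1)) ℝ)
    (c : Fin (k + 1) → ℝ) : ξ ᵥ* (∑ j, c j • a j) = ∑ j, c j • (ξ ᵥ* a j) := by
  have := map_sum (Matrix.vecMulBilin ℝ ℝ ξ) (fun j => c j • a j) Finset.univ
  simp only [map_smul] at this
  exact this

/-- A basis of the algebra of `S` whose multiplication table is that of a chart conjugates `S` to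
the shearing group of the chart. -/
theorem IsRegular.areConjugate (hS : IsRegular S ξ)
    {L : (Fin (k + 1) → ℝ) →ₗ[ℝ] Matrix (Fin (k + 1)) (Fin (k + 1)) ℝ} (hL : IsShearletChart L)
    (a : Fin (k + 1) → Matrix (Fin (k + 1)) (Fin (k + 1)) ℝ) (ha0 : a 0 = 1)
    (ha : ∀ i : Fin k, a i.succ ∈ nilPart S)
    (hli : ∀ c : Fin k → ℝ, ∑ i, c i • a i.succ = 0 → c = 0)
    (hmul : ∀ (i : Fin k) (v : Fin (k + 1) → ℝ),
      a i.succ * ∑ j, v j • a j = ∑ j, L v i.succ j • a j) :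
    AreConjugate S hL.shearing := by
  have hmem : ∀ i, a i ∈ groupAlgebra S := by
    intro i
    induction i using Fin.cases with
    | zero => rw [ha0]; exact one_mem _
    | succ i => exact (ha i).1
  have hnil : ∀ c : Fin (k + 1) → ℝ, ∑ j, c j • a j - c 0 • 1 ∈ nilPart S := by
    intro c
    rw [Fin.sum_univ_succ, ha0, add_sub_cancel_left]
    exact sum_mem fun i _ => Submodule.smul_mem _ _ (ha i)
  have hmul' : ∀ (i : Fin (k + 1)) (v : Fin (k + 1) → ℝ),
      a i * ∑ j, v j • a j = ∑ j, L v i j • a j := by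
    intro i v
    induction i using Fin.cases with
    | zero => simp only [ha0, one_mul, hL.row]
    | succ i => exact hmul i v
  have hli' : ∀ c : Fin (k + 1) → ℝ, ∑ i, c i • a i = 0 → c = 0 := by
    intro c hc
    have h0 : c 0 = 0 := by
      have := hnil c
      rw [hc, zero_sub, ← neg_smul, IsRegular.smul_one_mem_nilPart_iff] at this
      linarith
    rw [Fin.sum_univ_succ, h0, zero_smul, zero_add] at hc
    have := hli _ hc
    ext i
    induction i using Fin.cases with
    | zero => exact h0
    | succ i => exact congrFun this i
  -- The rows of `P` are the basis of the algebra carried to `ℝ^(k+1)` by the cyclic vector, so `P`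
  -- intertwines the algebra with the chart.
  let P : Matrix (Fin (k + 1)) (Fin (k + 1)) ℝ := Matrix.of fun i => ξ ᵥ* a i
  have hPli : LinearIndependent ℝ P.row := by
    rw [Fintype.linearIndependent_iff]
    intro c hc i
    have h1 : ξ ᵥ* (∑ j, c j • a j) = 0 := by rw [vecMul_sum_smul]; exact hc
    exact congrFun (hli' c (hS.eq_zero (sum_smul_mem hmem c) h1)) i
  have hPu : IsUnit P := Matrix.linearIndependent_rows_iff_isUnit.1 hPli
  let g : GLR (k + 1) := hPu.unit
  have hPmul : ∀ v : Fin (k + 1) → ℝ, P * ∑ j, v j • a j = L v * P := by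
    intro v
    ext i j
    rw [Matrix.mul_apply_eq_vecMul, Matrix.mul_apply_eq_vecMul]
    refine congrFun (?_ : (ξ ᵥ* a i) ᵥ* _ = _) j
    rw [Matrix.vecMul_vecMul, hmul', vecMul_sum_smul]
    ext j
    simp [Matrix.vecMul, dotProduct, P]
  have hspan : ∀ M ∈ groupAlgebra S, ∃ v : Fin (k + 1) → ℝ, M = ∑ j, v j • a j := by
    intro M hM
    obtain ⟨v, hv⟩ : ∃ v, v ᵥ* P = ξ ᵥ* M := by
      refine ⟨(ξ ᵥ* M) ᵥ* ((g⁻¹ : GLR (k + 1)) : Matrix (Fin (k + 1)) (Fin (k + 1)) ℝ), ?_⟩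
      have : ((g⁻¹ : GLR (k + 1)) : Matrix (Fin (k + 1)) (Fin (k + 1)) ℝ) * P = 1 :=
        hPu.unit.inv_mul
      rw [Matrix.vecMul_vecMul, this, Matrix.vecMul_one]
    refine ⟨v, ?_⟩
    rw [← sub_eq_zero]
    refine hS.eq_zero (sub_mem hM (sum_smul_mem hmem v)) ?_
    rw [Matrix.vecMul_sub, ← hv, vecMul_sum_smul, sub_eq_zero]
    ext j
    simp [Matrix.vecMul, dotProduct, P]
  have hgval : (g : Matrix (Fin (k + 1)) (Fin (k + 1)) ℝ) = P := rfl
  refine ⟨g, ?_⟩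
  ext t
  rw [Subgroup.mem_map, hL.mem_shearing]
  constructor
  · rintro ⟨s, hs, rfl⟩
    obtain ⟨v, hv⟩ := hspan _ (mem_groupAlgebra hs)
    refine ⟨v, ?_, ?_⟩
    · have h1 := sub_mem (hnil v) ((hS.mem_iff s).1 hs)
      rw [← hv, sub_sub_sub_cancel_left, ← one_smul ℝ (1 : Matrix _ _ ℝ), smul_smul, mul_one,
        ← sub_smul, IsRegular.smul_one_mem_nilPart_iff] at h1
      linarith
    · change ((g * s * g⁻¹ : GLR (k + 1)) : Matrix (Fin (k + 1)) (Fin (k + 1)) ℝ) = _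
      rw [Units.val_mul, Units.val_mul, hgval, hv, hPmul, mul_assoc, ← hgval, ← Units.val_mul,
        mul_inv_cancel, Units.val_one, mul_one]
  · rintro ⟨v, hv, ht⟩
    refine ⟨g⁻¹ * t * g, ?_, by simp [mul_assoc]⟩
    have h1 : ((g⁻¹ * t * g : GLR (k + 1)) : Matrix (Fin (k + 1)) (Fin (k + 1)) ℝ) =
        ∑ j, v j • a j := by
      rw [Units.val_mul, Units.val_mul, ht, hgval, mul_assoc, ← hPmul, ← mul_assoc, ← hgval,
        ← Units.val_mul, inv_mul_cancel, Units.val_one, one_mul]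
    have h2 := hnil v
    rw [hv, one_smul, ← h1] at h2
    exact (hS.mem_iff _).2 h2

/-- Evaluation at `ξ` gives the algebra dimension `k + 1`, and the scalars are a complement of the
nilpotent part. -/
theorem IsRegular.finrank_nilPart (hS : IsRegular S ξ) : Module.finrank ℝ (nilPart S) = k := by
  let R : groupAlgebra S →ₗ[ℝ] (Fin (k + 1) → ℝ) :=
    { toFun := fun M => ξ ᵥ* (M : Matrix (Fin (k + 1)) (Fin (k + 1)) ℝ)
      map_add' := fun M N => Matrix.vecMul_add _ _ _
      map_smul' := fun c M => Matrix.vecMul_smul _ _ _ }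
  have hR : Function.Bijective R := by
    refine ⟨(injective_iff_map_eq_zero R).2 fun M hM => ?_, fun v => ?_⟩
    · exact Subtype.ext (hS.eq_zero M.2 hM)
    · obtain ⟨M, hM, hv⟩ := hS.cyclic v
      exact ⟨⟨M, hM⟩, hv⟩
  have h1 : Module.finrank ℝ (Subalgebra.toSubmodule (groupAlgebra S)) = k + 1 := by
    have := (LinearEquiv.ofBijective R hR).finrank_eq
    rw [Module.finrank_fin_fun] at this
    exact this
  have h2 : nilPart S ⊔ Submodule.span ℝ {(1 : Matrix (Fin (k + 1)) (Fin (k + 1)) ℝ)} =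
      Subalgebra.toSubmodule (groupAlgebra S) := by
    apply le_antisymm
    · refine sup_le (fun M hM => hM.1) ?_
      rw [Submodule.span_singleton_le_iff_mem]
      exact one_mem (groupAlgebra S)
    · intro M hM
      obtain ⟨c, hc⟩ := hS.tri hM
      exact Submodule.mem_sup.2 ⟨_, hc, c • 1,
        Submodule.smul_mem _ _ (Submodule.mem_span_singleton_self _), sub_add_cancel _ _⟩
  have h3 : nilPart S ⊓ Submodule.span ℝ {(1 : Matrix (Fin (k + 1)) (Fin (k + 1)) ℝ)} = ⊥ := by
    rw [Submodule.eq_bot_iff]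
    rintro M ⟨hM, hM'⟩
    obtain ⟨c, rfl⟩ := Submodule.mem_span_singleton.1 hM'
    rw [IsRegular.smul_one_mem_nilPart_iff.1 hM, zero_smul]
  have h4 := Submodule.finrank_sup_add_finrank_inf_eq (nilPart S)
    (Submodule.span ℝ {(1 : Matrix (Fin (k + 1)) (Fin (k + 1)) ℝ)})
  rw [h2, h3, h1, finrank_bot, finrank_span_singleton one_ne_zero] at h4
  omega

/-- The scalar part of a nilpotent element is a difference of commuting nilpotents, hence zero. -/
theorem IsRegular.mem_nilPart_of_isNilpotent (hS : IsRegular S ξ)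
    {M : groupAlgebra S} (hM : IsNilpotent M) :
    (M : Matrix (Fin (k + 1)) (Fin (k + 1)) ℝ) ∈ nilPart S := by
  obtain ⟨c, hc⟩ := hS.tri M.2
  have h1 : IsNilpotent (M : Matrix (Fin (k + 1)) (Fin (k + 1)) ℝ) := hM.map (groupAlgebra S).val
  have h2 : IsNilpotent ((M : Matrix (Fin (k + 1)) (Fin (k + 1)) ℝ) - c • 1) :=
    ⟨k + 1, hc.2.pow_eq_zero le_rfl⟩
  have h3 := Commute.isNilpotent_sub (hS.comm M.2 hc.1) h1 h2
  rw [sub_sub_cancel] at h3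
  obtain ⟨n, hn⟩ := h3
  rw [smul_pow, one_pow] at hn
  have h4 : c ^ n = 0 := by simpa using congrFun (congrFun hn 0) 0
  rw [eq_zero_of_pow_eq_zero h4, zero_smul, sub_zero] at hc
  exact hc

/-- A single element with `x ^ n ≠ 0` rules out every smaller exponent, through the constant family.
-/
theorem IsRegular.hasNilpotencyClass (hS : IsRegular S ξ) {n : ℕ}
    (hprod : ∀ f : Fin (n + 1) → Matrix (Fin (k + 1)) (Fin (k + 1)) ℝ, (∀ i, f i ∈ nilPart S) →
      (List.ofFn f).prod = 0)
    {x : Matrix (Fin (k + 1)) (Fin (k + 1)) ℝ} (hx : x ∈ nilPart S) (hxn : x ^ n ≠ 0) :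
    HasNilpotencyClass (groupAlgebra S) (n + 1) := by
  refine ⟨fun f hf => ?_, fun m hm => ?_⟩
  · have h1 := hprod (fun i => (f i : Matrix (Fin (k + 1)) (Fin (k + 1)) ℝ))
      fun i => hS.mem_nilPart_of_isNilpotent (hf i)
    apply Subtype.ext
    change (groupAlgebra S).val _ = 0
    rw [map_list_prod, List.map_ofFn]
    exact h1
  · by_contra hlt
    have h1 := hm (fun _ => ⟨x, hx.1⟩) fun _ =>
      ⟨k + 1, Subtype.ext (hx.2.pow_eq_zero le_rfl)⟩
    rw [List.ofFn_const, List.prod_replicate] at h1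
    have h2 : x ^ m = 0 := congrArg Subtype.val h1
    exact hxn (pow_eq_zero_of_le (by omega) h2)

end Regular

/-! ### Commutative local algebras of dimension three and four -/

section Classification

/-- Polarisation of the square. -/
theorem nilPart_mul_eq_zero_of_sq {k : ℕ} {S : Subgroup (GLR (k + 1))} {ξ : Fin (k + 1) → ℝ}
    (hS : IsRegular S ξ) (h : ∀ x ∈ nilPart S, x * x = 0) {x y} (hx : x ∈ nilPart S)
    (hy : y ∈ nilPart S) : x * y = 0 := by
  have h1 := h _ (add_mem hx hy)
  rw [add_mul, mul_add, mul_add, h x hx, h y hy, hS.comm hy.1 hx.1, zero_add, add_zero,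
    ← two_smul ℝ] at h1
  exact (smul_eq_zero.1 h1).resolve_left two_ne_zero

/-- Polarisation in two stages: `(x + y)³ - (x - y)³ = 6x²y + 2y³` gives `x²y = 0`, and polarising
in `x` gives the trilinear statement. -/
theorem nilPart_mul_eq_zero_of_cube {k : ℕ} {S : Subgroup (GLR (k + 1))} {ξ : Fin (k + 1) → ℝ}
    (hS : IsRegular S ξ) (h : ∀ x ∈ nilPart S, x * x * x = 0) {x y z} (hx : x ∈ nilPart S)
    (hy : y ∈ nilPart S) (hz : z ∈ nilPart S) : x * y * z = 0 := by
  have key : ∀ x ∈ nilPart S, ∀ y ∈ nilPart S, x * x * y = 0 := by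
    intro x hx y hy
    have c := hS.comm hy.1 hx.1
    have e1 : y * x * x = x * x * y := by rw [c, mul_assoc, c, ← mul_assoc]
    have e2 : x * y * x = x * x * y := by rw [mul_assoc, c, ← mul_assoc]
    have e3 : y * x * y = x * y * y := by rw [c]
    have e4 : y * y * x = x * y * y := by rw [mul_assoc, c, ← mul_assoc, c]
    have h1 := h _ (add_mem hx hy)
    have h2 := h _ (sub_mem hx hy)
    simp only [add_mul, mul_add, sub_mul, mul_sub, h x hx, h y hy, e1, e2, e3, e4] at h1 h2
    have h3 : (6 : ℝ) • (x * x * y) = 0 := by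
      linear_combination (norm := module) h1 - h2
    exact (smul_eq_zero.1 h3).resolve_left (by norm_num)
  have c := hS.comm hz.1 hx.1
  have h1 := key _ (add_mem hx hz) y hy
  simp only [add_mul, mul_add, key x hx y hy, key z hz y hy, c, zero_add, add_zero] at h1
  rw [← two_smul ℝ] at h1
  have h2 := (smul_eq_zero.1 h1).resolve_left two_ne_zero
  rw [mul_assoc, hS.comm hy.1 hz.1, ← mul_assoc, h2]

/-- All products of nilpotents vanish, so any basis of the nilpotent part realises the standard
table. -/
theorem IsRegular.standard {k : ℕ} {S : Subgroup (GLR (k + 1))} {ξ : Fin (k + 1) → ℝ}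
    (hS : IsRegular S ξ) (hk : 1 ≤ k) (h : ∀ x ∈ nilPart S, x * x = 0) :
    HasNilpotencyClass (groupAlgebra S) 2 ∧ AreConjugate S (standardShearing (k + 1)) := by
  have h2 : ∀ {x y}, x ∈ nilPart S → y ∈ nilPart S → x * y = 0 :=
    nilPart_mul_eq_zero_of_sq hS h
  let b := Module.finBasisOfFinrankEq ℝ (nilPart S) hS.finrank_nilPart
  constructor
  · refine hS.hasNilpotencyClass (fun f hf => ?_) (b ⟨0, hk⟩).2 ?_
    · simp [List.ofFn_succ, h2 (hf 0) (hf 1)]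
    · rw [pow_one]
      exact fun h0 => b.ne_zero ⟨0, hk⟩ (Subtype.ext h0)
  · rw [← shearing_standard]
    refine hS.areConjugate (isShearletChart_standard k) (Fin.cons 1 fun i => (b i).1) rfl
      (fun i => (b i).2) (fun c hc => ?_) (fun i v => ?_)
    · have h3 : ∑ i, c i • b i = 0 := Subtype.ext (by simpa using hc)
      exact funext (Fintype.linearIndependent_iff.1 b.linearIndependent c h3)
    · have h3 : ∀ j, (b i).1 * (b j).1 = 0 := fun j => h2 (b i).2 (b j).2
      simp [Fin.sum_univ_succ, mul_add, Finset.mul_sum, h3, standardChart_apply, Fin.succ_ne_zero]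

/-- The powers of `x` form a basis with the Toeplitz table; multiplying a relation by `x` isolates
its lowest coefficient. -/
theorem IsRegular.toeplitz_three {S : Subgroup (GLR 3)} {ξ : Fin 3 → ℝ}
    (hS : IsRegular S ξ) {x} (hx : x ∈ nilPart S) (hx2 : x * x ≠ 0) :
    HasNilpotencyClass (groupAlgebra S) 3 ∧ AreConjugate S (toeplitzShearing 3) := by
  have h3 : ∀ {x y z : Matrix (Fin 3) (Fin 3) ℝ}, x ∈ nilPart S → y ∈ nilPart S → z ∈ nilPart S →
      x * y * z = 0 := fun hx hy hz => ((hx.2.mul hy.2).mul hz.2).eq_zero (by norm_num)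
  have hxxx := h3 hx hx hx
  have hxxx' : x * (x * x) = 0 := by rw [← mul_assoc, hxxx]
  constructor
  · refine hS.hasNilpotencyClass (n := 2) (fun f hf => ?_) hx (by rwa [pow_two])
    simpa [List.ofFn_succ, mul_assoc] using h3 (hf 0) (hf 1) (hf 2)
  · have := shearing_toeplitz 2
    rw [← this]
    refine hS.areConjugate (isShearletChart_toeplitz 2) ![1, x, x * x] rfl
      (fun i => ?_) (fun c hc => ?_) (fun i v => ?_)
    · fin_cases i
      · exact hx
      · exact mul_mem_nilPart hx hx
    · simp only [Fin.sum_univ_two] at hc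
      change c 0 • x + c 1 • (x * x) = 0 at hc
      have h4 := congrArg (x * ·) hc
      simp only [mul_add, mul_smul_comm, hxxx', smul_zero, add_zero, mul_zero] at h4
      have h0 := (smul_eq_zero.1 h4).resolve_right hx2
      rw [h0, zero_smul, zero_add] at hc
      have h1 := (smul_eq_zero.1 hc).resolve_right hx2
      ext i
      fin_cases i
      · exact h0
      · exact h1
    · fin_cases i <;>
      simp [Fin.sum_univ_three, mul_add, toeplitzChart_apply, hxxx, hxxx', mul_assoc]

theorem IsRegular.toeplitz_four {S : Subgroup (GLR 4)} {ξ : Fin 4 → ℝ}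
    (hS : IsRegular S ξ) {x} (hx : x ∈ nilPart S) (hx3 : x * x * x ≠ 0) :
    HasNilpotencyClass (groupAlgebra S) 4 ∧ AreConjugate S (toeplitzShearing 4) := by
  have h4 : ∀ {x y z w : Matrix (Fin 4) (Fin 4) ℝ}, x ∈ nilPart S → y ∈ nilPart S →
      z ∈ nilPart S → w ∈ nilPart S → x * y * z * w = 0 := fun hx hy hz hw =>
    (((hx.2.mul hy.2).mul hz.2).mul hw.2).eq_zero (by norm_num)
  have e4 : x * (x * (x * x)) = 0 := by simpa [mul_assoc] using h4 hx hx hx hx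
  rw [mul_assoc] at hx3
  constructor
  · refine hS.hasNilpotencyClass (n := 3) (fun f hf => ?_) hx (by
      rwa [pow_succ, pow_two, mul_assoc])
    simpa [List.ofFn_succ, mul_assoc] using h4 (hf 0) (hf 1) (hf 2) (hf 3)
  · have := shearing_toeplitz 3
    rw [← this]
    refine hS.areConjugate (isShearletChart_toeplitz 3) ![1, x, x * x, x * (x * x)] rfl
      (fun i => ?_) (fun c hc => ?_) (fun i v => ?_)
    · fin_cases i
      · exact hx
      · exact mul_mem_nilPart hx hx
      · exact mul_mem_nilPart hx (mul_mem_nilPart hx hx)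
    · simp only [Fin.sum_univ_three] at hc
      change c 0 • x + c 1 • (x * x) + c 2 • (x * (x * x)) = 0 at hc
      have h5 := congrArg (fun m => x * (x * m)) hc
      simp only [mul_add, mul_smul_comm, e4, smul_zero, add_zero, mul_zero] at h5
      have h0 := (smul_eq_zero.1 h5).resolve_right hx3
      rw [h0, zero_smul, zero_add] at hc
      have h6 := congrArg (fun m => x * m) hc
      simp only [mul_add, mul_smul_comm, e4, smul_zero, add_zero, mul_zero] at h6
      have h1 := (smul_eq_zero.1 h6).resolve_right hx3
      rw [h1, zero_smul, zero_add] at hc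
      have h2 := (smul_eq_zero.1 hc).resolve_right hx3
      ext i
      fin_cases i
      · exact h0
      · exact h1
      · exact h2
    · fin_cases i <;>
      simp [Fin.sum_univ_four, mul_add, toeplitzChart_apply, e4, mul_assoc]

theorem IsRegular.h_of_table {S : Subgroup (GLR 4)} {ξ : Fin 4 → ℝ}
    (hS : IsRegular S ξ) {x y} {a : ℝ} (hx : x ∈ nilPart S) (hy : y ∈ nilPart S)
    (hx2 : x * x ≠ 0) (hxxx : x * (x * x) = 0) (hxy : x * y = 0) (hyy : y * y = a • (x * x))
    (hli : ∀ c d : ℝ, y ≠ c • x + d • (x * x)) : AreConjugate S (hShearing a) := by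
  have hyx : y * x = 0 := by rw [hS.comm hy.1 hx.1, hxy]
  have hyxx : y * (x * x) = 0 := by rw [← mul_assoc, hyx, zero_mul]
  rw [← shearing_h]
  refine hS.areConjugate (isShearletChart_h a) ![1, x, y, x * x] rfl
    (fun i => ?_) (fun c hc => ?_) (fun i v => ?_)
  · fin_cases i
    · exact hx
    · exact hy
    · exact mul_mem_nilPart hx hx
  · simp only [Fin.sum_univ_three] at hc
    change c 0 • x + c 1 • y + c 2 • (x * x) = 0 at hc
    have h5 := congrArg (fun m => x * m) hc
    simp only [mul_add, mul_smul_comm, hxxx, hxy, smul_zero, add_zero, mul_zero] at h5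
    have h0 := (smul_eq_zero.1 h5).resolve_right hx2
    rw [h0, zero_smul, zero_add] at hc
    have h1 : c 1 = 0 := by
      by_contra h1
      refine hli 0 (-((c 1)⁻¹ * c 2)) ?_
      rw [zero_smul, zero_add, neg_smul, mul_smul, eq_neg_of_add_eq_zero_right hc, smul_neg,
        neg_neg, smul_smul, inv_mul_cancel₀ h1, one_smul]
    rw [h1, zero_smul, zero_add] at hc
    have h2 := (smul_eq_zero.1 hc).resolve_right hx2
    ext i
    fin_cases i
    · exact h0
    · exact h1
    · exact h2
  · fin_cases i <;>
    simp [Fin.sum_univ_four, mul_add, hChart_apply, hMatrix, hxxx, hxy, hyy, hyx, hyxx, mul_comm a,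
      mul_smul, mul_assoc]

/-- Complete `x, x²` to a basis by some `w`. Vanishing triple products force `x w` to be a multiple
`r x²`, so `y = w - r x` satisfies `x y = 0`; then `y³ = 0` removes the `y`-component of `y²`. -/
theorem IsRegular.exists_square_table {S : Subgroup (GLR 4)} {ξ : Fin 4 → ℝ}
    (hS : IsRegular S ξ)
    (h3 : ∀ {x y z}, x ∈ nilPart S → y ∈ nilPart S → z ∈ nilPart S → x * y * z = 0)
    {x} (hx : x ∈ nilPart S) (hx2 : x * x ≠ 0) :
    ∃ (y : _) (b : ℝ), y ∈ nilPart S ∧ y ∉ Submodule.span ℝ (Set.range ![x, x * x]) ∧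
      x * y = 0 ∧ y * y = b • (x * x) := by
  have hz := mul_mem_nilPart hx hx
  have xz : x * (x * x) = 0 := by rw [← mul_assoc, h3 hx hx hx]
  have hli : LinearIndependent ℝ ![x, x * x] := by
    rw [LinearIndependent.pair_iff]
    intro c d hcd
    have h0 := congrArg (x * ·) hcd
    simp only [mul_add, mul_smul_comm, xz, smul_zero, add_zero, mul_zero] at h0
    have hc := (smul_eq_zero.1 h0).resolve_right hx2
    rw [hc, zero_smul, zero_add] at hcd
    exact ⟨hc, (smul_eq_zero.1 hcd).resolve_right hx2⟩
  obtain ⟨w, hw, hws⟩ : ∃ w ∈ nilPart S, w ∉ Submodule.span ℝ (Set.range ![x, x * x]) := by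
    by_contra! h
    have h1 := Submodule.finrank_mono (R := ℝ) (s := nilPart S) h
    rw [finrank_span_eq_card hli, hS.finrank_nilPart, Fintype.card_fin] at h1
    omega
  have hli3 : LinearIndependent ℝ ![w, x, x * x] := linearIndependent_finCons.2 ⟨hli, hws⟩
  have hspan : Submodule.span ℝ (Set.range ![w, x, x * x]) = nilPart S := by
    refine Submodule.eq_of_le_of_finrank_eq ?_ ?_
    · rw [Submodule.span_le]
      rintro _ ⟨i, rfl⟩
      fin_cases i
      · exact hw
      · exact hx
      · exact hz
    · rw [finrank_span_eq_card hli3, hS.finrank_nilPart, Fintype.card_fin]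
  have hrep : ∀ m ∈ nilPart S, ∃ γ α β : ℝ, m = γ • w + α • x + β • (x * x) := by
    intro m hm
    rw [← hspan] at hm
    obtain ⟨c, hc⟩ := (Submodule.mem_span_range_iff_exists_fun ℝ).1 hm
    exact ⟨c 0, c 1, c 2, by rw [← hc]; simp [Fin.sum_univ_three]⟩
  obtain ⟨r, hr⟩ : ∃ r : ℝ, x * w = r • (x * x) := by
    obtain ⟨γ, α, β, h⟩ := hrep _ (mul_mem_nilPart hx hw)
    have h1 := congrArg (x * ·) h
    simp only [mul_add, mul_smul_comm, xz, smul_zero, add_zero] at h1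
    rw [← mul_assoc, h3 hx hx hw] at h1
    by_cases hγ : γ = 0
    · rw [hγ, zero_smul, zero_add] at h1
      rw [hγ, (smul_eq_zero.1 h1.symm).resolve_right hx2] at h
      exact ⟨β, by rw [h]; module⟩
    · refine ⟨-(γ⁻¹ * α), ?_⟩
      rw [neg_smul, mul_smul, eq_neg_of_add_eq_zero_right h1.symm, smul_neg, neg_neg, smul_smul,
        inv_mul_cancel₀ hγ, one_smul]
  have hy : w - r • x ∈ nilPart S := sub_mem hw (Submodule.smul_mem _ _ hx)
  have hxy : x * (w - r • x) = 0 := by rw [mul_sub, hr, mul_smul_comm, sub_self]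
  have hys : w - r • x ∉ Submodule.span ℝ (Set.range ![x, x * x]) := by
    intro h
    refine hws ?_
    rw [← sub_add_cancel w (r • x)]
    exact add_mem h (Submodule.smul_mem _ _ (Submodule.subset_span ⟨0, rfl⟩))
  obtain ⟨γ, α, β, h⟩ := hrep _ (mul_mem_nilPart hy hy)
  have h1 : γ * r + α = 0 := by
    have h1 := congrArg (x * ·) h
    simp only [mul_add, mul_smul_comm, xz, smul_zero, add_zero, hr] at h1
    rw [← mul_assoc, hxy, zero_mul, smul_smul, ← add_smul] at h1
    exact (smul_eq_zero.1 h1.symm).resolve_right hx2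
  have h2 : (w - r • x) * (w - r • x) = γ • (w - r • x) + β • (x * x) := by
    rw [h, eq_neg_of_add_eq_zero_right h1]
    module
  have h4 : γ • ((w - r • x) * (w - r • x)) = 0 := by
    have h5 := congrArg ((w - r • x) * ·) h2
    simp only [mul_add, mul_smul_comm] at h5
    rw [← mul_assoc, h3 hy hy hy, ← mul_assoc (w - r • x) x, h3 hy hx hx, smul_zero, add_zero] at h5
    exact h5.symm
  -- Either the coefficient `γ` vanishes, or `y² = 0` and the table holds with `b = 0`.
  rcases smul_eq_zero.1 h4 with h5 | h5
  · rw [h5, zero_smul, zero_add] at h2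
    exact ⟨_, β, hy, hys, hxy, h2⟩
  · exact ⟨_, 0, hy, hys, hxy, by rw [h5, zero_smul]⟩

/-- Rescaling `y` by `c` multiplies `b` by `c²`, and over `ℝ` only the sign of `b` survives. -/
theorem exists_normalizing_scalar (b : ℝ) :
    ∃ c : ℝ, c ≠ 0 ∧ c * c * b ∈ ({-1, 0, 1} : Set ℝ) := by
  rcases eq_or_ne b 0 with rfl | hb
  · exact ⟨1, one_ne_zero, by simp⟩
  · have h1 : 0 < |b| := abs_pos.2 hb
    refine ⟨(√|b|)⁻¹, (inv_pos.2 (Real.sqrt_pos.2 h1)).ne', ?_⟩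
    rw [← mul_inv, Real.mul_self_sqrt h1.le]
    rcases abs_cases b with ⟨h, -⟩ | ⟨h, -⟩
    · rw [h, inv_mul_cancel₀ hb]
      simp
    · rw [h, inv_neg, neg_mul, inv_mul_cancel₀ hb]
      simp

theorem IsRegular.exists_h {S : Subgroup (GLR 4)} {ξ : Fin 4 → ℝ} (hS : IsRegular S ξ)
    (h : ∀ x ∈ nilPart S, x * x * x = 0) {x} (hx : x ∈ nilPart S) (hx2 : x * x ≠ 0) :
    HasNilpotencyClass (groupAlgebra S) 3 ∧
      ∃ a ∈ ({-1, 0, 1} : Set ℝ), AreConjugate S (hShearing a) := by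
  have h3 : ∀ {x y z}, x ∈ nilPart S → y ∈ nilPart S → z ∈ nilPart S → x * y * z = 0 :=
    nilPart_mul_eq_zero_of_cube hS h
  constructor
  · refine hS.hasNilpotencyClass (n := 2) (fun f hf => ?_) hx (by rwa [pow_two])
    simpa [List.ofFn_succ, mul_assoc] using h3 (hf 0) (hf 1) (hf 2)
  · obtain ⟨y, b, hy, hys, hxy, hyy⟩ := hS.exists_square_table h3 hx hx2
    obtain ⟨c, hc, hcb⟩ := exists_normalizing_scalar b
    refine ⟨_, hcb, hS.h_of_table (y := c • y) hx (Submodule.smul_mem _ _ hy) hx2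
      (by rw [← mul_assoc, h x hx]) (by rw [mul_smul_comm, hxy, smul_zero])
      (by rw [smul_mul_smul_comm, hyy, smul_smul]) fun p q hpq => hys ?_⟩
    rw [← inv_smul_smul₀ hc y, hpq]
    exact Submodule.smul_mem _ _ (add_mem
      (Submodule.smul_mem _ _ (Submodule.subset_span ⟨0, rfl⟩))
      (Submodule.smul_mem _ _ (Submodule.subset_span ⟨1, rfl⟩)))

theorem IsShearingSubgroup.classification_three {S : Subgroup (GLR 3)}
    (hS : IsShearingSubgroup S) :
    (HasNilpotencyClass (groupAlgebra S) 2 ∧ AreConjugate S (standardShearing 3)) ∨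
      (HasNilpotencyClass (groupAlgebra S) 3 ∧ AreConjugate S (toeplitzShearing 3)) := by
  obtain ⟨ξ, h⟩ := hS.exists_isRegular (k := 2) (by norm_num)
  by_cases h2 : ∀ x ∈ nilPart S, x * x = 0
  · exact Or.inl (h.standard (k := 2) (by norm_num) h2)
  · push Not at h2
    obtain ⟨x, hx, hx2⟩ := h2
    exact Or.inr (h.toeplitz_three hx hx2)

theorem IsShearingSubgroup.classification_four {S : Subgroup (GLR 4)}
    (hS : IsShearingSubgroup S) :
    (HasNilpotencyClass (groupAlgebra S) 2 ∧ AreConjugate S (standardShearing 4)) ∨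
      (HasNilpotencyClass (groupAlgebra S) 4 ∧ AreConjugate S (toeplitzShearing 4)) ∨
      (HasNilpotencyClass (groupAlgebra S) 3 ∧
        ∃ a ∈ ({-1, 0, 1} : Set ℝ), AreConjugate S (hShearing a)) := by
  obtain ⟨ξ, h⟩ := hS.exists_isRegular (k := 3) (by norm_num)
  by_cases h2 : ∀ x ∈ nilPart S, x * x = 0
  · exact Or.inl (h.standard (k := 3) (by norm_num) h2)
  · push Not at h2
    obtain ⟨x, hx, hx2⟩ := h2
    by_cases h3 : ∀ x ∈ nilPart S, x * x * x = 0
    · exact Or.inr (Or.inr (h.exists_h h3 hx hx2))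
    · push Not at h3
      obtain ⟨y, hy, hy3⟩ := h3
      exact Or.inr (Or.inl (h.toeplitz_four hy hy3))

end Classification

/-! ### Conjugacy invariants that separate the models -/

section Invariants

variable {d : ℕ}

/-- The set of all `s - 1` with `s ∈ S`. -/
def unipotentParts (S : Subgroup (GLR d)) : Set (Matrix (Fin d) (Fin d) ℝ) :=
  {n | ∃ s ∈ S, (s : Matrix (Fin d) (Fin d) ℝ) = 1 + n}

/-- Conjugation by `g` as a ring automorphism of the matrix algebra. -/
def conjRingEquiv (g : GLR d) : Matrix (Fin d) (Fin d) ℝ ≃+* Matrix (Fin d) (Fin d) ℝ where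
  toFun M := g * M * (g⁻¹ : GLR d)
  invFun M := (g⁻¹ : GLR d) * M * g
  left_inv M := by simp [mul_assoc]
  right_inv M := by simp [mul_assoc]
  map_add' M N := by simp [mul_add, add_mul]
  map_mul' M N := by simp [mul_assoc]

theorem conjRingEquiv_apply (g : GLR d) (M : Matrix (Fin d) (Fin d) ℝ) :
    conjRingEquiv g M = g * M * (g⁻¹ : GLR d) := rfl

/-- Conjugation is a ring automorphism, so any property of `S - 1` phrased through products and zero
is a conjugacy invariant. -/
theorem AreConjugate.exists_image {S S' : Subgroup (GLR d)} (h : AreConjugate S S') :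
    ∃ φ : Matrix (Fin d) (Fin d) ℝ ≃+* Matrix (Fin d) (Fin d) ℝ,
      unipotentParts S' = φ '' unipotentParts S := by
  obtain ⟨g, rfl⟩ := h
  refine ⟨conjRingEquiv g, ?_⟩
  have hval : ∀ s : GLR d, conjRingEquiv g (s : Matrix (Fin d) (Fin d) ℝ) =
      (g * s * g⁻¹ : GLR d) := fun s => by
    rw [conjRingEquiv_apply, Units.val_mul, Units.val_mul]
  ext n
  constructor
  · rintro ⟨_, ⟨s, hs, rfl⟩, hn⟩
    refine ⟨s - 1, ⟨s, hs, (add_sub_cancel _ _).symm⟩, ?_⟩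
    rw [map_sub, map_one, hval, sub_eq_iff_eq_add']
    exact hn
  · rintro ⟨m, ⟨s, hs, hm⟩, rfl⟩
    refine ⟨_, ⟨s, hs, rfl⟩, ?_⟩
    rw [← map_one (conjRingEquiv g), ← map_add, ← hm, hval]
    rfl

theorem AreConjugate.symm {S S' : Subgroup (GLR d)} (h : AreConjugate S S') :
    AreConjugate S' S := by
  obtain ⟨g, rfl⟩ := h
  refine ⟨g⁻¹, ?_⟩
  ext s
  simp [Subgroup.mem_map, mul_assoc]

theorem AreConjugate.trans {S S' S'' : Subgroup (GLR d)} (h : AreConjugate S S')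
    (h' : AreConjugate S' S'') : AreConjugate S S'' := by
  obtain ⟨g, rfl⟩ := h
  obtain ⟨g', rfl⟩ := h'
  refine ⟨g' * g, ?_⟩
  rw [Subgroup.map_map]
  congr 1
  ext s
  simp [mul_assoc]

theorem IsShearletChart.mem_unipotentParts {k : ℕ}
    {L : (Fin (k + 1) → ℝ) →ₗ[ℝ] Matrix (Fin (k + 1)) (Fin (k + 1)) ℝ} (hL : IsShearletChart L)
    {n : Matrix (Fin (k + 1)) (Fin (k + 1)) ℝ} :
    n ∈ unipotentParts hL.shearing ↔ ∃ v, v 0 = 0 ∧ n = L v := by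
  constructor
  · rintro ⟨s, hs, hn⟩
    obtain ⟨v, hv, hs⟩ := hL.mem_shearing.1 hs
    refine ⟨v - Pi.single 0 1, by simp [hv], ?_⟩
    rw [map_sub, hL.one, ← hs, hn, add_sub_cancel_left]
  · rintro ⟨v, hv, rfl⟩
    have hw : (v + Pi.single 0 1 : Fin (k + 1) → ℝ) 0 = 1 := by simp [hv]
    have hu : IsUnit (L (v + Pi.single 0 1)) := by
      rw [Matrix.isUnit_iff_isUnit_det, hL.det, hw, one_pow]
      exact isUnit_one
    refine ⟨hu.unit, hL.mem_shearing.2 ⟨_, hw, rfl⟩, ?_⟩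
    change L (v + Pi.single 0 1) = _
    rw [map_add, hL.one]
    exact add_comm _ _

theorem AreConjugate.mul_eq_zero {S S' : Subgroup (GLR d)} (h : AreConjugate S S')
    (hS : ∀ n ∈ unipotentParts S, ∀ m ∈ unipotentParts S, n * m = 0) :
    ∀ n ∈ unipotentParts S', ∀ m ∈ unipotentParts S', n * m = 0 := by
  obtain ⟨φ, hφ⟩ := h.exists_image
  simpa only [hφ, Set.forall_mem_image, ← map_mul, EmbeddingLike.map_eq_zero_iff] using hS

theorem AreConjugate.cube_eq_zero {S S' : Subgroup (GLR d)} (h : AreConjugate S S')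
    (hS : ∀ n ∈ unipotentParts S, n * n * n = 0) :
    ∀ n ∈ unipotentParts S', n * n * n = 0 := by
  obtain ⟨φ, hφ⟩ := h.exists_image
  simpa only [hφ, Set.forall_mem_image, ← map_mul, EmbeddingLike.map_eq_zero_iff] using hS

theorem AreConjugate.annihilates {S S' : Subgroup (GLR d)} (h : AreConjugate S S')
    (hS : ∀ n ∈ unipotentParts S, n * n = 0 → ∀ m ∈ unipotentParts S, n * m = 0) :
    ∀ n ∈ unipotentParts S', n * n = 0 → ∀ m ∈ unipotentParts S', n * m = 0 := by
  obtain ⟨φ, hφ⟩ := h.exists_image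
  simpa only [hφ, Set.forall_mem_image, ← map_mul, EmbeddingLike.map_eq_zero_iff] using hS

theorem AreConjugate.socle_le_sq {S S' : Subgroup (GLR d)} (h : AreConjugate S S')
    (hS : ∀ n ∈ unipotentParts S, (∀ m ∈ unipotentParts S, n * m = 0) →
      ∃ m ∈ unipotentParts S, ∃ l ∈ unipotentParts S, n = m * l) :
    ∀ n ∈ unipotentParts S', (∀ m ∈ unipotentParts S', n * m = 0) →
      ∃ m ∈ unipotentParts S', ∃ l ∈ unipotentParts S', n = m * l := by
  obtain ⟨φ, hφ⟩ := h.exists_image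
  simpa only [hφ, Set.forall_mem_image, Set.exists_mem_image, ← map_mul,
    EmbeddingLike.map_eq_zero_iff, φ.injective.eq_iff] using hS

theorem standard_mul_eq_zero (k : ℕ) : ∀ n ∈ unipotentParts (standardShearing (k + 1)),
    ∀ m ∈ unipotentParts (standardShearing (k + 1)), n * m = 0 := by
  simp only [← shearing_standard, IsShearletChart.mem_unipotentParts]
  rintro _ ⟨v, hv, rfl⟩ _ ⟨w, hw, rfl⟩
  rw [standardChart_mul_apply, hv, hw]
  simp

/-- From dimension three on, the nilpotent shift has a nonzero square. -/
theorem not_areConjugate_standard_toeplitz (k : ℕ) :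
    ¬ AreConjugate (standardShearing (k + 3)) (toeplitzShearing (k + 3)) := by
  intro h
  have h1 := h.mul_eq_zero (standard_mul_eq_zero (k + 2))
  rw [← shearing_toeplitz] at h1
  have h2 : toeplitzChart (k + 2) (Pi.single 1 1) ∈
      unipotentParts (isShearletChart_toeplitz (k + 2)).shearing :=
    (isShearletChart_toeplitz (k + 2)).mem_unipotentParts.2 ⟨_, by simp, rfl⟩
  have h3 := congrFun (congrFun (h1 _ h2 _ h2) 0) 2
  rw [Matrix.mul_apply, Finset.sum_eq_single 1] at h3
  · simp [toeplitzChart_apply, Fin.le_def, Pi.single_apply, Fin.ext_iff] at h3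
    rw [Nat.mod_eq_of_lt (by omega)] at h3
    exact absurd h3 two_ne_zero
  · intro j _ hj
    simp [toeplitzChart_apply, Pi.single_apply, hj]
  · simp

theorem mem_unipotentParts_h {a : ℝ} {n : Matrix (Fin 4) (Fin 4) ℝ} :
    n ∈ unipotentParts (hShearing a) ↔ ∃ t₁ t₂ t₃ : ℝ, n = hMatrix a 0 t₁ t₂ t₃ := by
  rw [← shearing_h]
  refine (isShearletChart_h a).mem_unipotentParts.trans ⟨?_, ?_⟩
  · rintro ⟨v, hv, rfl⟩
    exact ⟨v 1, v 2, v 3, by rw [hChart_apply, hv]⟩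
  · rintro ⟨t₁, t₂, t₃, rfl⟩
    exact ⟨![0, t₁, t₂, t₃], rfl, rfl⟩

theorem hMatrix_inj {a s t₁ t₂ t₃ s' t₁' t₂' t₃' : ℝ} :
    hMatrix a s t₁ t₂ t₃ = hMatrix a s' t₁' t₂' t₃' ↔ s = s' ∧ t₁ = t₁' ∧ t₂ = t₂' ∧ t₃ = t₃' := by
  refine ⟨fun h => ?_, by rintro ⟨rfl, rfl, rfl, rfl⟩; rfl⟩
  have h' := congrFun (congrFun h 0)
  exact ⟨h' 0, h' 1, h' 2, h' 3⟩

theorem hMatrix_zero (a : ℝ) : hMatrix a 0 0 0 0 = 0 := (hChart a).map_zero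

/-- The product is the symmetric form `diag(1, a)` in `(t₁, t₂)` with values in the `t₃`-line. Its
isotropic vectors and its radical tell the three groups apart. -/
theorem hMatrix_mul_nil (a t₁ t₂ t₃ t₁' t₂' t₃' : ℝ) :
    hMatrix a 0 t₁ t₂ t₃ * hMatrix a 0 t₁' t₂' t₃' =
      hMatrix a 0 0 0 (t₁ * t₁' + a * (t₂ * t₂')) := by
  rw [hMatrix_mul]
  congr 1 <;> ring

theorem hMatrix_mul_nil_eq_zero {a t₁ t₂ t₃ t₁' t₂' t₃' : ℝ} :
    hMatrix a 0 t₁ t₂ t₃ * hMatrix a 0 t₁' t₂' t₃' = 0 ↔ t₁ * t₁' + a * (t₂ * t₂') = 0 := by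
  rw [hMatrix_mul_nil, ← hMatrix_zero a, hMatrix_inj]
  simp

theorem not_areConjugate_standard_h (a : ℝ) :
    ¬ AreConjugate (standardShearing 4) (hShearing a) := by
  intro h
  have h1 := h.mul_eq_zero (standard_mul_eq_zero 3) _ (mem_unipotentParts_h.2 ⟨1, 0, 0, rfl⟩) _
    (mem_unipotentParts_h.2 ⟨1, 0, 0, rfl⟩)
  rw [hMatrix_mul_nil_eq_zero] at h1
  norm_num at h1

theorem not_areConjugate_toeplitz_h (a : ℝ) :
    ¬ AreConjugate (toeplitzShearing 4) (hShearing a) := by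
  intro h
  have h1 : ∀ n ∈ unipotentParts (hShearing a), n * n * n = 0 := by
    intro n hn
    obtain ⟨t₁, t₂, t₃, rfl⟩ := mem_unipotentParts_h.1 hn
    rw [hMatrix_mul_nil, hMatrix_mul_nil_eq_zero]
    ring
  have h2 : toeplitzChart 3 (Pi.single 1 1) ∈ unipotentParts (toeplitzShearing 4) := by
    rw [← shearing_toeplitz 3]
    exact (isShearletChart_toeplitz 3).mem_unipotentParts.2 ⟨_, by simp, rfl⟩
  have h3 := congrFun (congrFun (h.symm.cube_eq_zero h1 _ h2) 0) 3
  simp [Matrix.mul_apply, Fin.sum_univ_four, toeplitzChart_apply, Pi.single_apply] at h3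

/-- For `a ≥ 0` the form is semidefinite, so isotropic vectors lie in its radical. -/
theorem h_annihilates {a : ℝ} (ha : 0 ≤ a) : ∀ n ∈ unipotentParts (hShearing a), n * n = 0 →
    ∀ m ∈ unipotentParts (hShearing a), n * m = 0 := by
  intro n hn h m hm
  obtain ⟨t₁, t₂, t₃, rfl⟩ := mem_unipotentParts_h.1 hn
  obtain ⟨s₁, s₂, s₃, rfl⟩ := mem_unipotentParts_h.1 hm
  rw [hMatrix_mul_nil_eq_zero] at h ⊢
  have h1 : t₁ = 0 := by nlinarith [mul_nonneg ha (mul_self_nonneg t₂)]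
  have h2 : a * t₂ = 0 := by
    rw [h1, zero_mul, zero_add, ← mul_assoc] at h
    rcases mul_eq_zero.1 h with h | h
    · exact h
    · rw [h, mul_zero]
  rw [h1, ← mul_assoc, h2]
  ring

theorem not_areConjugate_h_neg_one {a : ℝ} (ha : 0 ≤ a) :
    ¬ AreConjugate (hShearing a) (hShearing (-1)) := by
  intro h
  -- The vector `(1, 1)` is isotropic for `t₁² - t₂²` but not orthogonal to `(1, 0)`.
  have h1 := h.annihilates (h_annihilates ha) _ (mem_unipotentParts_h.2 ⟨1, 1, 0, rfl⟩)
    (by rw [hMatrix_mul_nil_eq_zero]; norm_num) _ (mem_unipotentParts_h.2 ⟨1, 0, 0, rfl⟩)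
  rw [hMatrix_mul_nil_eq_zero] at h1
  norm_num at h1

/-- The form is nondegenerate for `a = 1`, so the annihilator is the `t₃`-line, which consists of
products. -/
theorem h_one_socle_le_sq : ∀ n ∈ unipotentParts (hShearing 1),
    (∀ m ∈ unipotentParts (hShearing 1), n * m = 0) →
      ∃ m ∈ unipotentParts (hShearing 1), ∃ l ∈ unipotentParts (hShearing 1), n = m * l := by
  intro n hn h0
  obtain ⟨t₁, t₂, t₃, rfl⟩ := mem_unipotentParts_h.1 hn
  have h1 := h0 _ (mem_unipotentParts_h.2 ⟨1, 0, 0, rfl⟩)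
  have h2 := h0 _ (mem_unipotentParts_h.2 ⟨0, 1, 0, rfl⟩)
  rw [hMatrix_mul_nil_eq_zero] at h1 h2
  refine ⟨_, mem_unipotentParts_h.2 ⟨1, 0, 0, rfl⟩, _, mem_unipotentParts_h.2 ⟨t₃, 0, 0, rfl⟩, ?_⟩
  rw [hMatrix_mul_nil, hMatrix_inj]
  refine ⟨rfl, ?_, ?_, ?_⟩ <;> linarith

theorem not_areConjugate_h_one_zero : ¬ AreConjugate (hShearing 1) (hShearing 0) := by
  intro h
  -- For `a = 0` the `t₂`-direction is in the radical, yet products only reach the `t₃`-line.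
  have h0 : ∀ m ∈ unipotentParts (hShearing 0), hMatrix 0 0 0 1 0 * m = 0 := by
    intro m hm
    obtain ⟨t₁, t₂, t₃, rfl⟩ := mem_unipotentParts_h.1 hm
    rw [hMatrix_mul_nil_eq_zero]
    ring
  obtain ⟨m, hm, l, hl, hml⟩ :=
    h.socle_le_sq h_one_socle_le_sq _ (mem_unipotentParts_h.2 ⟨0, 1, 0, rfl⟩) h0
  obtain ⟨t₁, t₂, t₃, rfl⟩ := mem_unipotentParts_h.1 hm
  obtain ⟨s₁, s₂, s₃, rfl⟩ := mem_unipotentParts_h.1 hl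
  rw [hMatrix_mul_nil, hMatrix_inj] at hml
  exact one_ne_zero hml.2.2.1

theorem eq_of_areConjugate_h {a b : ℝ} (ha : a ∈ ({-1, 0, 1} : Set ℝ))
    (hb : b ∈ ({-1, 0, 1} : Set ℝ)) (h : AreConjugate (hShearing a) (hShearing b)) : a = b := by
  rcases ha with rfl | rfl | rfl <;> rcases hb with rfl | rfl | rfl
  · rfl
  · exact absurd h.symm (not_areConjugate_h_neg_one le_rfl)
  · exact absurd h.symm (not_areConjugate_h_neg_one zero_le_one)
  · exact absurd h (not_areConjugate_h_neg_one le_rfl)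
  · rfl
  · exact absurd h.symm not_areConjugate_h_one_zero
  · exact absurd h (not_areConjugate_h_neg_one zero_le_one)
  · exact absurd h not_areConjugate_h_one_zero
  · rfl

end Invariants

/-! ### The quotient algebra and its regular representation -/

section RegularRepresentation

variable (a : ℝ)

theorem hGen_zero_pow : hGen a 0 ^ 3 = 0 :=
  Ideal.Quotient.eq_zero_iff_mem.2 (Ideal.subset_span (by simp))

theorem hGen_one_sq : hGen a 1 ^ 2 = a • hGen a 0 ^ 2 := by
  have h : a • hGen a 0 ^ 2 = algebraMap ℝ _ a * hGen a 0 ^ 2 :=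
    congrArg (Ideal.Quotient.mk (hIdeal a)) (Algebra.smul_def a (MvPolynomial.X 0 ^ 2))
  rw [← sub_eq_zero, h]
  exact Ideal.Quotient.eq_zero_iff_mem.2 (Ideal.subset_span (by simp))

theorem hGen_mul : hGen a 0 * hGen a 1 = 0 :=
  Ideal.Quotient.eq_zero_iff_mem.2 (Ideal.subset_span (by simp))

theorem hAlgebra_mul_smul {a : ℝ} (c : ℝ) (z w : HAlgebra a) : z * c • w = c • (z * w) :=
  Algebra.mul_smul_comm _ _ _

/-- The linear combination of `1, X, Y, X²` with given coefficients. -/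
def hLin : (Fin 4 → ℝ) →ₗ[ℝ] HAlgebra a :=
  Fintype.linearCombination ℝ ![1, hGen a 0, hGen a 1, hGen a 0 ^ 2]

theorem hLin_apply (v : Fin 4 → ℝ) :
    hLin a v = v 0 • 1 + v 1 • hGen a 0 + v 2 • hGen a 1 + v 3 • hGen a 0 ^ 2 := by
  simp [hLin, Fintype.linearCombination_apply, Fin.sum_univ_four]

theorem hGen_zero_mul_hLin (v : Fin 4 → ℝ) : hGen a 0 * hLin a v = hLin a ![0, v 0, 0, v 1] := by
  have h : hGen a 0 * hGen a 0 ^ 2 = 0 := by rw [← pow_succ', hGen_zero_pow]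
  simp [hLin_apply, mul_add, hAlgebra_mul_smul, h, hGen_mul, ← pow_two]

theorem hGen_one_mul_hLin (v : Fin 4 → ℝ) :
    hGen a 1 * hLin a v = hLin a ![0, 0, v 0, a * v 2] := by
  have h : hGen a 1 * hGen a 0 = 0 := by rw [mul_comm, hGen_mul]
  have h' : hGen a 1 * hGen a 0 ^ 2 = 0 := by rw [pow_two, ← mul_assoc, h, zero_mul]
  simp [hLin_apply, mul_add, hAlgebra_mul_smul, h, h', ← pow_two, hGen_one_sq,
    smul_smul, mul_comm a]

/-- The span of `1, X, Y, X²` contains the constants and is stable under multiplication by both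
generators. -/
theorem hLin_surjective : Function.Surjective (hLin a) := by
  intro z
  obtain ⟨p, rfl⟩ := Ideal.Quotient.mk_surjective z
  induction p using MvPolynomial.induction_on with
  | C c =>
    refine ⟨![c, 0, 0, 0], ?_⟩
    simp only [hLin_apply, Matrix.cons_val, zero_smul, add_zero]
    rw [← Algebra.algebraMap_eq_smul_one]
    rfl
  | add p q hp hq =>
    obtain ⟨v, hv⟩ := hp
    obtain ⟨w, hw⟩ := hq
    exact ⟨v + w, by rw [map_add, map_add, hv, hw]⟩
  | mul_X p i hp =>
    obtain ⟨v, hv⟩ := hp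
    rw [map_mul, ← hv, mul_comm]
    fin_cases i
    · exact ⟨_, (hGen_zero_mul_hLin a v).symm⟩
    · exact ⟨_, (hGen_one_mul_hLin a v).symm⟩

/-- The span of `H_a`, as a subalgebra. -/
def hSubalgebra : Subalgebra ℝ (Matrix (Fin 4) (Fin 4) ℝ) where
  carrier := Set.range (hChart a)
  mul_mem' := by
    rintro _ _ ⟨v, rfl⟩ ⟨w, rfl⟩
    exact ⟨_, ((isShearletChart_h a).mul v w).symm⟩
  add_mem' := by
    rintro _ _ ⟨v, rfl⟩ ⟨w, rfl⟩
    exact ⟨_, map_add _ v w⟩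
  algebraMap_mem' c := ⟨c • Pi.single 0 1, by
    rw [map_smul, (isShearletChart_h a).one, Algebra.algebraMap_eq_smul_one]⟩

/-- Polynomial evaluation needs a commutative target, which the full matrix algebra is not. -/
instance : CommRing (hSubalgebra a) :=
  { (inferInstance : Ring (hSubalgebra a)) with
    mul_comm := by
      rintro ⟨_, v, rfl⟩ ⟨_, w, rfl⟩
      exact Subtype.ext ((isShearletChart_h a).comm v w) }

/-- The evaluation of polynomials at the basis elements of the span of `H_a` which correspond to
the parameters `t₁` and `t₂`. -/
def hEval : MvPolynomial (Fin 2) ℝ →ₐ[ℝ] hSubalgebra a :=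
  MvPolynomial.aeval ![⟨hChart a ![0, 1, 0, 0], _, rfl⟩, ⟨hChart a ![0, 0, 1, 0], _, rfl⟩]

theorem hEval_X_zero : (hEval a (.X 0) : Matrix (Fin 4) (Fin 4) ℝ) = hMatrix a 0 1 0 0 := by
  rw [hEval, MvPolynomial.aeval_X]
  rfl

theorem hEval_X_one : (hEval a (.X 1) : Matrix (Fin 4) (Fin 4) ℝ) = hMatrix a 0 0 1 0 := by
  rw [hEval, MvPolynomial.aeval_X]
  rfl

theorem hEval_X_zero_sq :
    ((hEval a (.X 0) ^ 2 : hSubalgebra a) : Matrix (Fin 4) (Fin 4) ℝ) = hMatrix a 0 0 0 1 := by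
  rw [pow_two]
  change (hEval a (.X 0) : Matrix (Fin 4) (Fin 4) ℝ) * hEval a (.X 0) = _
  rw [hEval_X_zero, hMatrix_mul_nil, hMatrix_inj]
  simp

theorem hEval_eq_zero : ∀ p ∈ hIdeal a, hEval a p = 0 := by
  suffices hIdeal a ≤ RingHom.ker (hEval a) from fun p hp => this hp
  refine Ideal.span_le.2 ?_
  rintro p (rfl | rfl | rfl)
  · refine (RingHom.mem_ker).2 (Subtype.ext ?_)
    rw [map_pow, pow_succ]
    change ((hEval a (.X 0) ^ 2 : hSubalgebra a) : Matrix (Fin 4) (Fin 4) ℝ) * hEval a (.X 0) = 0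
    rw [hEval_X_zero_sq, hEval_X_zero, hMatrix_mul_nil_eq_zero]
    simp
  · refine (RingHom.mem_ker).2 ?_
    rw [map_sub, map_mul, ← MvPolynomial.algebraMap_eq, AlgHom.commutes, map_pow, map_pow,
      sub_eq_zero, ← Algebra.smul_def]
    apply Subtype.ext
    change _ = a • ((hEval a (.X 0) ^ 2 : hSubalgebra a) : Matrix (Fin 4) (Fin 4) ℝ)
    rw [hEval_X_zero_sq, pow_two]
    change (hEval a (.X 1) : Matrix (Fin 4) (Fin 4) ℝ) * hEval a (.X 1) = _
    rw [hEval_X_one, hMatrix_mul_nil]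
    have h := (hChart a).map_smul a ![0, 0, 0, 1]
    simp only [hChart_apply] at h
    refine Eq.trans ?_ h
    rw [hMatrix_inj]
    simp
  · refine (RingHom.mem_ker).2 (Subtype.ext ?_)
    rw [map_mul]
    change (hEval a (.X 0) : Matrix (Fin 4) (Fin 4) ℝ) * hEval a (.X 1) = 0
    rw [hEval_X_zero, hEval_X_one, hMatrix_mul_nil_eq_zero]
    simp

/-- The regular representation of `HAlgebra a` by the matrices in the span of `H_a`. -/
def hRep : HAlgebra a →ₐ[ℝ] Matrix (Fin 4) (Fin 4) ℝ :=
  (hSubalgebra a).val.comp (Ideal.Quotient.liftₐ (hIdeal a) (hEval a) (hEval_eq_zero a))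

theorem hRep_hLin (v : Fin 4 → ℝ) : hRep a (hLin a v) = hChart a v := by
  have h0 : hRep a (hGen a 0) = hMatrix a 0 1 0 0 := hEval_X_zero a
  have h1 : hRep a (hGen a 1) = hMatrix a 0 0 1 0 := hEval_X_one a
  rw [hLin_apply, map_add, map_add, map_add, map_smul, map_smul, map_smul, map_smul, map_pow,
    map_one, h0, h1, pow_two, hMatrix_mul_nil]
  ext i j
  fin_cases i <;> fin_cases j <;> simp [hChart_apply, hMatrix, mul_comm]

theorem hRep_injective : Function.Injective (hRep a) := by
  intro z z' h
  obtain ⟨v, rfl⟩ := hLin_surjective a z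
  obtain ⟨w, rfl⟩ := hLin_surjective a z'
  rw [hRep_hLin, hRep_hLin] at h
  rw [(isShearletChart_h a).injective h]

/-- Independence of `1, X, Y, X²` is detected by the matrices that represent them. -/
theorem hLin_injective : Function.Injective (hLin a) := fun v w h =>
  (isShearletChart_h a).injective (by rw [← hRep_hLin, h, hRep_hLin])

/-- The coordinates of an element of `HAlgebra a` in the basis `1, X, Y, X²`. -/
def hCoord : HAlgebra a ≃ₗ[ℝ] (Fin 4 → ℝ) :=
  (LinearEquiv.ofBijective (hLin a) ⟨hLin_injective a, hLin_surjective a⟩).symm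

theorem hCoord_symm (v : Fin 4 → ℝ) : (hCoord a).symm v = hLin a v := rfl

theorem hCoord_hLin (v : Fin 4 → ℝ) : hCoord a (hLin a v) = v := (hCoord a).apply_symm_apply v

theorem hLin_hCoord (z : HAlgebra a) : hLin a (hCoord a z) = z := (hCoord a).symm_apply_apply z

theorem hLin_single (i : Fin 4) :
    hLin a (Pi.single i 1) = ![1, hGen a 0, hGen a 1, hGen a 0 ^ 2] i := by
  simp [hLin]

/-- Under the injective `hRep` this becomes the multiplication rule of the chart. -/
theorem hCoord_mul (z : HAlgebra a) (ξ : Fin 4 → ℝ) :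
    hCoord a (z * (hCoord a).symm ξ) = ξ ᵥ* hRep a z := by
  rw [hCoord_symm, mul_comm, ← hCoord_hLin a (ξ ᵥ* hRep a z)]
  congr 1
  apply hRep_injective
  rw [map_mul, hRep_hLin, hRep_hLin, ← hLin_hCoord a z, hRep_hLin, (isShearletChart_h a).mul]

theorem mem_hGroup_iff (h : GLR 4) : h ∈ hGroup a ↔ ∃ u : (HAlgebra a)ˣ, ∀ ξ : Fin 4 → ℝ,
    (h : Matrix (Fin 4) (Fin 4) ℝ)ᵀ *ᵥ ξ = hCoord a ((u : HAlgebra a) * (hCoord a).symm ξ) := by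
  simp only [hCoord_mul, Matrix.mulVec_transpose]
  constructor
  · intro hh
    obtain ⟨v, -, hv⟩ := (isShearletChart_h a).mem_group.1 ((group_h a).symm ▸ hh)
    -- The inverse matrix also belongs to the group, and its first row gives the inverse of the
    -- unit.
    obtain ⟨w, -, hw⟩ := (isShearletChart_h a).mem_group.1 ((group_h a).symm ▸ inv_mem hh)
    refine ⟨Units.mkOfMulEqOne (hLin a v) (hLin a w) (hRep_injective a ?_), fun ξ => ?_⟩
    · rw [map_mul, hRep_hLin, hRep_hLin, ← hv, ← hw, map_one, ← Units.val_mul, mul_inv_cancel,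
        Units.val_one]
    · rw [Units.val_mkOfMulEqOne, hRep_hLin, hv]
  · rintro ⟨u, hu⟩
    rw [← group_h, (isShearletChart_h a).mem_group]
    have h1 : (h : Matrix (Fin 4) (Fin 4) ℝ) = hChart a (hCoord a u) := by
      rw [← hRep_hLin, hLin_hCoord]
      ext i j
      have := congrFun (hu (Pi.single i 1)) j
      rwa [Matrix.single_one_vecMul, Matrix.single_one_vecMul] at this
    refine ⟨_, fun h0 => ?_, h1⟩
    have h2 := ((Matrix.isUnit_iff_isUnit_det _).1 h.isUnit).ne_zero
    rw [h1, (isShearletChart_h a).det, h0] at h2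
    exact h2 (zero_pow (by norm_num))

end RegularRepresentation
-- Assembly
theorem isShearingSubgroup_standard (k : ℕ) : IsShearingSubgroup (standardShearing (k + 1)) :=
  ⟨_, shearing_standard k ▸ (isShearletChart_standard k).isShearletGroupWith⟩

theorem isShearingSubgroup_toeplitz (k : ℕ) : IsShearingSubgroup (toeplitzShearing (k + 1)) :=
  ⟨_, shearing_toeplitz k ▸ (isShearletChart_toeplitz k).isShearletGroupWith⟩

theorem isShearletGroupWith_h (a : ℝ) : IsShearletGroupWith (hGroup a) (hShearing a) := by
  rw [← shearing_h, ← group_h]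
  exact (isShearletChart_h a).isShearletGroupWith

end ShearletGroups

end

open ShearletGroups
theorem mainTheorem10 :
    -- dimension three
    (IsShearingSubgroup (standardShearing 3) ∧
      IsShearingSubgroup (toeplitzShearing 3) ∧
      ¬ AreConjugate (standardShearing 3)
        (toeplitzShearing 3) ∧
      ∀ S : Subgroup (GL (Fin 3) ℝ), IsShearingSubgroup S →
        (HasNilpotencyClass (groupAlgebra S) 2 ∧
          AreConjugate S (standardShearing 3)) ∨
        (HasNilpotencyClass (groupAlgebra S) 3 ∧
          AreConjugate S (toeplitzShearing 3))) ∧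
    -- dimension four
    (IsShearingSubgroup (standardShearing 4) ∧
      IsShearingSubgroup (toeplitzShearing 4) ∧
      (∀ a ∈ ({-1, 0, 1} : Set ℝ),
        IsShearletGroupWith (hGroup a)
          (hShearing a)) ∧
      ¬ AreConjugate (standardShearing 4)
        (toeplitzShearing 4) ∧
      (∀ a ∈ ({-1, 0, 1} : Set ℝ),
        ¬ AreConjugate (standardShearing 4)
            (hShearing a) ∧
        ¬ AreConjugate (toeplitzShearing 4)
            (hShearing a)) ∧
      (∀ a ∈ ({-1, 0, 1} : Set ℝ), ∀ b ∈ ({-1, 0, 1} : Set ℝ),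
        AreConjugate (hShearing a)
          (hShearing b) → a = b) ∧
      ∀ S : Subgroup (GL (Fin 4) ℝ), IsShearingSubgroup S →
        (HasNilpotencyClass (groupAlgebra S) 2 ∧
          AreConjugate S (standardShearing 4)) ∨
        (HasNilpotencyClass (groupAlgebra S) 4 ∧
          AreConjugate S (toeplitzShearing 4)) ∨
        (HasNilpotencyClass (groupAlgebra S) 3 ∧
          ∃! a : ℝ, a ∈ ({-1, 0, 1} : Set ℝ) ∧
            AreConjugate S (hShearing a))) ∧
    -- the groups `H_a` come from the regular representations of `ℝ[X,Y]/(X³, Y² - aX², XY)`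
    (∀ a ∈ ({-1, 0, 1} : Set ℝ),
      ∃ ψ : HAlgebra a ≃ₗ[ℝ] (Fin 4 → ℝ),
        ψ 1 = Pi.single 0 1 ∧
        ψ (hGen a 0) = Pi.single 1 1 ∧
        ψ (hGen a 1) = Pi.single 2 1 ∧
        ψ (hGen a 0 ^ 2) = Pi.single 3 1 ∧
        ∀ h : GL (Fin 4) ℝ, h ∈ hGroup a ↔
          ∃ u : (HAlgebra a)ˣ, ∀ ξ : Fin 4 → ℝ,
            Matrix.mulVec (Matrix.transpose (h : Matrix (Fin 4) (Fin 4) ℝ)) ξ =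
              ψ ((u : HAlgebra a) * ψ.symm ξ)) := by
  refine ⟨⟨isShearingSubgroup_standard 2, isShearingSubgroup_toeplitz 2,
    not_areConjugate_standard_toeplitz 0, fun S hS => hS.classification_three⟩,
    ⟨isShearingSubgroup_standard 3, isShearingSubgroup_toeplitz 3,
      fun a _ => isShearletGroupWith_h a, not_areConjugate_standard_toeplitz 1,
      fun a _ => ⟨not_areConjugate_standard_h a, not_areConjugate_toeplitz_h a⟩,
      fun a ha b hb => eq_of_areConjugate_h ha hb, fun S hS => ?_⟩, fun a _ => ?_⟩
  · refine hS.classification_four.imp_right (Or.imp_right (And.imp_right ?_))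
    rintro ⟨a, ha, h⟩
    exact ⟨a, ⟨ha, h⟩, fun b hb => eq_of_areConjugate_h hb.1 ha (hb.2.symm.trans h)⟩
  -- Coordinates invert `hLin`, which sends the standard basis vectors to `1, X, Y, X²`.
  · have h := fun i => (congrArg (hCoord a) (hLin_single a i)).symm.trans (hCoord_hLin a _)
    exact ⟨hCoord a, h 0, h 1, h 2, h 3, mem_hGroup_iff a⟩
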